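/- Conventions. Graphs are finite, simple and undirected. A threshold function for a graph $G$ is a function $\tau:V(G)\to\mathbb{Z}$. The hull $H_{(G,\tau)}(D)$ of $D\subseteq V(G)$ is the smallest set $H\subseteq V(G)$ such that $D\subseteq H$ and every vertex $u$ with $|H\cap N_G(u)|\ge\tau(u)$ belongs to $H$. A partial incentive of $(G,\tau)$ is a function $\sigma:V(G)\to\mathbb{N}_0$ with $H_{(G,\tau-\sigma)}(\emptyset)=V(G)$; it is optimal if its weight $\sum_{u\in V(G)}\sigma(u)$ is minimum among all partial incentives of $(G,\tau)$. Time is counted on a random access machine with integer registers and integer arrays (indirect addressing), on which additions, subtractions, comparisons and memory accesses take unit time. The input is $n$, the adjacency matrix of a graph $G$ on the vertices $0,\dots,n-1$, and the list of the thresholds $\tau(u)\in\mathbb{Z}$. Theorem. For a given pair $(G,\tau)$, where $G$ is a graph of order $n$ and treewidth at most $w$, and $\tau$ is a threshold function for $G$, an optimal partial incentive of $(G,\tau)$ can be computed in time $n^{O(w)}$. That is, there are a program and a constant $c$ such that, for all non-negative integers $w$ and $n$, every graph $G$ of order $n$ and treewidth at most $w$, and every threshold function $\tau$ for $G$, the program,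 on input $(G,\tau)$, halts after at most $c\,n^{c\max\{w,1\}}+c$ steps and outputs an optimal partial incentive of $(G,\tau)$. -/

import Mathlib

namespace Incentive

section Graphs

variable {V : Type}

/-- `H` is closed in `(G, τ)`: every vertex `u` with at least `τ u` neighbours in `H` lies in `H`. -/
def IsClosedIn [Finite V] (G : SimpleGraph V) (τ : V → ℤ) (H : Set V) : Prop :=
  ∀ u, τ u ≤ ((H ∩ G.neighborSet u).ncard : ℤ) → u ∈ H

/-- The hull of `D` in `(G, τ)`: the smallest closed set that contains `D`. -/
def hull [Finite V] (G : SimpleGraph V) (τ : V → ℤ) (D : Set V) : Set V :=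
  ⋂₀ {H | D ⊆ H ∧ IsClosedIn G τ H}

/-- `σ` is a partial incentive of `(G, τ)`. -/
def IsPartialIncentive [Finite V] (G : SimpleGraph V) (τ : V → ℤ) (σ : V → ℕ) : Prop :=
  hull G (fun u => τ u - (σ u : ℤ)) ∅ = Set.univ

/-- The weight of a function on the vertices. -/
def weight [Fintype V] (σ : V → ℕ) : ℕ := ∑ u, σ u

/-- `σ` is a partial incentive of `(G, τ)` of minimum weight. -/
def IsOptimalPartialIncentive [Fintype V] (G : SimpleGraph V) (τ : V → ℤ) (σ : V → ℕ) : Prop :=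
  IsPartialIncentive G τ σ ∧ ∀ σ' : V → ℕ, IsPartialIncentive G τ σ' → weight σ ≤ weight σ'

/-- A tree-decomposition of `G`, with a finite tree. A set of nodes of a tree induces a subtree
exactly if it induces a connected (in particular nonempty) graph. -/
structure TreeDecomposition (G : SimpleGraph V) where
  Node : Type
  [nodeFintype : Fintype Node]
  tree : SimpleGraph Node
  isTree : tree.IsTree
  bag : Node → Finset V
  cover : ∀ u, ∃ t, u ∈ bag t
  edge : ∀ u v, G.Adj u v → ∃ t, u ∈ bag t ∧ v ∈ bag t
  subtree : ∀ u, (tree.induce {t | u ∈ bag t}).Connected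

attribute [instance] TreeDecomposition.nodeFintype

/-- The width: the maximum order of a bag, minus one (an integer: `-1` if all bags are empty). -/
def TreeDecomposition.width {G : SimpleGraph V} (D : TreeDecomposition G) : ℤ :=
  ((Finset.univ.sup fun t => (D.bag t).card : ℕ) : ℤ) - 1

/-- The treewidth of `G`, the minimum width of a tree-decomposition, is at most `w`. -/
def TreewidthAtMost (G : SimpleGraph V) (w : ℕ) : Prop :=
  ∃ D : TreeDecomposition G, D.width ≤ (w : ℤ)

end Graphs

/-! ### Random access machine

The memory consists of integer registers and of integer arrays with indirect addressing.
Elementary instructions and tests act on registers and take one unit of time each. The only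
arithmetic is addition and subtraction. -/

/-- A memory content: register `x` holds `reg x`, cell `i` of array `k` holds `arr k i`. -/
structure Memory where
  reg : ℕ → ℤ
  arr : ℕ → ℤ → ℤ

/-- Assignment to a register. -/
def Memory.setReg (m : Memory) (x : ℕ) (a : ℤ) : Memory :=
  { m with reg := Function.update m.reg x a }

/-- Assignment to an array cell. -/
def Memory.setArr (m : Memory) (k : ℕ) (i a : ℤ) : Memory :=
  { m with arr := Function.update m.arr k (Function.update (m.arr k) i a) }

/-- Programs. Each program mentions finitely many registers and arrays. -/
inductive Program : Type
  /-- do nothing -/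
  | skip : Program
  /-- `x := a` for a fixed integer `a` -/
  | const (x : ℕ) (a : ℤ) : Program
  /-- `x := y + z` -/
  | add (x y z : ℕ) : Program
  /-- `x := y - z` -/
  | sub (x y z : ℕ) : Program
  /-- `x := k[y]` -/
  | load (x k y : ℕ) : Program
  /-- `k[x] := y` -/
  | store (k x y : ℕ) : Program
  /-- first `p`, then `q` -/
  | seq (p q : Program) : Program
  /-- if `x < y` then `p` else `q` -/
  | branch (x y : ℕ) (p q : Program) : Program
  /-- while `x < y` do `p` -/
  | loop (x y : ℕ) (p : Program) : Program

/-- `Exec p m m' t`: started on memory `m`, the program `p` halts after exactly `t` units of time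
with memory `m'`. -/
inductive Exec : Program → Memory → Memory → ℕ → Prop
  | skip (m : Memory) : Exec .skip m m 1
  | const (m : Memory) (x : ℕ) (a : ℤ) : Exec (.const x a) m (m.setReg x a) 1
  | add (m : Memory) (x y z : ℕ) : Exec (.add x y z) m (m.setReg x (m.reg y + m.reg z)) 1
  | sub (m : Memory) (x y z : ℕ) : Exec (.sub x y z) m (m.setReg x (m.reg y - m.reg z)) 1
  | load (m : Memory) (x k y : ℕ) : Exec (.load x k y) m (m.setReg x (m.arr k (m.reg y))) 1
  | store (m : Memory) (k x y : ℕ) : Exec (.store k x y) m (m.setArr k (m.reg x) (m.reg y)) 1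
  | seq {p q : Program} {m m' m'' : Memory} {t t' : ℕ} :
      Exec p m m' t → Exec q m' m'' t' → Exec (.seq p q) m m'' (t + t')
  | branch_true {x y : ℕ} {p q : Program} {m m' : Memory} {t : ℕ} :
      m.reg x < m.reg y → Exec p m m' t → Exec (.branch x y p q) m m' (t + 1)
  | branch_false {x y : ℕ} {p q : Program} {m m' : Memory} {t : ℕ} :
      ¬ m.reg x < m.reg y → Exec q m m' t → Exec (.branch x y p q) m m' (t + 1)
  | loop_true {x y : ℕ} {p : Program} {m m' m'' : Memory} {t t' : ℕ} :
      m.reg x < m.reg y → Exec p m m' t → Exec (.loop x y p) m' m'' t' →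
        Exec (.loop x y p) m m'' (t + t' + 1)
  | loop_false {x y : ℕ} {p : Program} {m : Memory} :
      ¬ m.reg x < m.reg y → Exec (.loop x y p) m m 1

open Classical in
/-- The memory that presents `(G, τ)`, with `G` a graph on `0, …, n - 1`: register `0` holds `n`,
array `0` holds the thresholds, array `1` holds the adjacency matrix row by row; all other
registers and cells are `0`. -/
noncomputable def inputMemory {n : ℕ} (G : SimpleGraph (Fin n)) (τ : Fin n → ℤ) : Memory where
  reg x := if x = 0 then (n : ℤ) else 0
  arr k i :=
    if k = 0 then
      if h : 0 ≤ i ∧ i.toNat < n then τ ⟨i.toNat, h.2⟩ else 0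
    else if k = 1 then
      if ∃ u v : Fin n, G.Adj u v ∧ i = ((u : ℕ) : ℤ) * (n : ℤ) + ((v : ℕ) : ℤ) then 1 else 0
    else 0

/-- The memory presents `σ` as output: array `2` holds the values of `σ` in the cells
`0, …, n - 1`. -/
def Memory.Outputs {n : ℕ} (m : Memory) (σ : Fin n → ℕ) : Prop :=
  ∀ u : Fin n, m.arr 2 ((u : ℕ) : ℤ) = (σ u : ℤ)

end Incentive

/-! Partial incentives correspond to labellings of the vertices (`isPartialIncentive_iff`). The
labels record the order in which the hull grows, and σ(v) has to cover the deficit of τ(v) over the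
number of neighbours of v with smaller labels. Hence the least weight is the minimum, over all
labellings, of the sum of the positive parts of these deficits. Labels may be replaced by their
ranks, so labels below n suffice. Negative thresholds may be raised to 0, and the part of a
threshold above n is paid at its vertex in any case, so the core problem has thresholds between 0
and n.

The minimum is found by dynamic programming over small separators, without computing a
tree-decomposition. There are K slots for vertices. A piece is a union of components of the graph
without the slot vertices, and it is described by the slots and two numbers y and j: it consists of
the components that contain some w ≥ j adjacent to y (any w ≥ j, if y = n). An item is a piece
together with labels of the slot vertices, the number of earlier neighbours in the piece that each
slot vertex is promised, and a cost. It is coded by 3K + 4 digits to base n + 2. A nonempty piece is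
split as follows: one vertex x of a component takes over a slot whose occupant has no neighbour in
that component; the rest of the component is one smaller piece, and the other components form a
second one. The table of items is obtained by iterating this rule to its fixed point.

Items in the table are realized by labellings, since labellings of disjoint pieces can be glued
(`good_of_items`). Conversely, if an elimination scheme `Deriv` for the whole graph exists, then
every labelling is reflected by items in the table (`items_of_deriv`). Such a scheme can itself be
read off from any item for the whole graph (`deriv_of_items`). Therefore K can be increased until
such an item appears, and from then on the table decides exactly, for all thresholds up to n, which
weights suffice. Treewidth k guarantees success for K = k + 1 (`deriv_of_treewidth`): root the tree
and always eliminate the vertex x of the component whose topmost bag is nearest to the root. The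
slot vertices adjacent to the component lie in that bag and differ from x, so they occupy at most k
slots.

An optimal incentive is extracted from the decision procedure by self-reduction: a unit is charged
to a vertex whenever the remaining problem can then be solved with one unit less (`Optimal.attempt`,
`Optimal.round`).

For the running time, everything is composed of loops over a common range N = (n + 2)^(3K + 4), in a
nesting that does not depend on K. The combinators for `PF`, `PFP` and `St` produce the programs
together with bounds polynomial in N; products, quotients and digits are computed by such loops as
well. As K ≤ w + 1, the total is n^{O(w)}. -/

namespace Incentive

/-! ### Polynomial bounds -/

/-- `T` is bounded by a polynomial. -/
def PolyBound (T : ℕ → ℕ) : Prop := ∃ C, ∀ x, T x ≤ C * (x + 1) ^ C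

theorem PolyBound.const (c : ℕ) : PolyBound fun _ => c :=
  ⟨c, fun x => Nat.le_mul_of_pos_right _ (by positivity)⟩

theorem PolyBound.id : PolyBound fun x => x := ⟨1, fun x => by simp⟩

theorem PolyBound.add {T T' : ℕ → ℕ} (h : PolyBound T) (h' : PolyBound T') :
    PolyBound fun x => T x + T' x := by
  obtain ⟨C, hC⟩ := h
  obtain ⟨C', hC'⟩ := h'
  refine ⟨C + C', fun x => ?_⟩
  have h1 : (x + 1) ^ C ≤ (x + 1) ^ (C + C') := Nat.pow_le_pow_right (by omega) (by omega)
  have h2 : (x + 1) ^ C' ≤ (x + 1) ^ (C + C') := Nat.pow_le_pow_right (by omega) (by omega)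
  calc T x + T' x ≤ C * (x + 1) ^ C + C' * (x + 1) ^ C' := Nat.add_le_add (hC x) (hC' x)
    _ ≤ C * (x + 1) ^ (C + C') + C' * (x + 1) ^ (C + C') := by gcongr
    _ = _ := by ring

theorem PolyBound.mul {T T' : ℕ → ℕ} (h : PolyBound T) (h' : PolyBound T') :
    PolyBound fun x => T x * T' x := by
  obtain ⟨C, hC⟩ := h
  obtain ⟨C', hC'⟩ := h'
  refine ⟨C * C' + C + C', fun x => ?_⟩
  calc T x * T' x ≤ (C * (x + 1) ^ C) * (C' * (x + 1) ^ C') := Nat.mul_le_mul (hC x) (hC' x)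
    _ = (C * C') * (x + 1) ^ (C + C') := by ring
    _ ≤ (C * C' + C + C') * (x + 1) ^ (C * C' + C + C') := by
      refine Nat.mul_le_mul (by omega) (Nat.pow_le_pow_right (by omega) (by omega))

/-- A bound `T` need not be monotone, so the composition is replaced by a polynomial that dominates
`T` at every point up to `T' x`. -/
theorem PolyBound.comp {T T' : ℕ → ℕ} (h : PolyBound T) (h' : PolyBound T') :
    ∃ T'', PolyBound T'' ∧ ∀ x y, y ≤ T' x → T y ≤ T'' x := by
  obtain ⟨C, hC⟩ := h
  refine ⟨fun x => C * (T' x + 1) ^ C, ?_, fun x y hy => (hC y).trans (Nat.mul_le_mul_left _ (Nat.pow_le_pow_left (by omega) _))⟩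
  refine (PolyBound.const C).mul ?_
  have h1 : PolyBound fun x => T' x + 1 := h'.add (PolyBound.const 1)
  clear hC
  induction C with
  | zero => simpa using PolyBound.const 1
  | succ C ih => simpa [pow_succ] using ih.mul h1

/-! ### Memory -/

@[simp] theorem Memory.setReg_arr (m : Memory) (x : ℕ) (a : ℤ) : (m.setReg x a).arr = m.arr := rfl

@[simp] theorem Memory.setReg_reg_self (m : Memory) (x : ℕ) (a : ℤ) :
    (m.setReg x a).reg x = a := by simp [Memory.setReg]

theorem Memory.setReg_reg_of_ne (m : Memory) {x y : ℕ} (a : ℤ) (h : y ≠ x) :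
    (m.setReg x a).reg y = m.reg y := by simp [Memory.setReg, h]

theorem Memory.setReg_reg (m : Memory) (x y : ℕ) (a : ℤ) :
    (m.setReg x a).reg y = if y = x then a else m.reg y := by
  simp [Memory.setReg, Function.update_apply]

@[simp] theorem Memory.setArr_reg (m : Memory) (k : ℕ) (i a : ℤ) : (m.setArr k i a).reg = m.reg :=
  rfl

theorem Memory.setArr_arr (m : Memory) (k k' : ℕ) (i i' a : ℤ) :
    (m.setArr k i a).arr k' i' = if k' = k ∧ i' = i then a else m.arr k' i' := by
  unfold Memory.setArr
  by_cases h : k' = k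
  · subst h
    by_cases h' : i' = i <;> simp [h']
  · simp [h]

/-- Run `p` for register `c` from `0` up to the value of register `1`. -/
def forLoop (c : ℕ) (p : Program) : Program :=
  .seq (.const c 0) (.loop c 1 (.seq p (.seq (.const (c + 1) 1) (.add c c (c + 1)))))

/-- The rule for bounded loops with invariant `I`. Register `c + 1` receives the constant 1 for the
increment, so `I` has to survive this write. Each pass costs the body plus two instructions and one
test; the 2 at the end is the initialization and the last test. -/
theorem exec_forLoop {p : Program} {c N T : ℕ} (I : ℕ → Memory → Prop) (hc : 1 < c)
    (h : ∀ i < N, ∀ m : Memory, I i m → m.reg c = (i : ℤ) → m.reg 1 = (N : ℤ) →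
      ∃ m' t, Exec p m m' t ∧ m'.reg c = (i : ℤ) ∧ m'.reg 1 = (N : ℤ) ∧
        I (i + 1) ((m'.setReg (c + 1) 1).setReg c ((i + 1 : ℕ) : ℤ)) ∧ t ≤ T)
    (m : Memory) (hm : m.reg 1 = (N : ℤ)) (h0 : I 0 (m.setReg c 0)) :
    ∃ m' t, Exec (forLoop c p) m m' t ∧ I N m' ∧ t ≤ N * (T + 3) + 2 := by
  have key : ∀ j i, i + j = N → ∀ m : Memory, I i m → m.reg c = (i : ℤ) → m.reg 1 = (N : ℤ) →
      ∃ m' t, Exec (.loop c 1 (.seq p (.seq (.const (c + 1) 1) (.add c c (c + 1))))) m m' t ∧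
        I N m' ∧ t ≤ j * (T + 3) + 1 := by
    intro j
    induction j with
    | zero =>
      intro i hi m hI hci h1
      obtain rfl : i = N := by omega
      exact ⟨m, 1, .loop_false (by rw [hci, h1]; simp), hI, by simp⟩
    | succ j ih =>
      intro i hi m hI hci h1
      obtain ⟨m', t, he, hc', h1', hI', ht⟩ := h i (by omega) m hI hci h1
      have hadd : (m'.setReg (c + 1) 1).setReg c
          ((m'.setReg (c + 1) 1).reg c + (m'.setReg (c + 1) 1).reg (c + 1)) =
          (m'.setReg (c + 1) 1).setReg c ((i + 1 : ℕ) : ℤ) := by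
        rw [Memory.setReg_reg_of_ne _ _ (by omega : c ≠ c + 1), hc']
        simp
      obtain ⟨m'', t', he', hI'', ht'⟩ := ih (i + 1) (by omega) _ hI' (by simp)
        (by rw [Memory.setReg_reg_of_ne _ _ (by omega), Memory.setReg_reg_of_ne _ _ (by omega), h1'])
      refine ⟨m'', t + (1 + 1) + t' + 1, ?_, hI'', ?_⟩
      · refine .loop_true (by rw [hci, h1]; exact_mod_cast (by omega : i < N)) ?_ he'
        refine .seq he (.seq (.const _ _ _) ?_)
        rw [← hadd]
        exact .add _ _ _ _
      · have : (j + 1) * (T + 3) = j * (T + 3) + (T + 3) := by ring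
        omega
  obtain ⟨m', t, he, hI, ht⟩ := key N 0 (by omega) _ h0 (by simp)
    (by rw [Memory.setReg_reg_of_ne _ _ (by omega), hm])
  exact ⟨m', 1 + t, .seq (.const _ _ _) he, hI, by omega⟩

/-! ### Expressions -/

/-- A way of presenting objects `a : α` in the memory, by the arrays and the registers below
`depth`. Register `1` holds the size of `a`, which is the range of all loops. -/
structure Ctx (α : Type) where
  rel : α → Memory → Prop
  size : α → ℕ
  depth : ℕ
  one_lt : 1 < depth
  reg_one : ∀ {a m}, rel a m → m.reg 1 = (size a : ℤ)
  congr : ∀ {a} {m m' : Memory}, rel a m → m'.arr = m.arr → (∀ x < depth, m'.reg x = m.reg x) →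
    rel a m'

/-- Add a natural number that is held in register `d`. -/
def Ctx.ext {α : Type} (Γ : Ctx α) (d : ℕ) (hd : Γ.depth ≤ d) : Ctx (α × ℕ) where
  rel x m := Γ.rel x.1 m ∧ m.reg d = (x.2 : ℤ)
  size x := Γ.size x.1
  depth := d + 1
  one_lt := by have := Γ.one_lt; omega
  reg_one h := Γ.reg_one h.1
  congr h h1 h2 := ⟨Γ.congr h.1 h1 fun x hx => h2 x (by omega), by rw [h2 d (by omega)]; exact h.2⟩

/-- The function `f` can be evaluated in polynomial time, into any register `d` from the depth
on, without side effects on arrays and on registers below `d`. -/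
def PF {α : Type} (Γ : Ctx α) (f : α → ℕ) : Prop :=
  ∀ d, Γ.depth ≤ d → ∃ p T, PolyBound T ∧ ∀ a m, Γ.rel a m → ∃ m' t, Exec p m m' t ∧
    m'.arr = m.arr ∧ (∀ x < d, m'.reg x = m.reg x) ∧ m'.reg d = (f a : ℤ) ∧ t ≤ T (Γ.size a)

open Classical in
/-- The predicate `P` can be decided in polynomial time. -/
def PFP {α : Type} (Γ : Ctx α) (P : α → Prop) : Prop := PF Γ fun a => if P a then 1 else 0

section Expressions

variable {α : Type} {Γ : Ctx α}

theorem PF.congr {f g : α → ℕ} (h : PF Γ f) (hfg : ∀ a, f a = g a) : PF Γ g := by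
  rwa [← (funext hfg : f = g)]

theorem PFP.congr {P Q : α → Prop} (h : PFP Γ P) (hPQ : ∀ a, P a ↔ Q a) : PFP Γ Q := by
  rwa [← (funext fun a => propext (hPQ a) : P = Q)]

theorem PF.lift {f : α → ℕ} (h : PF Γ f) {d : ℕ} {hd : Γ.depth ≤ d} :
    PF (Γ.ext d hd) fun x => f x.1 := by
  intro d' hd'
  have hd2 : d + 1 ≤ d' := hd'
  obtain ⟨p, T, hT, hp⟩ := h d' (by omega)
  exact ⟨p, T, hT, fun a m hm => hp a.1 m hm.1⟩

theorem PF.ofReg {f : α → ℕ} (x : ℕ) (hx : x < Γ.depth)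
    (h : ∀ a m, Γ.rel a m → m.reg x = (f a : ℤ)) : PF Γ f := by
  intro d hd
  refine ⟨.seq (.const d 0) (.add d x d), fun _ => 2, .const 2, fun a m hm => ?_⟩
  refine ⟨_, _, .seq (.const _ _ _) (.add _ _ _ _), rfl, fun y hy => ?_, ?_, le_rfl⟩
  · rw [Memory.setReg_reg_of_ne _ _ (by omega), Memory.setReg_reg_of_ne _ _ (by omega)]
  · simp [Memory.setReg_reg_of_ne _ _ (by omega : x ≠ d), h a m hm]

theorem PF.var {d : ℕ} {hd : Γ.depth ≤ d} : PF (Γ.ext d hd) fun x => x.2 :=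
  .ofReg d (Nat.lt_succ_self d) fun _ _ h => h.2

theorem PF.size : PF Γ Γ.size := .ofReg 1 Γ.one_lt fun _ _ h => Γ.reg_one h

theorem PF.const (c : ℕ) : PF Γ fun _ => c := by
  intro d hd
  refine ⟨.const d c, fun _ => 1, .const 1, fun a m hm => ?_⟩
  exact ⟨_, _, .const _ _ _, rfl, fun y hy => Memory.setReg_reg_of_ne _ _ (by omega), by simp,
    le_rfl⟩

/-- Evaluation of `f` into register `d`, of `g` into register `d + 1`, and then a program that
combines the two values. -/
theorem PF.binary {f g r : α → ℕ} (hf : PF Γ f) (hg : PF Γ g) (q : ℕ → Program) (c : ℕ)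
    (hq : ∀ d m a, m.reg d = (f a : ℤ) → m.reg (d + 1) = (g a : ℤ) →
      ∃ m' t, Exec (q d) m m' t ∧ m'.arr = m.arr ∧ (∀ x < d, m'.reg x = m.reg x) ∧
        m'.reg d = (r a : ℤ) ∧ t ≤ c) : PF Γ r := by
  intro d hd
  obtain ⟨p, T, hT, hp⟩ := hf d hd
  obtain ⟨p', T', hT', hp'⟩ := hg (d + 1) (by omega)
  refine ⟨.seq p (.seq p' (q d)), fun x => T x + (T' x + c), hT.add (hT'.add (.const c)),
    fun a m hm => ?_⟩
  obtain ⟨m1, t1, e1, a1, r1, v1, b1⟩ := hp a m hm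
  have hm1 : Γ.rel a m1 := Γ.congr hm a1 fun x hx => r1 x (by omega)
  obtain ⟨m2, t2, e2, a2, r2, v2, b2⟩ := hp' a m1 hm1
  obtain ⟨m3, t3, e3, a3, r3, v3, b3⟩ := hq d m2 a (by rw [r2 d (by omega), v1]) v2
  refine ⟨m3, _, .seq e1 (.seq e2 e3), by rw [a3, a2, a1], fun x hx => ?_, v3, by beta_reduce; omega⟩
  rw [r3 x hx, r2 x (by omega), r1 x hx]

theorem PF.add {f g : α → ℕ} (hf : PF Γ f) (hg : PF Γ g) : PF Γ fun a => f a + g a := by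
  refine hf.binary hg (fun d => .add d d (d + 1)) 1 fun d m a h1 h2 => ?_
  refine ⟨_, _, .add _ _ _ _, rfl, fun x hx => Memory.setReg_reg_of_ne _ _ (by omega), ?_, le_rfl⟩
  simp [h1, h2]

theorem PF.sub {f g : α → ℕ} (hf : PF Γ f) (hg : PF Γ g) : PF Γ fun a => f a - g a := by
  refine hf.binary hg (fun d => .branch d (d + 1) (.const d 0) (.sub d d (d + 1))) 2
    fun d m a h1 h2 => ?_
  by_cases hlt : f a < g a
  · refine ⟨_, _, .branch_true (by rw [h1, h2]; exact_mod_cast hlt) (.const _ _ _), rfl,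
      fun x hx => Memory.setReg_reg_of_ne _ _ (by omega), ?_, le_rfl⟩
    simp [Nat.sub_eq_zero_of_le hlt.le]
  · refine ⟨_, _, .branch_false (by rw [h1, h2]; exact_mod_cast hlt) (.sub _ _ _ _), rfl,
      fun x hx => Memory.setReg_reg_of_ne _ _ (by omega), ?_, le_rfl⟩
    simp [h1, h2, Nat.cast_sub (not_lt.1 hlt)]

theorem PFP.lt {f g : α → ℕ} (hf : PF Γ f) (hg : PF Γ g) : PFP Γ fun a => f a < g a := by
  refine hf.binary hg (fun d => .branch d (d + 1) (.const d 1) (.const d 0)) 2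
    fun d m a h1 h2 => ?_
  by_cases hlt : f a < g a
  · refine ⟨_, _, .branch_true (by rw [h1, h2]; exact_mod_cast hlt) (.const _ _ _), rfl,
      fun x hx => Memory.setReg_reg_of_ne _ _ (by omega), ?_, le_rfl⟩
    simp [hlt]
  · refine ⟨_, _, .branch_false (by rw [h1, h2]; exact_mod_cast hlt) (.const _ _ _), rfl,
      fun x hx => Memory.setReg_reg_of_ne _ _ (by omega), ?_, le_rfl⟩
    simp [hlt]

open Classical in
theorem PF.ite {P : α → Prop} {f g : α → ℕ} (hP : PFP Γ P) (hf : PF Γ f) (hg : PF Γ g) :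
    PF Γ fun a => if P a then f a else g a := by
  intro d hd
  obtain ⟨p0, T0, hT0, hp0⟩ := hP d hd
  obtain ⟨p1, T1, hT1, hp1⟩ := hf d hd
  obtain ⟨p2, T2, hT2, hp2⟩ := hg d hd
  refine ⟨.seq p0 (.seq (.const (d + 1) 0) (.branch (d + 1) d p1 p2)),
    fun x => T0 x + (T1 x + T2 x + 2), hT0.add ((hT1.add hT2).add (.const 2)), fun a m hm => ?_⟩
  obtain ⟨m1, t1, e1, a1, r1, v1, b1⟩ := hp0 a m hm
  have hreg : ∀ x < d, (m1.setReg (d + 1) 0).reg x = m.reg x := fun x hx => by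
    rw [Memory.setReg_reg_of_ne _ _ (by omega), r1 x hx]
  have hm1 : Γ.rel a (m1.setReg (d + 1) 0) := Γ.congr hm a1 fun x hx => hreg x (by omega)
  by_cases h : P a
  · obtain ⟨m2, t2, e2, a2, r2, v2, b2⟩ := hp1 a _ hm1
    refine ⟨m2, _, .seq e1 (.seq (.const _ _ _) (.branch_true ?_ e2)), by rw [a2]; exact a1,
      fun x hx => by rw [r2 x hx, hreg x hx], by simp [h, v2], by beta_reduce; omega⟩
    rw [Memory.setReg_reg_self, Memory.setReg_reg_of_ne _ _ (by omega), v1]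
    simp [h]
  · obtain ⟨m2, t2, e2, a2, r2, v2, b2⟩ := hp2 a _ hm1
    refine ⟨m2, _, .seq e1 (.seq (.const _ _ _) (.branch_false ?_ e2)), by rw [a2]; exact a1,
      fun x hx => by rw [r2 x hx, hreg x hx], by simp [h, v2], by beta_reduce; omega⟩
    rw [Memory.setReg_reg_self, Memory.setReg_reg_of_ne _ _ (by omega), v1]
    simp [h]

theorem PFP.and {P Q : α → Prop} (hP : PFP Γ P) (hQ : PFP Γ Q) : PFP Γ fun a => P a ∧ Q a :=
  (PF.ite hP hQ (.const 0)).congr fun a => by by_cases h : P a <;> by_cases h2 : Q a <;> simp [h, h2]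

theorem PFP.or {P Q : α → Prop} (hP : PFP Γ P) (hQ : PFP Γ Q) : PFP Γ fun a => P a ∨ Q a :=
  (PF.ite hP (.const 1) hQ).congr fun a => by by_cases h : P a <;> by_cases h2 : Q a <;> simp [h, h2]

theorem PFP.not {P : α → Prop} (hP : PFP Γ P) : PFP Γ fun a => ¬ P a :=
  (PF.ite hP (.const 0) (.const 1)).congr fun a => by by_cases h : P a <;> simp [h]

theorem PFP.imp {P Q : α → Prop} (hP : PFP Γ P) (hQ : PFP Γ Q) : PFP Γ fun a => P a → Q a :=
  (hP.not.or hQ).congr fun _ => imp_iff_not_or.symm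

theorem PFP.le {f g : α → ℕ} (hf : PF Γ f) (hg : PF Γ g) : PFP Γ fun a => f a ≤ g a :=
  (PFP.lt hg hf).not.congr fun _ => not_lt

theorem PFP.eq {f g : α → ℕ} (hf : PF Γ f) (hg : PF Γ g) : PFP Γ fun a => f a = g a :=
  ((PFP.le hf hg).and (PFP.le hg hf)).congr fun _ => le_antisymm_iff.symm

/-- The accumulator lives in register `d` and the counter in `d + 1`. The new value is computed in
`d + 2` and moved to `d` by adding a zero, as there is no instruction for copying registers. -/
theorem PF.fold {g : α → ℕ} {F : α → ℕ → ℕ → ℕ} (hg : PF Γ g)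
    (hF : ∀ d hd, PF ((Γ.ext d hd).ext (d + 1) le_rfl) fun x => F x.1.1 x.2 x.1.2) :
    PF Γ fun a => Nat.rec (g a) (fun i acc => F a i acc) (Γ.size a) := by
  intro d hd
  have hdep := Γ.one_lt
  obtain ⟨p0, T0, hT0, hp0⟩ := hg d hd
  obtain ⟨p1, T1, hT1, hp1⟩ := hF d hd (d + 2) le_rfl
  refine ⟨.seq p0 (forLoop (d + 1) (.seq p1 (.seq (.const (d + 3) 0) (.add d (d + 2) (d + 3))))),
    fun x => T0 x + (x * (T1 x + 2 + 3) + 2),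
    hT0.add ((PolyBound.id.mul ((hT1.add (.const 2)).add (.const 3))).add (.const 2)),
    fun a m hm => ?_⟩
  obtain ⟨m1, t1, e1, a1, r1, v1, b1⟩ := hp0 a m hm
  let val : ℕ → ℕ := fun j => Nat.rec (g a) (fun i acc => F a i acc) j
  let I : ℕ → Memory → Prop := fun i m' =>
    m'.arr = m.arr ∧ (∀ x < d, m'.reg x = m.reg x) ∧ m'.reg d = Nat.cast (val i)
  obtain ⟨m2, t2, e2, ⟨a2, r2, v2⟩, b2⟩ := exec_forLoop (c := d + 1) (N := Γ.size a)
    (p := .seq p1 (.seq (.const (d + 3) 0) (.add d (d + 2) (d + 3)))) (T := T1 (Γ.size a) + 2)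
    I
    (by omega) (by
      rintro i hi m' ⟨ha, hr, hv⟩ hci h1
      have hrel : Γ.rel a m' := Γ.congr hm ha fun x hx => hr x (by omega)
      obtain ⟨m3, t3, e3, a3, r3, v3, b3⟩ := hp1 ((a, val i), i) m' ⟨⟨hrel, hv⟩, hci⟩
      refine ⟨_, _, .seq e3 (.seq (.const _ _ _) (.add _ _ _ _)), ?_, ?_, ⟨?_, ?_, ?_⟩, ?_⟩
      · rw [Memory.setReg_reg_of_ne _ _ (by omega), Memory.setReg_reg_of_ne _ _ (by omega),
          r3 _ (by omega), hci]
      · rw [Memory.setReg_reg_of_ne _ _ (by omega), Memory.setReg_reg_of_ne _ _ (by omega),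
          r3 _ (by omega), h1]
      · simp [a3, ha]
      · intro x hx
        rw [Memory.setReg_reg_of_ne _ _ (by omega), Memory.setReg_reg_of_ne _ _ (by omega),
          Memory.setReg_reg_of_ne _ _ (by omega), Memory.setReg_reg_of_ne _ _ (by omega),
          r3 x (by omega), hr x hx]
      · rw [Memory.setReg_reg_of_ne _ _ (by omega), Memory.setReg_reg_of_ne _ _ (by omega)]
        rw [Memory.setReg_reg_self, Memory.setReg_reg_self,
          Memory.setReg_reg_of_ne _ _ (by omega), v3]
        simp [val]
      · have : t3 ≤ T1 (Γ.size a) := b3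
        omega)
    m1 (by rw [r1 1 (by omega), Γ.reg_one hm])
    ⟨by simpa using a1,
      fun x hx => by rw [Memory.setReg_reg_of_ne _ _ (by omega), r1 x hx],
      by rw [Memory.setReg_reg_of_ne _ _ (by omega), v1]; rfl⟩
  exact ⟨m2, _, .seq e1 e2, a2, r2, v2, by beta_reduce; omega⟩

theorem PF.sum {F : α → ℕ → ℕ} (hF : ∀ d hd, PF (Γ.ext d hd) fun x => F x.1 x.2) :
    PF Γ fun a => ∑ i ∈ Finset.range (Γ.size a), F a i := by
  have h : ∀ d (hd : Γ.depth ≤ d),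
      PF ((Γ.ext d hd).ext (d + 1) le_rfl) fun x => x.1.2 + F x.1.1 x.2 := by
    intro d hd
    refine PF.add PF.var.lift ?_
    intro d' hd'
    -- The summand is compiled with its index in register `d + 1`, which leaves register `d` to the
    -- accumulator.
    obtain ⟨p, T, hT, hp⟩ := hF (d + 1) (by omega) d' hd'
    exact ⟨p, T, hT, fun a m hm => hp (a.1.1, a.2) m ⟨hm.1.1, hm.2⟩⟩
  refine (PF.fold (.const 0) (F := fun a i acc => acc + F a i) h).congr fun a => ?_
  generalize Γ.size a = N
  induction N with
  | zero => rfl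
  | succ N ih => rw [Finset.sum_range_succ, ← ih]

theorem PFP.ex {P : α → ℕ → Prop} (hP : ∀ d hd, PFP (Γ.ext d hd) fun x => P x.1 x.2) :
    PFP Γ fun a => ∃ i < Γ.size a, P a i := by
  classical
  refine (PFP.lt (.const 0) (PF.sum (F := fun a i => if P a i then 1 else 0) hP)).congr fun a => ?_
  rw [Nat.pos_iff_ne_zero, Ne, Finset.sum_eq_zero_iff]
  simp

theorem PFP.all {P : α → ℕ → Prop} (hP : ∀ d hd, PFP (Γ.ext d hd) fun x => P x.1 x.2) :
    PFP Γ fun a => ∀ i < Γ.size a, P a i :=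
  (PFP.ex (P := fun a i => ¬ P a i) fun d hd => (hP d hd).not).not.congr fun a => by push Not; rfl

/-- Array `k` holds the function `A a`. -/
def HoldsArr (Γ : Ctx α) (k : ℕ) (A : α → ℕ → ℕ) : Prop :=
  ∀ a m, Γ.rel a m → ∀ i : ℕ, m.arr k (i : ℤ) = (A a i : ℤ)

theorem HoldsArr.lift {k : ℕ} {A : α → ℕ → ℕ} (h : HoldsArr Γ k A) {d : ℕ} {hd : Γ.depth ≤ d} :
    HoldsArr (Γ.ext d hd) k fun x => A x.1 := fun a m hm => h a.1 m hm.1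

theorem PF.load {k : ℕ} {A : α → ℕ → ℕ} {f : α → ℕ} (hf : PF Γ f) (hA : HoldsArr Γ k A) :
    PF Γ fun a => A a (f a) := by
  intro d hd
  obtain ⟨p, T, hT, hp⟩ := hf d hd
  refine ⟨.seq p (.load d k d), fun x => T x + 1, hT.add (.const 1), fun a m hm => ?_⟩
  obtain ⟨m1, t1, e1, a1, r1, v1, b1⟩ := hp a m hm
  refine ⟨_, _, .seq e1 (.load _ _ _ _), a1,
    fun x hx => by rw [Memory.setReg_reg_of_ne _ _ (by omega), r1 x hx], ?_, by beta_reduce; omega⟩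
  rw [Memory.setReg_reg_self, a1, v1, hA a m hm]

/-- Reading the positive part of an array cell. -/
theorem PF.loadToNat {k : ℕ} {A : α → ℕ → ℕ} {f : α → ℕ} (hf : PF Γ f)
    (hA : ∀ a m, Γ.rel a m → ∀ i : ℕ, (m.arr k (i : ℤ)).toNat = A a i) :
    PF Γ fun a => A a (f a) := by
  intro d hd
  obtain ⟨p, T, hT, hp⟩ := hf d hd
  refine ⟨.seq p (.seq (.load d k d) (.seq (.const (d + 1) 0)
    (.branch d (d + 1) (.const d 0) .skip))), fun x => T x + 4, hT.add (.const 4),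
    fun a m hm => ?_⟩
  obtain ⟨m1, t1, e1, a1, r1, v1, b1⟩ := hp a m hm
  have hv : ((m1.setReg d (m1.arr k (m1.reg d))).setReg (d + 1) 0).reg d = m.arr k (f a) := by
    rw [Memory.setReg_reg_of_ne _ _ (by omega), Memory.setReg_reg_self, a1, v1]
  have hr : ∀ x < d, ((m1.setReg d (m1.arr k (m1.reg d))).setReg (d + 1) 0).reg x = m.reg x := by
    intro x hx
    rw [Memory.setReg_reg_of_ne _ _ (by omega), Memory.setReg_reg_of_ne _ _ (by omega), r1 x hx]
  by_cases hlt : m.arr k (f a) < 0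
  · refine ⟨_, _, .seq e1 (.seq (.load _ _ _ _) (.seq (.const _ _ _)
      (.branch_true (by rw [hv, Memory.setReg_reg_self]; exact hlt) (.const _ _ _)))), a1,
      fun x hx => by rw [Memory.setReg_reg_of_ne _ _ (by omega), hr x hx], ?_, by beta_reduce; omega⟩
    rw [Memory.setReg_reg_self]
    beta_reduce
    rw [← hA a m hm]
    omega
  · refine ⟨_, _, .seq e1 (.seq (.load _ _ _ _) (.seq (.const _ _ _)
      (.branch_false (by rw [hv, Memory.setReg_reg_self]; exact hlt) (.skip _)))), a1,
      hr, ?_, by beta_reduce; omega⟩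
    rw [hv]
    beta_reduce
    rw [← hA a m hm]
    omega

end Expressions

/-! ### Statements -/

/-- The transformation `f` can be performed in polynomial time, without side effects on
the registers between the depth and `d`, for any `d`. -/
def St {α : Type} (Γ : Ctx α) (f : α → α) : Prop :=
  ∀ d, Γ.depth ≤ d → ∃ p T, PolyBound T ∧ ∀ a m, Γ.rel a m → ∃ m' t, Exec p m m' t ∧
    Γ.rel (f a) m' ∧ (∀ x, Γ.depth ≤ x → x < d → m'.reg x = m.reg x) ∧ t ≤ T (Γ.size a)

section Statements

variable {α : Type} {Γ : Ctx α}

theorem St.id : St Γ fun a => a := fun _ _ =>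
  ⟨.skip, fun _ => 1, .const 1, fun _ m hm => ⟨m, 1, .skip m, hm, fun _ _ _ => rfl, le_rfl⟩⟩

/-- The time of the second program is measured in the size that the first one leaves behind, hence
the polynomial bound `S` on its growth. -/
theorem St.seq' {f g : α → α} (hf : St Γ f) (hg : St Γ g) {S : ℕ → ℕ} (hS : PolyBound S)
    (hfS : ∀ a, Γ.size (f a) ≤ S (Γ.size a)) : St Γ fun a => g (f a) := by
  intro d hd
  obtain ⟨p, T, hT, hp⟩ := hf d hd
  obtain ⟨q, U, hU, hq⟩ := hg d hd
  obtain ⟨U', hU', hUU⟩ := hU.comp hS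
  refine ⟨.seq p q, fun x => T x + U' x, hT.add hU', fun a m hm => ?_⟩
  obtain ⟨m1, t1, e1, h1, r1, b1⟩ := hp a m hm
  obtain ⟨m2, t2, e2, h2, r2, b2⟩ := hq _ m1 h1
  refine ⟨m2, _, .seq e1 e2, h2, fun x hx hx' => by rw [r2 x hx hx', r1 x hx hx'], ?_⟩
  have := hUU _ _ (hfS a)
  beta_reduce; omega

theorem St.seq {f g : α → α} (hf : St Γ f) (hg : St Γ g) (hs : ∀ a, Γ.size (f a) = Γ.size a) :
    St Γ fun a => g (f a) :=
  hf.seq' hg .id fun a => (hs a).le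

open Classical in
theorem St.ite {P : α → Prop} {f g : α → α} (hP : PFP Γ P) (hf : St Γ f) (hg : St Γ g) :
    St Γ fun a => if P a then f a else g a := by
  intro d hd
  obtain ⟨p0, T0, hT0, hp0⟩ := hP d hd
  obtain ⟨p1, T1, hT1, hp1⟩ := hf d hd
  obtain ⟨p2, T2, hT2, hp2⟩ := hg d hd
  refine ⟨.seq p0 (.seq (.const (d + 1) 0) (.branch (d + 1) d p1 p2)),
    fun x => T0 x + (T1 x + T2 x + 2), hT0.add ((hT1.add hT2).add (.const 2)), fun a m hm => ?_⟩
  obtain ⟨m1, t1, e1, a1, r1, v1, b1⟩ := hp0 a m hm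
  have hreg : ∀ x < d, (m1.setReg (d + 1) 0).reg x = m.reg x := fun x hx => by
    rw [Memory.setReg_reg_of_ne _ _ (by omega), r1 x hx]
  have hm1 : Γ.rel a (m1.setReg (d + 1) 0) := Γ.congr hm a1 fun x hx => hreg x (by omega)
  by_cases h : P a
  · obtain ⟨m2, t2, e2, h2, r2, b2⟩ := hp1 a _ hm1
    refine ⟨m2, _, .seq e1 (.seq (.const _ _ _) (.branch_true ?_ e2)), by simpa [h] using h2,
      fun x hx hx' => by rw [r2 x hx hx', hreg x hx'], by beta_reduce; omega⟩
    rw [Memory.setReg_reg_self, Memory.setReg_reg_of_ne _ _ (by omega), v1]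
    simp [h]
  · obtain ⟨m2, t2, e2, h2, r2, b2⟩ := hp2 a _ hm1
    refine ⟨m2, _, .seq e1 (.seq (.const _ _ _) (.branch_false ?_ e2)), by simpa [h] using h2,
      fun x hx hx' => by rw [r2 x hx hx', hreg x hx'], by beta_reduce; omega⟩
    rw [Memory.setReg_reg_self, Memory.setReg_reg_of_ne _ _ (by omega), v1]
    simp [h]

/-- The size has to be kept, as it is the loop bound in register 1. The loop occupies the registers
`d` and `d + 1`, so the body works from `d + 2` on. -/
theorem St.iterate {f : α → α} (hf : St Γ f) (hs : ∀ a, Γ.size (f a) = Γ.size a) :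
    St Γ fun a => f^[Γ.size a] a := by
  intro d hd
  have hdep := Γ.one_lt
  obtain ⟨p, T, hT, hp⟩ := hf (d + 2) (by omega)
  refine ⟨forLoop d p, fun x => x * (T x + 3) + 2,
    (PolyBound.id.mul (hT.add (.const 3))).add (.const 2), fun a m hm => ?_⟩
  have hsize : ∀ i, Γ.size (f^[i] a) = Γ.size a := by
    intro i
    induction i with
    | zero => rfl
    | succ i ih => rw [Function.iterate_succ_apply', hs, ih]
  have hcongr : ∀ {b m} (_ : Γ.rel b m) (x : ℕ) (v : ℤ), d ≤ x → Γ.rel b (m.setReg x v) :=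
    fun h x v hx => Γ.congr h rfl fun y hy => Memory.setReg_reg_of_ne _ _ (by omega)
  obtain ⟨m', t, e, ⟨hr, hrr⟩, b⟩ := exec_forLoop (p := p) (c := d) (N := Γ.size a)
    (T := T (Γ.size a))
    (fun i m' => Γ.rel (f^[i] a) m' ∧ ∀ x, Γ.depth ≤ x → x < d → m'.reg x = m.reg x) (by omega)
    (by
      rintro i hi m1 ⟨h1, h1'⟩ hci hN
      obtain ⟨m2, t2, e2, h2, r2, b2⟩ := hp _ m1 h1
      rw [← Function.iterate_succ_apply' f] at h2
      refine ⟨m2, t2, e2, by rw [r2 d hd (by omega), hci], by rw [Γ.reg_one h2, hsize],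
        ⟨hcongr (hcongr h2 _ _ (by omega)) _ _ le_rfl, fun x hx hx' => ?_⟩,
        by rwa [hsize] at b2⟩
      rw [Memory.setReg_reg_of_ne _ _ (by omega), Memory.setReg_reg_of_ne _ _ (by omega),
        r2 x hx (by omega), h1' x hx hx'])
    m (Γ.reg_one hm) ⟨hcongr hm _ _ le_rfl, fun x _ hx => Memory.setReg_reg_of_ne _ _ (by omega)⟩
  exact ⟨m', t, e, hr, hrr, b⟩

/-- Assignment to a register below the depth. -/
theorem St.assign {set : α → ℕ → α} {f : α → ℕ} (x : ℕ) (hx : x < Γ.depth)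
    (hset : ∀ a m, Γ.rel a m → ∀ v : ℕ, Γ.rel (set a v) (m.setReg x v)) (hf : PF Γ f) :
    St Γ fun a => set a (f a) := by
  intro d hd
  obtain ⟨p, T, hT, hp⟩ := hf d hd
  refine ⟨.seq p (.seq (.const (d + 1) 0) (.add x d (d + 1))), fun y => T y + 2, hT.add (.const 2),
    fun a m hm => ?_⟩
  obtain ⟨m1, t1, e1, a1, r1, v1, b1⟩ := hp a m hm
  refine ⟨_, _, .seq e1 (.seq (.const _ _ _) (.add _ _ _ _)), ?_, fun y hy hy' => ?_, by beta_reduce; omega⟩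
  · rw [Memory.setReg_reg_self, Memory.setReg_reg_of_ne _ _ (by omega), v1, add_zero]
    refine hset a _ (Γ.congr hm (m' := m1.setReg (d + 1) 0) a1 fun y hy => ?_) _
    rw [Memory.setReg_reg_of_ne _ _ (by omega), r1 y (by omega)]
  · rw [Memory.setReg_reg_of_ne _ _ (by omega), Memory.setReg_reg_of_ne _ _ (by omega), r1 y hy']

/-- Assignment to the cells of array `k` below the size, all at once. Array `k'` is used as a
buffer. -/
theorem St.fill {set : α → (ℕ → ℕ) → α} {A : α → ℕ → ℕ} {F : α → ℕ → ℕ} (k k' : ℕ) (hkk : k ≠ k')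
    (hA : HoldsArr Γ k A)
    (hbuf : ∀ a m, Γ.rel a m → ∀ m' : Memory, m'.reg = m.reg → (∀ l ≠ k', m'.arr l = m.arr l) →
      Γ.rel a m')
    (hset : ∀ a m, Γ.rel a m → ∀ (m' : Memory) (g : ℕ → ℕ), m'.reg = m.reg →
      (∀ l ≠ k, m'.arr l = m.arr l) → (∀ i : ℕ, m'.arr k (i : ℤ) = (g i : ℤ)) →
      Γ.rel (set a g) m')
    (hF : ∀ d hd, PF (Γ.ext d hd) fun x => F x.1 x.2) :
    St Γ fun a => set a fun i => if i < Γ.size a then F a i else A a i := by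
  intro d hd
  have hdep := Γ.one_lt
  obtain ⟨p, T, hT, hp⟩ := hF d hd (d + 1) le_rfl
  -- The values `F a i` may depend on the array that is being overwritten. They are first collected
  -- in the buffer and then copied.
  refine ⟨.seq (forLoop d (.seq p (.store k' d (d + 1))))
    (forLoop d (.seq (.load (d + 1) k' d) (.store k d (d + 1)))),
    fun x => (x * (T x + 1 + 3) + 2) + (x * (2 + 3) + 2),
    ((PolyBound.id.mul ((hT.add (.const 1)).add (.const 3))).add (.const 2)).add
      ((PolyBound.id.mul (.const _)).add (.const 2)), fun a m hm => ?_⟩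
  obtain ⟨m1, t1, e1, ⟨h1, r1, v1⟩, b1⟩ := exec_forLoop (p := .seq p (.store k' d (d + 1)))
    (c := d) (N := Γ.size a) (T := T (Γ.size a) + 1)
    (fun i m' => (∀ l ≠ k', m'.arr l = m.arr l) ∧ (∀ x < d, m'.reg x = m.reg x) ∧
      ∀ j < i, m'.arr k' (j : ℤ) = (F a j : ℤ)) (by omega)
    (by
      rintro i hi m1 ⟨h1, h2, h3⟩ hci hN
      have hrel : Γ.rel a m1 :=
        Γ.congr (m := { m with arr := m1.arr }) (hbuf a m hm { m with arr := m1.arr } rfl h1) rfl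
          fun x hx => h2 x (by omega)
      obtain ⟨m2, t2, e2, a2, r2, v2, b2⟩ := hp (a, i) m1 ⟨hrel, hci⟩
      refine ⟨_, _, .seq e2 (.store _ _ _ _), ?_, ?_, ⟨?_, ?_, ?_⟩, ?_⟩
      · rw [Memory.setArr_reg, r2 d (by omega), hci]
      · rw [Memory.setArr_reg, r2 1 (by omega), hN]
      · intro l hl
        ext j
        simp only [Memory.setReg_arr, Memory.setArr_arr, hl, false_and, if_false, a2, h1 l hl]
      · intro x hx
        rw [Memory.setReg_reg_of_ne _ _ (by omega), Memory.setReg_reg_of_ne _ _ (by omega),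
          Memory.setArr_reg, r2 x (by omega), h2 x hx]
      · intro j hj
        simp only [Memory.setReg_arr, Memory.setArr_arr, r2 d (by omega), hci, v2, a2, true_and,
          Nat.cast_inj]
        split_ifs with hji
        · rw [hji]
        · exact h3 j (by omega)
      · have : t2 ≤ T (Γ.size a) := b2
        omega)
    m (Γ.reg_one hm)
    ⟨fun _ _ => rfl, fun x hx => Memory.setReg_reg_of_ne _ _ (by omega), by simp⟩
  obtain ⟨m2, t2, e2, ⟨h2, r2, v2, -⟩, b2⟩ := exec_forLoop
    (p := .seq (.load (d + 1) k' d) (.store k d (d + 1)))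
    (c := d) (N := Γ.size a) (T := 2)
    (fun i m' => (∀ l ≠ k, m'.arr l = m1.arr l) ∧ (∀ x < d, m'.reg x = m.reg x) ∧
      (∀ j : ℕ, m'.arr k (j : ℤ) = ((if j < i then F a j else A a j : ℕ) : ℤ)) ∧
      i ≤ Γ.size a) (by omega)
    (by
      rintro i hi m3 ⟨h3, h3', h4, -⟩ hci hN
      refine ⟨_, _, .seq (.load _ _ _ _) (.store _ _ _ _), ?_, ?_, ⟨?_, ?_, ?_, hi⟩, le_rfl⟩
      · rw [Memory.setArr_reg, Memory.setReg_reg_of_ne _ _ (by omega), hci]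
      · rw [Memory.setArr_reg, Memory.setReg_reg_of_ne _ _ (by omega), hN]
      · intro l hl
        ext j
        simp only [Memory.setReg_arr, Memory.setArr_arr, hl, false_and, if_false, h3 l hl]
      · intro x hx
        rw [Memory.setReg_reg_of_ne _ _ (by omega), Memory.setReg_reg_of_ne _ _ (by omega),
          Memory.setArr_reg, Memory.setReg_reg_of_ne _ _ (by omega), h3' x hx]
      · intro j
        simp only [Memory.setReg_arr, Memory.setArr_arr, Memory.setReg_reg_self, true_and,
          Memory.setReg_reg_of_ne _ _ (show d ≠ d + 1 by omega), hci, Nat.cast_inj,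
          h3 k' hkk.symm, v1 i hi]
        by_cases hji : j = i
        · subst hji
          simp
        · rw [if_neg hji, h4]
          simp only [show (j < i + 1) = (j < i) from propext ⟨fun _ => by omega, fun _ => by omega⟩])
    m1 (by rw [r1 1 (by omega), Γ.reg_one hm])
    ⟨fun _ _ => rfl, fun x hx => by rw [Memory.setReg_reg_of_ne _ _ (by omega), r1 x hx],
      fun j => by simp [h1 k hkk, hA a m hm], Nat.zero_le _⟩
  refine ⟨m2, _, .seq e1 e2, ?_, fun x _ hx => r2 x hx, by beta_reduce; omega⟩
  have hrel : Γ.rel a { m with arr := m1.arr } := hbuf a m hm _ rfl h1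
  exact Γ.congr (hset a _ hrel { m with arr := m2.arr } _ rfl h2 v2) rfl
    fun x hx => r2 x (by omega)

end Statements

/-! ### Arithmetic with bounded loops -/

/-- The indicator of a proposition. -/
noncomputable def ind (P : Prop) : ℕ := @ite _ P (Classical.propDecidable P) 1 0

theorem ind_of {P : Prop} (h : P) : ind P = 1 := if_pos h

theorem ind_of_not {P : Prop} (h : ¬ P) : ind P = 0 := if_neg h

@[simp] theorem ind_eq_one {P : Prop} : ind P = 1 ↔ P := by
  by_cases h : P <;> simp [ind, h]

/-- Multiplication, if `x ≤ N`. -/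
def mulN (N x y : ℕ) : ℕ := ∑ i ∈ Finset.range N, if i < x then y else 0

/-- Division, if `x ≤ N`. -/
def divN (N x y : ℕ) : ℕ := ∑ i ∈ Finset.range N, if mulN N (i + 1) y ≤ x then 1 else 0

/-- Division of `a` by `b ^ t`, if `a ≤ N` and `t ≤ N`. -/
def shiftN (N b a t : ℕ) : ℕ := Nat.rec a (fun i acc => if i < t then divN N acc b else acc) N

/-- The digit of `a` at position `t` to base `b`. -/
def digN (N b a t : ℕ) : ℕ := shiftN N b a t - mulN N (divN N (shiftN N b a t) b) b

section Arithmetic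

variable {α : Type} {Γ : Ctx α}

theorem PFP.ind {P : α → Prop} (h : PFP Γ P) : PF Γ fun a => ind (P a) := h

theorem PF.mulN {f g : α → ℕ} (hf : PF Γ f) (hg : PF Γ g) :
    PF Γ fun a => mulN (Γ.size a) (f a) (g a) :=
  (PF.sum (F := fun a i => @_root_.ite _ (i < f a) (Classical.propDecidable _) (g a) 0) fun _ _ =>
    PF.ite (PFP.lt .var hf.lift) hg.lift (.const 0)).congr fun a => by
      unfold Incentive.mulN; congr! 2

theorem PF.divN {f g : α → ℕ} (hf : PF Γ f) (hg : PF Γ g) :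
    PF Γ fun a => divN (Γ.size a) (f a) (g a) :=
  (PF.sum (F := fun a i => @_root_.ite _ (Incentive.mulN (Γ.size a) (i + 1) (g a) ≤ f a)
    (Classical.propDecidable _) 1 0) fun _ _ =>
    PFP.le (PF.mulN (.add .var (.const 1)) hg.lift) hf.lift).congr fun a => by
      unfold Incentive.divN; congr! 2

theorem PF.shiftN {b f g : α → ℕ} (hb : PF Γ b) (hf : PF Γ f) (hg : PF Γ g) :
    PF Γ fun a => shiftN (Γ.size a) (b a) (f a) (g a) :=
  (PF.fold (F := fun a i acc => @_root_.ite _ (i < g a) (Classical.propDecidable _)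
    (Incentive.divN (Γ.size a) acc (b a)) acc) hf fun _ _ =>
    PF.ite (PFP.lt .var hg.lift.lift) (PF.divN PF.var.lift hb.lift.lift) PF.var.lift).congr
      fun a => by unfold Incentive.shiftN; congr! 4

theorem PF.digN {b f g : α → ℕ} (hb : PF Γ b) (hf : PF Γ f) (hg : PF Γ g) :
    PF Γ fun a => digN (Γ.size a) (b a) (f a) (g a) :=
  (hb.shiftN hf hg).sub (((hb.shiftN hf hg).divN hb).mulN hb)

end Arithmetic

/-! ### The state of the computation -/

/-- The abstract content of the memory: the order `n` of the graph, the range `N` of the loops,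
the number `K` of slots, a distinguished vertex `z`, the weight `q` that remains to be
distributed, a flag, the positive parts of the given thresholds, the adjacency matrix, the output,
the current thresholds, and the tables of connections and of items. -/
structure State where
  n : ℕ
  N : ℕ
  K : ℕ
  z : ℕ
  q : ℕ
  done : ℕ
  thr : ℕ → ℕ
  adj : ℕ → ℕ
  out : ℕ → ℕ
  T : ℕ → ℕ
  reach : ℕ → ℕ
  tab : ℕ → ℕ

/-- The memory `m` presents the state `s`. -/
structure Represents (s : State) (m : Memory) : Prop where
  n : m.reg 0 = (s.n : ℤ)
  N : m.reg 1 = (s.N : ℤ)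
  K : m.reg 2 = (s.K : ℤ)
  z : m.reg 3 = (s.z : ℤ)
  q : m.reg 4 = (s.q : ℤ)
  done : m.reg 5 = (s.done : ℤ)
  thr : ∀ i : ℕ, (m.arr 0 (i : ℤ)).toNat = s.thr i
  adj : ∀ i : ℕ, m.arr 1 (i : ℤ) = (s.adj i : ℤ)
  out : ∀ i : ℕ, m.arr 2 (i : ℤ) = (s.out i : ℤ)
  T : ∀ i : ℕ, m.arr 3 (i : ℤ) = (s.T i : ℤ)
  reach : ∀ i : ℕ, m.arr 4 (i : ℤ) = (s.reach i : ℤ)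
  tab : ∀ i : ℕ, m.arr 5 (i : ℤ) = (s.tab i : ℤ)

/-- The states as a context. -/
def base : Ctx State where
  rel := Represents
  size := State.N
  depth := 6
  one_lt := by norm_num
  reg_one h := h.N
  congr h ha hr := by
    refine ⟨?_, ?_, ?_, ?_, ?_, ?_, ?_, ?_, ?_, ?_, ?_, ?_⟩
    · rw [hr 0 (by norm_num), h.n]
    · rw [hr 1 (by norm_num), h.N]
    · rw [hr 2 (by norm_num), h.K]
    · rw [hr 3 (by norm_num), h.z]
    · rw [hr 4 (by norm_num), h.q]
    · rw [hr 5 (by norm_num), h.done]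
    · rw [ha]; exact h.thr
    · rw [ha]; exact h.adj
    · rw [ha]; exact h.out
    · rw [ha]; exact h.T
    · rw [ha]; exact h.reach
    · rw [ha]; exact h.tab

/-- A context whose objects carry a state. -/
structure Over {α : Type} (Γ : Ctx α) (π : α → State) : Prop where
  size : ∀ a, Γ.size a = (π a).N
  n : PF Γ fun a => (π a).n
  K : PF Γ fun a => (π a).K
  z : PF Γ fun a => (π a).z
  q : PF Γ fun a => (π a).q
  thr : ∀ a m, Γ.rel a m → ∀ i : ℕ, (m.arr 0 (i : ℤ)).toNat = (π a).thr i
  adj : HoldsArr Γ 1 fun a => (π a).adj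
  out : HoldsArr Γ 2 fun a => (π a).out
  T : HoldsArr Γ 3 fun a => (π a).T
  reach : HoldsArr Γ 4 fun a => (π a).reach
  tab : HoldsArr Γ 5 fun a => (π a).tab

/-! ### The rules -/

namespace State

variable (s : State)

/-- The digits of a code, to base `n + 2`. -/
def dig (a t : ℕ) : ℕ := digN s.N (s.n + 2) a t

/-- Adjacency. -/
def E (y u : ℕ) : Prop := y < s.n ∧ u < s.n ∧ s.adj (mulN s.N y s.n + u) = 1

/-- The vertex in slot `l` of an item; the value `n` stands for an empty slot. -/
def slot (a l : ℕ) : ℕ := s.dig a l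

/-- The label of the vertex in slot `l` of an item. -/
def lab (a l : ℕ) : ℕ := s.dig a (s.K + l)

/-- The number of earlier neighbours that the vertex in slot `l` of an item is granted. -/
def cnt (a l : ℕ) : ℕ := s.dig a (s.K + s.K + l)

/-- The first component of the descriptor of the vertex set of an item. -/
def root (a : ℕ) : ℕ := s.dig a (s.K + s.K + s.K)

/-- The second component of the descriptor of the vertex set of an item. -/
def low (a : ℕ) : ℕ := s.dig a (s.K + s.K + s.K + 1)

/-- The cost of an item. -/
def cost (a : ℕ) : ℕ :=
  s.dig a (s.K + s.K + s.K + 2) + mulN s.N (s.n + 2) (s.dig a (s.K + s.K + s.K + 3))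

/-- The rule for codes `e` that stand for two vertices connected outside the slots. -/
def reachRule (e : ℕ) : Prop :=
  s.dig e s.K < s.n ∧ s.dig e (s.K + 1) < s.n ∧
    (∀ l < s.N, l < s.K → s.dig e l ≠ s.dig e (s.K + 1)) ∧
    (s.dig e s.K = s.dig e (s.K + 1) ∨
      ∃ e' < s.N, s.reach e' = 1 ∧ (∀ l < s.N, l < s.K + 1 → s.dig e' l = s.dig e l) ∧
        s.E (s.dig e' (s.K + 1)) (s.dig e (s.K + 1)))

/-- `u` belongs to the vertex set of the item `a`. -/
def mem (a u : ℕ) : Prop :=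
  ∃ e < s.N, s.reach e = 1 ∧ (∀ l < s.N, l < s.K → s.dig e l = s.slot a l) ∧
    s.dig e (s.K + 1) = u ∧ s.low a ≤ s.dig e s.K ∧
    (s.root a = s.n ∨ s.E (s.root a) (s.dig e s.K))

/-- The current thresholds, with the threshold of `z` decreased. -/
noncomputable def thrAt (v : ℕ) : ℕ := s.T v - ind (v = s.z)

/-- The number of occupied slots other than `i` with earlier neighbours of the vertex in slot `i`
of the item `b`. -/
noncomputable def slotCount (b i : ℕ) : ℕ :=
  ∑ l ∈ Finset.range s.N,
    ind (l < s.K ∧ l ≠ i ∧ s.E (s.slot b l) (s.slot b i) ∧ s.lab b l < s.lab b i)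

/-- The labels and counts of the items `a`, `b` and `c` fit together. -/
def Fits (a b c i : ℕ) : Prop :=
  ∀ l < s.N, l < s.K → s.slot c l = s.slot a l ∧ s.lab c l = s.lab a l ∧
    (l ≠ i → s.slot b l = s.slot a l ∧ s.lab b l = s.lab a l ∧
      s.cnt a l ≤ s.cnt b l + s.cnt c l +
        ind (s.E (s.slot a l) (s.slot b i) ∧ s.lab b i < s.lab a l))

/-- The vertex set of `a` is the disjoint union of those of `b` and `c` and of the vertex in
slot `i` of `b`. -/
def Splits (a b c i : ℕ) : Prop :=
  (∀ u < s.N, (s.mem a u → u = s.slot b i ∨ s.mem b u ∨ s.mem c u) ∧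
    (u = s.slot b i ∨ s.mem b u ∨ s.mem c u → s.mem a u)) ∧
  ¬ s.mem b (s.slot b i) ∧ ¬ s.mem c (s.slot b i) ∧ ∀ u < s.N, ¬ (s.mem b u ∧ s.mem c u)

/-- There are no edges between the two parts of `a`, and none to the vertex in slot `i` of `a`. -/
def Separates (a b c i : ℕ) : Prop :=
  ∀ u < s.N, u = s.slot b i ∨ s.mem b u →
    ¬ s.E (s.slot a i) u ∧ ∀ v < s.N, s.mem c v → ¬ s.E u v

/-- The item `a` arises from `b` and `c` by elimination of the vertex in slot `i` of `b`. -/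
def joinRule (a b c i : ℕ) : Prop :=
  i < s.K ∧ s.slot b i < s.n ∧ s.Fits a b c i ∧ s.cnt a i ≤ s.cnt c i ∧
    s.cost b + s.cost c + (s.thrAt (s.slot b i) - (s.cnt b i + s.slotCount b i)) ≤ s.cost a ∧
    s.Splits a b c i ∧ s.Separates a b c i

/-- The item `a` has an empty vertex set. -/
def emptyRule (a : ℕ) : Prop :=
  (∀ u < s.N, ¬ s.mem a u) ∧ ∀ l < s.N, l < s.K → s.cnt a l = 0

/-- The rule for items. -/
def itemRule (a : ℕ) : Prop :=
  s.emptyRule a ∨ ∃ b < s.N, s.tab b = 1 ∧ ∃ c < s.N, s.tab c = 1 ∧ ∃ i < s.N, s.joinRule a b c i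

/-- The table contains an item for the whole graph of cost at most `q`. -/
def Decides (q : ℕ) : Prop :=
  ∃ a < s.N, s.tab a = 1 ∧ (∀ l < s.N, l < s.K → s.slot a l = s.n) ∧ s.root a = s.n ∧
    s.low a = 0 ∧ s.cost a ≤ q

end State

/-! ### Evaluation of the rules in polynomial time -/

namespace Over

variable {α : Type} {Γ : Ctx α} {π : α → State}

theorem lift (h : Over Γ π) {d : ℕ} {hd : Γ.depth ≤ d} : Over (Γ.ext d hd) fun x => π x.1 where
  size a := h.size a.1
  n := h.n.lift
  K := h.K.lift
  z := h.z.lift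
  q := h.q.lift
  thr a m hm := h.thr a.1 m hm.1
  adj := h.adj.lift
  out := h.out.lift
  T := h.T.lift
  reach := h.reach.lift
  tab := h.tab.lift

theorem base_id : Over base fun s => s where
  size _ := rfl
  n := .ofReg 0 (by decide) fun _ _ h => h.n
  K := .ofReg 2 (by decide) fun _ _ h => h.K
  z := .ofReg 3 (by decide) fun _ _ h => h.z
  q := .ofReg 4 (by decide) fun _ _ h => h.q
  thr _ _ h := h.thr
  adj _ _ h := h.adj
  out _ _ h := h.out
  T _ _ h := h.T
  reach _ _ h := h.reach
  tab _ _ h := h.tab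

theorem N (h : Over Γ π) : PF Γ fun a => (π a).N := PF.size.congr h.size

theorem ex (h : Over Γ π) {P : α → ℕ → Prop}
    (hP : ∀ d hd, PFP (Γ.ext d hd) fun x => P x.1 x.2) : PFP Γ fun a => ∃ i < (π a).N, P a i :=
  (PFP.ex hP).congr fun a => by rw [h.size]

theorem all (h : Over Γ π) {P : α → ℕ → Prop}
    (hP : ∀ d hd, PFP (Γ.ext d hd) fun x => P x.1 x.2) : PFP Γ fun a => ∀ i < (π a).N, P a i :=
  (PFP.all hP).congr fun a => by rw [h.size]

theorem sum (h : Over Γ π) {F : α → ℕ → ℕ} (hF : ∀ d hd, PF (Γ.ext d hd) fun x => F x.1 x.2) :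
    PF Γ fun a => ∑ i ∈ Finset.range (π a).N, F a i :=
  (PF.sum hF).congr fun a => by rw [h.size]

theorem mulN (h : Over Γ π) {f g : α → ℕ} (hf : PF Γ f) (hg : PF Γ g) :
    PF Γ fun a => mulN (π a).N (f a) (g a) :=
  (PF.mulN hf hg).congr fun a => by rw [h.size]

variable {f g k l : α → ℕ}

theorem dig (h : Over Γ π) (hf : PF Γ f) (hg : PF Γ g) :
    PF Γ fun a => (π a).dig (f a) (g a) :=
  (PF.digN (h.n.add (.const 2)) hf hg).congr fun a => by rw [h.size]; rfl

theorem E (h : Over Γ π) (hf : PF Γ f) (hg : PF Γ g) : PFP Γ fun a => (π a).E (f a) (g a) :=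
  (PFP.lt hf h.n).and ((PFP.lt hg h.n).and
    (PFP.eq (((h.mulN hf h.n).add hg).load h.adj) (.const 1)))

theorem slot (h : Over Γ π) (hf : PF Γ f) (hg : PF Γ g) :
    PF Γ fun a => (π a).slot (f a) (g a) := h.dig hf hg

theorem lab (h : Over Γ π) (hf : PF Γ f) (hg : PF Γ g) :
    PF Γ fun a => (π a).lab (f a) (g a) := h.dig hf (h.K.add hg)

theorem cnt (h : Over Γ π) (hf : PF Γ f) (hg : PF Γ g) :
    PF Γ fun a => (π a).cnt (f a) (g a) := h.dig hf ((h.K.add h.K).add hg)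

theorem root (h : Over Γ π) (hf : PF Γ f) : PF Γ fun a => (π a).root (f a) :=
  h.dig hf ((h.K.add h.K).add h.K)

theorem low (h : Over Γ π) (hf : PF Γ f) : PF Γ fun a => (π a).low (f a) :=
  h.dig hf (((h.K.add h.K).add h.K).add (.const 1))

theorem cost (h : Over Γ π) (hf : PF Γ f) : PF Γ fun a => (π a).cost (f a) :=
  (h.dig hf (((h.K.add h.K).add h.K).add (.const 2))).add
    (h.mulN (h.n.add (.const 2)) (h.dig hf (((h.K.add h.K).add h.K).add (.const 3))))

theorem reachRule (h : Over Γ π) (hf : PF Γ f) : PFP Γ fun a => (π a).reachRule (f a) :=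
  (PFP.lt (h.dig hf h.K) h.n).and <| (PFP.lt (h.dig hf (h.K.add (.const 1))) h.n).and <|
    (h.all fun _ _ => (PFP.lt .var h.K.lift).imp
      (PFP.eq (h.lift.dig hf.lift .var) (h.dig hf (h.K.add (.const 1))).lift).not).and <|
    (PFP.eq (h.dig hf h.K) (h.dig hf (h.K.add (.const 1)))).or <|
    h.ex fun _ _ => (PFP.eq (PF.load .var h.lift.reach) (.const 1)).and <|
      (h.lift.all fun _ _ => (PFP.lt .var (h.K.add (.const 1)).lift.lift).imp
        (PFP.eq (h.lift.lift.dig PF.var.lift .var) (h.lift.lift.dig hf.lift.lift .var))).and <|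
      h.lift.E (h.lift.dig .var (h.K.add (.const 1)).lift) (h.dig hf (h.K.add (.const 1))).lift

theorem mem (h : Over Γ π) (hf : PF Γ f) (hg : PF Γ g) : PFP Γ fun a => (π a).mem (f a) (g a) :=
  h.ex fun _ _ => (PFP.eq (PF.load .var h.lift.reach) (.const 1)).and <|
    (h.lift.all fun _ _ => (PFP.lt .var h.K.lift.lift).imp
      (PFP.eq (h.lift.lift.dig PF.var.lift .var) (h.lift.lift.slot hf.lift.lift .var))).and <|
    (PFP.eq (h.lift.dig .var (h.K.add (.const 1)).lift) hg.lift).and <|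
    (PFP.le (h.low hf).lift (h.lift.dig .var h.K.lift)).and <|
    (PFP.eq (h.root hf).lift h.n.lift).or
      (h.lift.E (h.root hf).lift (h.lift.dig .var h.K.lift))

theorem thrAt (h : Over Γ π) (hf : PF Γ f) : PF Γ fun a => (π a).thrAt (f a) :=
  (hf.load h.T).sub (PFP.eq hf h.z).ind

theorem slotCount (h : Over Γ π) (hf : PF Γ f) (hg : PF Γ g) :
    PF Γ fun a => (π a).slotCount (f a) (g a) :=
  h.sum fun _ _ => PFP.ind <| (PFP.lt .var h.K.lift).and <| (PFP.eq .var hg.lift).not.and <|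
    (h.lift.E (h.lift.slot hf.lift .var) (h.slot hf hg).lift).and
      (PFP.lt (h.lift.lab hf.lift .var) (h.lab hf hg).lift)

theorem Fits (h : Over Γ π) (hf : PF Γ f) (hg : PF Γ g) (hk : PF Γ k) (hl : PF Γ l) :
    PFP Γ fun a => (π a).Fits (f a) (g a) (k a) (l a) :=
  h.all fun _ _ => (PFP.lt .var h.K.lift).imp <|
    (PFP.eq (h.lift.slot hk.lift .var) (h.lift.slot hf.lift .var)).and <|
    (PFP.eq (h.lift.lab hk.lift .var) (h.lift.lab hf.lift .var)).and <|
    (PFP.eq .var hl.lift).not.imp <|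
    (PFP.eq (h.lift.slot hg.lift .var) (h.lift.slot hf.lift .var)).and <|
    (PFP.eq (h.lift.lab hg.lift .var) (h.lift.lab hf.lift .var)).and <|
    PFP.le (h.lift.cnt hf.lift .var) <|
      ((h.lift.cnt hg.lift .var).add (h.lift.cnt hk.lift .var)).add <| PFP.ind <|
      (h.lift.E (h.lift.slot hf.lift .var) (h.slot hg hl).lift).and
        (PFP.lt (h.lab hg hl).lift (h.lift.lab hf.lift .var))

theorem Splits (h : Over Γ π) (hf : PF Γ f) (hg : PF Γ g) (hk : PF Γ k) (hl : PF Γ l) :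
    PFP Γ fun a => (π a).Splits (f a) (g a) (k a) (l a) :=
  (h.all fun _ _ =>
    have hu := (PFP.eq .var (h.slot hg hl).lift).or
      ((h.lift.mem hg.lift .var).or (h.lift.mem hk.lift .var))
    ((h.lift.mem hf.lift .var).imp hu).and (hu.imp (h.lift.mem hf.lift .var))).and <|
  (h.mem hg (h.slot hg hl)).not.and <| (h.mem hk (h.slot hg hl)).not.and <|
  h.all fun _ _ => ((h.lift.mem hg.lift .var).and (h.lift.mem hk.lift .var)).not

theorem Separates (h : Over Γ π) (hf : PF Γ f) (hg : PF Γ g) (hk : PF Γ k) (hl : PF Γ l) :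
    PFP Γ fun a => (π a).Separates (f a) (g a) (k a) (l a) :=
  h.all fun _ _ =>
    ((PFP.eq .var (h.slot hg hl).lift).or (h.lift.mem hg.lift .var)).imp <|
    (h.lift.E (h.slot hf hl).lift .var).not.and <|
    h.lift.all fun _ _ => (h.lift.lift.mem hk.lift.lift .var).imp
      (h.lift.lift.E PF.var.lift .var).not

theorem joinRule (h : Over Γ π) (hf : PF Γ f) (hg : PF Γ g) (hk : PF Γ k) (hl : PF Γ l) :
    PFP Γ fun a => (π a).joinRule (f a) (g a) (k a) (l a) :=
  (PFP.lt hl h.K).and <| (PFP.lt (h.slot hg hl) h.n).and <| (h.Fits hf hg hk hl).and <|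
    (PFP.le (h.cnt hf hl) (h.cnt hk hl)).and <|
    (PFP.le (((h.cost hg).add (h.cost hk)).add <|
      (h.thrAt (h.slot hg hl)).sub ((h.cnt hg hl).add (h.slotCount hg hl))) (h.cost hf)).and <|
    (h.Splits hf hg hk hl).and (h.Separates hf hg hk hl)

theorem itemRule (h : Over Γ π) (hf : PF Γ f) : PFP Γ fun a => (π a).itemRule (f a) :=
  PFP.or ((h.all fun _ _ => (h.lift.mem hf.lift .var).not).and
    (h.all fun _ _ => (PFP.lt .var h.K.lift).imp (PFP.eq (h.lift.cnt hf.lift .var) (.const 0)))) <|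
  h.ex fun _ _ => (PFP.eq (PF.load .var h.lift.tab) (.const 1)).and <|
  h.lift.ex fun _ _ => (PFP.eq (PF.load .var h.lift.lift.tab) (.const 1)).and <|
  h.lift.lift.ex fun _ _ =>
    h.lift.lift.lift.joinRule hf.lift.lift.lift PF.var.lift.lift PF.var.lift .var

theorem Decides (h : Over Γ π) (hf : PF Γ f) : PFP Γ fun a => (π a).Decides (f a) :=
  h.ex fun _ _ => (PFP.eq (PF.load .var h.lift.tab) (.const 1)).and <|
    (h.lift.all fun _ _ => (PFP.lt .var h.K.lift.lift).imp
      (PFP.eq (h.lift.lift.slot PF.var.lift .var) h.n.lift.lift)).and <|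
    (PFP.eq (h.lift.root .var) h.n.lift).and <| (PFP.eq (h.lift.low .var) (.const 0)).and
      (PFP.le (h.lift.cost .var) hf.lift)

end Over

/-! ### The program -/

namespace State

/-- Write `F` into the cells of `A` below the range. -/
def overwrite (s : State) (F A : ℕ → ℕ) : ℕ → ℕ := fun i => if i < s.N then F i else A i

/-- Clear the table of connections. -/
def clearReach (s : State) : State := { s with reach := s.overwrite (fun _ => 0) s.reach }

/-- Apply the rule for connections once. -/
noncomputable def stepReach (s : State) : State :=
  { s with reach := s.overwrite (fun e => ind (s.reachRule e)) s.reach }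

/-- Compute the table of connections. -/
noncomputable def reachClosure (s : State) : State := stepReach^[s.N] s.clearReach

/-- Clear the table of items. -/
def clearTab (s : State) : State := { s with tab := s.overwrite (fun _ => 0) s.tab }

/-- Apply the rule for items once. -/
noncomputable def stepTab (s : State) : State :=
  { s with tab := s.overwrite (fun e => ind (s.itemRule e)) s.tab }

/-- Compute the table of items. -/
noncomputable def itemClosure (s : State) : State := stepTab^[s.N] s.clearTab

/-- Charge one unit to the vertex `z`. -/
noncomputable def commit (s : State) : State :=
  { s with
    out := s.overwrite (fun u => s.out u + ind (u = s.z)) s.out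
    T := s.overwrite s.thrAt s.T
    q := s.q - 1 }

open Classical in
/-- Charge one unit to the vertex `z`, if this is optimal. -/
noncomputable def attempt (s : State) : State :=
  { (if s.z < s.n ∧ 0 < s.q ∧ 0 < s.T s.z ∧ s.itemClosure.Decides (s.q - 1) then
      s.itemClosure.commit else s.itemClosure) with z := s.z + 1 }

/-- Try all vertices. -/
noncomputable def round (s : State) : State := attempt^[s.N] { s with z := 0 }

/-- Distribute the optimal weight. -/
noncomputable def finish (s : State) : State :=
  round^[s.N] { s with
    q := ∑ q ∈ Finset.range s.N, ind (¬ s.Decides q)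
    done := 1 }

/-- Increase the number of slots. -/
def start (s : State) : State :=
  { s with
    K := s.K + 1
    -- No vertex equals `n`, so the first tables are computed with undiminished thresholds.
    z := s.n
    N := mulN s.N (s.n + 2) (mulN s.N (s.n + 2) (mulN s.N (s.n + 2) s.N)) }

/-- Set up the tables. -/
noncomputable def tables (s : State) : State := s.start.reachClosure.itemClosure

open Classical in
/-- Work with one more slot. -/
noncomputable def stage (s : State) : State :=
  if ∃ q < s.tables.N, s.tables.Decides q then s.tables.finish else s.tables

/-- The initial thresholds. -/
noncomputable def prepare (s : State) : State :=
  { s with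
    N := mulN s.N s.N (mulN s.N s.N (mulN s.N s.N s.N))
    T := s.overwrite (fun u => s.thr u - (s.thr u - s.n)) s.T
    out := s.overwrite (fun u => s.thr u - s.n) s.out }

end State

/-! ### Compilation of the state transformations -/

theorem St.congr {α : Type} {Γ : Ctx α} {f g : α → α} (h : St Γ f) (hfg : ∀ a, f a = g a) :
    St Γ g := by
  rwa [← (funext hfg : f = g)]

/-- Assignment to an array of a state. -/
theorem St.baseFill {set : State → (ℕ → ℕ) → State} {A : State → ℕ → ℕ} {F : State → ℕ → ℕ}
    (k : ℕ) (hk : k ≠ 6) (hA : HoldsArr base k A)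
    (hset : ∀ a m, Represents a m → ∀ (m' : Memory) (g : ℕ → ℕ), m'.reg = m.reg →
      (∀ l ≠ k, m'.arr l = m.arr l) → (∀ i : ℕ, m'.arr k (i : ℤ) = (g i : ℤ)) →
      Represents (set a g) m')
    (hF : ∀ d hd, PF (base.ext d hd) fun x => F x.1 x.2) :
    St base fun s => set s (s.overwrite (F s) (A s)) := by
  refine St.fill (Γ := base) k 6 hk hA ?_ hset hF
  intro s m h m' hr ha
  exact ⟨hr ▸ h.n, hr ▸ h.N, hr ▸ h.K, hr ▸ h.z, hr ▸ h.q, hr ▸ h.done,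
    by rw [ha 0 (by norm_num)]; exact h.thr, by rw [ha 1 (by norm_num)]; exact h.adj,
    by rw [ha 2 (by norm_num)]; exact h.out, by rw [ha 3 (by norm_num)]; exact h.T,
    by rw [ha 4 (by norm_num)]; exact h.reach, by rw [ha 5 (by norm_num)]; exact h.tab⟩

section Fills

variable {F : State → ℕ → ℕ}

theorem St.setOut (hF : ∀ d hd, PF (base.ext d hd) fun x => F x.1 x.2) :
    St base fun s => { s with out := s.overwrite (F s) s.out } := by
  refine St.baseFill (set := fun s g => { s with out := g }) 2 (by norm_num)
    Over.base_id.out ?_ hF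
  intro s m h m' g hr ha hk
  exact ⟨hr ▸ h.n, hr ▸ h.N, hr ▸ h.K, hr ▸ h.z, hr ▸ h.q, hr ▸ h.done,
    by rw [ha 0 (by norm_num)]; exact h.thr, by rw [ha 1 (by norm_num)]; exact h.adj,
    hk, by rw [ha 3 (by norm_num)]; exact h.T,
    by rw [ha 4 (by norm_num)]; exact h.reach, by rw [ha 5 (by norm_num)]; exact h.tab⟩

theorem St.setT (hF : ∀ d hd, PF (base.ext d hd) fun x => F x.1 x.2) :
    St base fun s => { s with T := s.overwrite (F s) s.T } := by
  refine St.baseFill (set := fun s g => { s with T := g }) 3 (by norm_num) Over.base_id.T ?_ hF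
  intro s m h m' g hr ha hk
  exact ⟨hr ▸ h.n, hr ▸ h.N, hr ▸ h.K, hr ▸ h.z, hr ▸ h.q, hr ▸ h.done,
    by rw [ha 0 (by norm_num)]; exact h.thr, by rw [ha 1 (by norm_num)]; exact h.adj,
    by rw [ha 2 (by norm_num)]; exact h.out, hk,
    by rw [ha 4 (by norm_num)]; exact h.reach, by rw [ha 5 (by norm_num)]; exact h.tab⟩

theorem St.setReach (hF : ∀ d hd, PF (base.ext d hd) fun x => F x.1 x.2) :
    St base fun s => { s with reach := s.overwrite (F s) s.reach } := by
  refine St.baseFill (set := fun s g => { s with reach := g }) 4 (by norm_num)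
    Over.base_id.reach ?_ hF
  intro s m h m' g hr ha hk
  exact ⟨hr ▸ h.n, hr ▸ h.N, hr ▸ h.K, hr ▸ h.z, hr ▸ h.q, hr ▸ h.done,
    by rw [ha 0 (by norm_num)]; exact h.thr, by rw [ha 1 (by norm_num)]; exact h.adj,
    by rw [ha 2 (by norm_num)]; exact h.out, by rw [ha 3 (by norm_num)]; exact h.T,
    hk, by rw [ha 5 (by norm_num)]; exact h.tab⟩

theorem St.setTab (hF : ∀ d hd, PF (base.ext d hd) fun x => F x.1 x.2) :
    St base fun s => { s with tab := s.overwrite (F s) s.tab } := by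
  refine St.baseFill (set := fun s g => { s with tab := g }) 5 (by norm_num)
    Over.base_id.tab ?_ hF
  intro s m h m' g hr ha hk
  exact ⟨hr ▸ h.n, hr ▸ h.N, hr ▸ h.K, hr ▸ h.z, hr ▸ h.q, hr ▸ h.done,
    by rw [ha 0 (by norm_num)]; exact h.thr, by rw [ha 1 (by norm_num)]; exact h.adj,
    by rw [ha 2 (by norm_num)]; exact h.out, by rw [ha 3 (by norm_num)]; exact h.T,
    by rw [ha 4 (by norm_num)]; exact h.reach, hk⟩

end Fills

section Assignments

variable {f : State → ℕ}

theorem St.setN (hf : PF base f) : St base fun s => { s with N := f s } :=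
  St.assign (Γ := base) (set := fun s v => { s with N := v }) 1 (by decide) (fun s m h v =>
    ⟨by simpa [Memory.setReg_reg] using h.n, by simp,
      by simpa [Memory.setReg_reg] using h.K, by simpa [Memory.setReg_reg] using h.z,
      by simpa [Memory.setReg_reg] using h.q, by simpa [Memory.setReg_reg] using h.done,
      h.thr, h.adj, h.out, h.T, h.reach, h.tab⟩) hf

theorem St.setK (hf : PF base f) : St base fun s => { s with K := f s } :=
  St.assign (Γ := base) (set := fun s v => { s with K := v }) 2 (by decide) (fun s m h v =>
    ⟨by simpa [Memory.setReg_reg] using h.n, by simpa [Memory.setReg_reg] using h.N,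
      by simp, by simpa [Memory.setReg_reg] using h.z,
      by simpa [Memory.setReg_reg] using h.q, by simpa [Memory.setReg_reg] using h.done,
      h.thr, h.adj, h.out, h.T, h.reach, h.tab⟩) hf

theorem St.setZ (hf : PF base f) : St base fun s => { s with z := f s } :=
  St.assign (Γ := base) (set := fun s v => { s with z := v }) 3 (by decide) (fun s m h v =>
    ⟨by simpa [Memory.setReg_reg] using h.n, by simpa [Memory.setReg_reg] using h.N,
      by simpa [Memory.setReg_reg] using h.K, by simp,
      by simpa [Memory.setReg_reg] using h.q, by simpa [Memory.setReg_reg] using h.done,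
      h.thr, h.adj, h.out, h.T, h.reach, h.tab⟩) hf

theorem St.setQ (hf : PF base f) : St base fun s => { s with q := f s } :=
  St.assign (Γ := base) (set := fun s v => { s with q := v }) 4 (by decide) (fun s m h v =>
    ⟨by simpa [Memory.setReg_reg] using h.n, by simpa [Memory.setReg_reg] using h.N,
      by simpa [Memory.setReg_reg] using h.K, by simpa [Memory.setReg_reg] using h.z,
      by simp, by simpa [Memory.setReg_reg] using h.done,
      h.thr, h.adj, h.out, h.T, h.reach, h.tab⟩) hf

theorem St.setDone (hf : PF base f) : St base fun s => { s with done := f s } :=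
  St.assign (Γ := base) (set := fun s v => { s with done := v }) 5 (by decide) (fun s m h v =>
    ⟨by simpa [Memory.setReg_reg] using h.n, by simpa [Memory.setReg_reg] using h.N,
      by simpa [Memory.setReg_reg] using h.K, by simpa [Memory.setReg_reg] using h.z,
      by simpa [Memory.setReg_reg] using h.q, by simp,
      h.thr, h.adj, h.out, h.T, h.reach, h.tab⟩) hf

end Assignments

/-- A property of states that is kept by `f` is kept by iteration. -/
theorem iterate_keep {α β : Type} {f : α → α} {g : α → β} (h : ∀ a, g (f a) = g a) (k : ℕ) (a : α) :
    g (f^[k] a) = g a := by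
  induction k with
  | zero => rfl
  | succ k ih => rw [Function.iterate_succ_apply', h, ih]

/-- The state without the table of connections. -/
def State.eraseReach (s : State) : State := { s with reach := fun _ => 0 }

/-- The state without the table of items. -/
def State.eraseTab (s : State) : State := { s with tab := fun _ => 0 }

/-- Equality up to one erased table yields equality of every other field by `congrArg`. -/
theorem State.eraseReach_reachClosure (s : State) : s.reachClosure.eraseReach = s.eraseReach :=
  iterate_keep (f := stepReach) (g := eraseReach) (fun _ => rfl) s.N s.clearReach

theorem State.eraseTab_itemClosure (s : State) : s.itemClosure.eraseTab = s.eraseTab :=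
  iterate_keep (f := stepTab) (g := eraseTab) (fun _ => rfl) s.N s.clearTab

theorem State.reachClosure_N (s : State) : s.reachClosure.N = s.N :=
  (congrArg State.N s.eraseReach_reachClosure :)

theorem State.itemClosure_N (s : State) : s.itemClosure.N = s.N :=
  (congrArg State.N s.eraseTab_itemClosure :)

theorem State.attempt_N (s : State) : s.attempt.N = s.N := by
  unfold State.attempt
  split_ifs
  · exact s.itemClosure_N
  · exact s.itemClosure_N

theorem State.round_N (s : State) : s.round.N = s.N := iterate_keep State.attempt_N _ _

theorem St.reachClosure : St base State.reachClosure := by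
  have h1 : St base State.clearReach := St.setReach (F := fun _ _ => 0) fun _ _ => .const 0
  have h2 : St base State.stepReach := St.setReach (F := fun s e => ind (s.reachRule e))
    fun _ _ => (Over.base_id.lift.reachRule .var).ind
  exact h1.seq (h2.iterate fun _ => rfl) fun _ => rfl

theorem St.itemClosure : St base State.itemClosure := by
  have h1 : St base State.clearTab := St.setTab (F := fun _ _ => 0) fun _ _ => .const 0
  have h2 : St base State.stepTab := St.setTab (F := fun s e => ind (s.itemRule e))
    fun _ _ => (Over.base_id.lift.itemRule .var).ind
  exact h1.seq (h2.iterate fun _ => rfl) fun _ => rfl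

theorem St.commit : St base State.commit :=
  ((St.setOut (F := fun s u => s.out u + ind (u = s.z)) fun _ _ => (PF.load .var Over.base_id.lift.out).add
    (PFP.eq .var Over.base_id.z.lift).ind).seq
    ((St.setT (F := fun s u => s.thrAt u) fun _ _ => Over.base_id.lift.thrAt .var).seq
      (St.setQ (Over.base_id.q.sub (.const 1))) fun _ => rfl) fun _ => rfl)

open Classical in
theorem St.attempt : St base State.attempt := by
  have hb := Over.base_id
  have h1 : St base fun s : State => if s.z < s.n ∧ 0 < s.q ∧ 0 < s.T s.z ∧ s.Decides (s.q - 1)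
      then s.commit else s :=
    (St.ite ((PFP.lt hb.z hb.n).and <| (PFP.lt (.const 0) hb.q).and <|
      (PFP.lt (.const 0) (hb.z.load hb.T)).and (hb.Decides (hb.q.sub (.const 1)))) St.commit .id).congr
      fun _ => by congr
  refine ((St.itemClosure.seq h1 State.itemClosure_N).seq (St.setZ (hb.z.add (.const 1)))
    fun s => ?_).congr fun s => ?_
  · change State.N _ = _
    split_ifs
    · exact s.itemClosure_N
    · exact s.itemClosure_N
  · have hz : s.itemClosure.z = s.z := (congrArg State.z s.eraseTab_itemClosure :)
    have hn : s.itemClosure.n = s.n := (congrArg State.n s.eraseTab_itemClosure :)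
    have hq : s.itemClosure.q = s.q := (congrArg State.q s.eraseTab_itemClosure :)
    have hT : s.itemClosure.T = s.T := (congrArg State.T s.eraseTab_itemClosure :)
    unfold State.attempt
    rw [hz, hn, hq, hT]
    split_ifs
    · simp only [State.commit, hz]
    · simp only [hz]

theorem St.round : St base State.round :=
  (St.setZ (f := fun _ => 0) (.const 0)).seq (St.iterate St.attempt State.attempt_N) fun _ => rfl

theorem St.finish : St base State.finish :=
  (St.setQ (f := fun s => ∑ q ∈ Finset.range s.N, ind (¬ s.Decides q))
    (Over.base_id.sum fun _ _ => (Over.base_id.lift.Decides .var).not.ind)).seq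
  ((St.setDone (f := fun _ => 1) (.const 1)).seq (St.iterate St.round State.round_N) fun _ => rfl)
    fun _ => rfl

theorem mulN_le (N x y : ℕ) : mulN N x y ≤ N * y := by
  unfold mulN
  calc _ ≤ ∑ i ∈ Finset.range N, y := Finset.sum_le_sum fun i _ => by split_ifs <;> simp
    _ = N * y := by simp

theorem polyBound_pow_four : PolyBound fun x => x * (x * (x * x)) :=
  PolyBound.id.mul (PolyBound.id.mul (PolyBound.id.mul .id))

theorem St.start : St base State.start := by
  have hb := Over.base_id
  have hB := hb.n.add (.const 2)
  exact (St.setK (hb.K.add (.const 1))).seq ((St.setZ hb.n).seq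
    (St.setN (hb.mulN hB (hb.mulN hB (hb.mulN hB hb.N)))) fun _ => rfl) fun _ => rfl

/-- As `mulN` cuts off its first factor at the range, this holds for every state, also if `n + 2`
exceeds the range. -/
theorem State.start_N_le (s : State) : s.start.N ≤ s.N * (s.N * (s.N * s.N)) :=
  (mulN_le _ _ _).trans <| Nat.mul_le_mul_left _ <| (mulN_le _ _ _).trans <|
    Nat.mul_le_mul_left _ (mulN_le _ _ _)

open Classical in
theorem St.stage : St base State.stage := by
  have h1 : St base State.tables :=
    St.start.seq' (St.reachClosure.seq St.itemClosure State.reachClosure_N)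
      polyBound_pow_four State.start_N_le
  have h2 : St base fun s : State => if ∃ q < s.N, s.Decides q then s.finish else s :=
    (St.ite (Over.base_id.ex fun _ _ => Over.base_id.lift.Decides .var) St.finish .id).congr
      fun _ => by congr
  refine h1.seq' h2 polyBound_pow_four fun s => ?_
  rw [show base.size s.tables = s.start.N from
    (State.itemClosure_N _).trans (State.reachClosure_N _)]
  exact s.start_N_le

theorem St.prepare : St base State.prepare := by
  have hb := Over.base_id
  have hthr : ∀ d hd, PF (base.ext d hd) fun x => x.1.thr x.2 := fun _ _ =>
    PF.loadToNat .var hb.lift.thr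
  exact (St.setOut (F := fun s u => s.thr u - s.n) fun d hd => (hthr d hd).sub hb.n.lift).seq
    ((St.setT (F := fun s u => s.thr u - (s.thr u - s.n)) fun d hd => (hthr d hd).sub ((hthr d hd).sub hb.n.lift)).seq
      (St.setN (hb.mulN hb.N (hb.mulN hb.N (hb.mulN hb.N hb.N)))) fun _ => rfl) fun _ => rfl

/-- While the flag is not set, `p` performs stages. -/
theorem exec_stages {p : Program} {T : ℕ → ℕ}
    (hp : ∀ (s : State) m, Represents s m → ∃ m' t, Exec p m m' t ∧ Represents s.stage m' ∧
      (∀ x, 6 ≤ x → x < 7 → m'.reg x = m.reg x) ∧ t ≤ T s.N) :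
    ∀ (k : ℕ) (s : State) (m : Memory), Represents s m → m.reg 6 = 1 →
      (∀ i < k, (State.stage^[i] s).done = 0) → (State.stage^[k] s).done = 1 →
      ∃ m' t, Exec (.loop 5 6 p) m m' t ∧ Represents (State.stage^[k] s) m' ∧
        t ≤ ∑ i ∈ Finset.range k, (T (State.stage^[i] s).N + 1) + 1 := by
  intro k
  induction k with
  | zero =>
    intro s m hm h6 _ hd
    refine ⟨m, 1, .loop_false ?_, hm, by simp⟩
    have : s.done = 1 := hd
    rw [hm.done, h6, this]
    norm_num
  | succ k ih =>
    intro s m hm h6 h0 hd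
    obtain ⟨m1, t1, e1, r1, k1, b1⟩ := hp s m hm
    obtain ⟨m2, t2, e2, r2, b2⟩ := ih s.stage m1 r1 (by rw [k1 6 le_rfl (by norm_num), h6])
      (fun i hi => h0 (i + 1) (by omega)) hd
    refine ⟨m2, _, .loop_true ?_ e1 e2, r2, ?_⟩
    · have : s.done = 0 := h0 0 (by omega)
      rw [hm.done, h6, this]
      norm_num
    · rw [Finset.sum_range_succ']
      simp only [Function.iterate_zero, _root_.id, Function.iterate_succ_apply]
      omega

/-- The whole program. -/
theorem exists_program : ∃ P C, ∀ (s : State) (m : Memory) (k : ℕ), Represents s m →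
    (∀ i < k, (State.stage^[i] { s with N := s.n + 2 }.prepare).done = 0) →
    (State.stage^[k] { s with N := s.n + 2 }.prepare).done = 1 →
    ∃ m' t, Exec P m m' t ∧ Represents (State.stage^[k] { s with N := s.n + 2 }.prepare) m' ∧
      t ≤ C * (s.N + 1) ^ C + C * (s.n + 2 + 1) ^ C + 2 + ∑ i ∈ Finset.range k,
        (C * ((State.stage^[i] { s with N := s.n + 2 }.prepare).N + 1) ^ C + 1) := by
  obtain ⟨p0, T0, ⟨C0, h0⟩, hp0⟩ := St.setN (Over.base_id.n.add (.const 2)) 6 le_rfl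
  obtain ⟨p1, T1, ⟨C1, h1⟩, hp1⟩ := St.prepare 6 le_rfl
  -- Register 6 lies above those of the state and will hold the constant 1 to which the flag is
  -- compared; scratch registers from 7 on keep it intact.
  obtain ⟨p2, T2, ⟨C2, h2⟩, hp2⟩ := St.stage 7 (by decide)
  have hmono : ∀ {T : ℕ → ℕ} {C : ℕ}, (∀ x, T x ≤ C * (x + 1) ^ C) → C ≤ C0 + C1 + C2 →
      ∀ x, T x ≤ (C0 + C1 + C2) * (x + 1) ^ (C0 + C1 + C2) := fun h hC x =>
    (h x).trans (Nat.mul_le_mul hC (Nat.pow_le_pow_right (by omega) hC))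
  refine ⟨.seq p0 (.seq p1 (.seq (.const 6 1) (.loop 5 6 p2))), C0 + C1 + C2,
    fun s m k hm hk hd => ?_⟩
  obtain ⟨m1, t1, e1, r1, -, b1⟩ := hp0 s m hm
  obtain ⟨m2, t2, e2, r2, -, b2⟩ := hp1 _ m1 r1
  have r3 : Represents _ (m2.setReg 6 1) := base.congr r2 rfl fun x hx =>
    Memory.setReg_reg_of_ne _ _ (show x < 6 from hx).ne
  obtain ⟨m3, t3, e3, r4, b3⟩ := exec_stages hp2 k _ _ r3 (by simp) hk hd
  refine ⟨m3, _, .seq e1 (.seq e2 (.seq (.const _ _ _) e3)), r4, ?_⟩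
  have h3 : t1 ≤ _ := b1.trans (hmono h0 (by omega) _)
  have h4 : t2 ≤ _ := b2.trans (hmono h1 (by omega) _)
  have h5 : ∑ i ∈ Finset.range k, (T2 (State.stage^[i] { s with N := s.n + 2 }.prepare).N + 1) ≤
      ∑ i ∈ Finset.range k, ((C0 + C1 + C2) *
        ((State.stage^[i] { s with N := s.n + 2 }.prepare).N + 1) ^ (C0 + C1 + C2) + 1) :=
    Finset.sum_le_sum fun i _ => Nat.add_le_add_right (hmono h2 (by omega) _) 1
  beta_reduce at b3
  change t1 ≤ (C0 + C1 + C2) * (s.N + 1) ^ (C0 + C1 + C2) at h3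
  change t2 ≤ (C0 + C1 + C2) * (s.n + 2 + 1) ^ (C0 + C1 + C2) at h4
  omega

/-! ### Digits -/

theorem mulN_eq {N x : ℕ} (h : x ≤ N) (y : ℕ) : mulN N x y = x * y := by
  unfold mulN
  rw [← Finset.sum_filter, Finset.sum_const, smul_eq_mul]
  congr 1
  rw [show (Finset.range N).filter (fun i => i < x) = Finset.range x by ext i; simp; omega]
  simp

theorem divN_eq {N x y : ℕ} (hx : x ≤ N) (hy : 0 < y) : divN N x y = x / y := by
  unfold divN
  rw [← Finset.sum_filter, Finset.sum_const, smul_eq_mul, mul_one]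
  have h1 : x / y ≤ N := (Nat.div_le_self x y).trans hx
  rw [show (Finset.range N).filter (fun i => mulN N (i + 1) y ≤ x) = Finset.range (x / y) by
    ext i
    simp only [Finset.mem_filter, Finset.mem_range]
    constructor
    · rintro ⟨hi, hle⟩
      rw [mulN_eq (by omega)] at hle
      exact (Nat.le_div_iff_mul_le hy).2 hle
    · intro hi
      refine ⟨by omega, ?_⟩
      rw [mulN_eq (by omega)]
      exact (Nat.le_div_iff_mul_le hy).1 hi]
  simp

theorem shiftN_eq {N b a t : ℕ} (hb : 0 < b) (ha : a ≤ N) (ht : t ≤ N) :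
    shiftN N b a t = a / b ^ t := by
  have key : ∀ M : ℕ, (Nat.rec a (fun i acc => if i < t then divN N acc b else acc) M : ℕ) =
      a / b ^ min M t := by
    intro M
    induction M with
    | zero => simp
    | succ M ih =>
      simp only [ih]
      split_ifs with h
      · rw [divN_eq ((Nat.div_le_self _ _).trans ha) hb, min_eq_left (by omega : M ≤ t),
          min_eq_left (by omega : M + 1 ≤ t), Nat.div_div_eq_div_mul, pow_succ]
      · rw [min_eq_right (by omega), min_eq_right (by omega)]
  unfold shiftN
  rw [key, min_eq_right ht]

theorem digN_eq {N b a t : ℕ} (hb : 0 < b) (ha : a ≤ N) (ht : t ≤ N) :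
    digN N b a t = a / b ^ t % b := by
  unfold digN
  have h1 : a / b ^ t ≤ N := (Nat.div_le_self _ _).trans ha
  rw [shiftN_eq hb ha ht, divN_eq h1 hb, mulN_eq ((Nat.div_le_self _ _).trans h1)]
  have := Nat.div_add_mod (a / b ^ t) b
  rw [mul_comm] at this
  omega

theorem exists_digits {b : ℕ} (hb : 0 < b) (L : ℕ) :
    ∀ f : ℕ → ℕ, (∀ t < L, f t < b) → ∃ a < b ^ L, ∀ t < L, a / b ^ t % b = f t := by
  induction L with
  | zero => exact fun f _ => ⟨0, by simp, by simp⟩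
  | succ L ih =>
    intro f hf
    obtain ⟨a, ha, h⟩ := ih (fun t => f (t + 1)) fun t ht => hf _ (by omega)
    have h0 := hf 0 (by omega)
    refine ⟨f 0 + b * a, ?_, fun t ht => ?_⟩
    · rw [pow_succ, mul_comm (b ^ L)]
      nlinarith
    · cases t with
      | zero => simp [Nat.mod_eq_of_lt h0]
      | succ t =>
        rw [pow_succ', ← Nat.div_div_eq_div_mul, Nat.add_mul_div_left _ _ hb,
          Nat.div_eq_of_lt h0, zero_add]
        exact h t (by omega)

/-! ### Iteration of a monotone rule -/

/-- The tables that arise by iterated application of the rule `R` below `N`. -/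
noncomputable def iterTable (N : ℕ) (R : (ℕ → ℕ) → ℕ → Prop) (A : ℕ → ℕ) : ℕ → ℕ → ℕ
  | 0 => fun i => if i < N then 0 else A i
  | k + 1 => fun i => if i < N then ind (R (iterTable N R A k) i) else iterTable N R A k i

section IterTable

variable {N : ℕ} {R : (ℕ → ℕ) → ℕ → Prop} {A : ℕ → ℕ}

/-- Induction on a least fixed point: the first table is empty, and each application of the rule
preserves `Q`. -/
theorem iterTable_induction (Q : ℕ → Prop)
    (hQ : ∀ A', (∀ e < N, A' e = 1 → Q e) → ∀ e < N, R A' e → Q e) (k : ℕ) :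
    ∀ e < N, iterTable N R A k e = 1 → Q e := by
  induction k with
  | zero => intro e he h; simp [iterTable, he] at h
  | succ k ih =>
    intro e he h
    simp only [iterTable, he, if_true, ind_eq_one] at h
    exact hQ _ ih e he h

theorem iterTable_succ {k e : ℕ} (he : e < N) :
    iterTable N R A (k + 1) e = 1 ↔ R (iterTable N R A k) e := by
  simp [iterTable, he]

theorem iterTable_le_succ
    (hmono : ∀ A A' : ℕ → ℕ, (∀ e < N, A e = 1 → A' e = 1) → ∀ e < N, R A e → R A' e) (k : ℕ) :
    ∀ e < N, iterTable N R A k e = 1 → iterTable N R A (k + 1) e = 1 := by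
  induction k with
  | zero => intro e he h; simp [iterTable, he] at h
  | succ k ih =>
    intro e he h
    rw [iterTable_succ he] at h ⊢
    exact hmono _ _ ih e he h

/-- The tables increase, and once two consecutive ones agree they are stationary. A subset of `N`
elements can grow strictly at most `N` times, so `N` iterations reach the fixed point. -/
theorem iterTable_closed
    (hmono : ∀ A A' : ℕ → ℕ, (∀ e < N, A e = 1 → A' e = 1) → ∀ e < N, R A e → R A' e) :
    ∀ e < N, R (iterTable N R A N) e → iterTable N R A N e = 1 := by
  let t : ℕ → Finset ℕ := fun k => (Finset.range N).filter fun e => iterTable N R A k e = 1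
  have hsub : ∀ k, t k ⊆ t (k + 1) := fun k e he => by
    simp only [t, Finset.mem_filter, Finset.mem_range] at he ⊢
    exact ⟨he.1, iterTable_le_succ hmono k e he.1 he.2⟩
  have hstep : ∀ k, t k = t (k + 1) → t (k + 1) = t (k + 2) := by
    intro k hk
    refine (hsub _).antisymm fun e he => ?_
    simp only [t, Finset.mem_filter, Finset.mem_range] at he ⊢
    refine ⟨he.1, ?_⟩
    have h := he.2
    rw [iterTable_succ he.1] at h ⊢
    refine hmono _ _ (fun e' he' h' => ?_) e he.1 h
    have : e' ∈ t (k + 1) := by simp [t, he', h']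
    rw [← hk] at this
    exact (Finset.mem_filter.1 this).2
  have hcard : ∀ k, t k = t (k + 1) ∨ k < (t (k + 1)).card := by
    intro k
    induction k with
    | zero =>
      by_cases h : t 0 = t 1
      · exact .inl h
      · exact .inr (lt_of_le_of_lt (Nat.zero_le _)
          (Finset.card_lt_card ((hsub 0).ssubset_of_ne h)))
    | succ k ih =>
      rcases ih with ih | ih
      · exact .inl (hstep k ih)
      · by_cases h : t (k + 1) = t (k + 2)
        · exact .inl h
        · have : (t (k + 1)).card < (t (k + 2)).card :=
            Finset.card_lt_card ((hsub (k + 1)).ssubset_of_ne h)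
          right
          change k + 1 < (t (k + 2)).card
          omega
  intro e he h
  have hle : (t (N + 1)).card ≤ N := (Finset.card_filter_le _ _).trans (by simp)
  have heq : t N = t (N + 1) := (hcard N).resolve_right (by omega)
  have : e ∈ t (N + 1) :=
    Finset.mem_filter.2 ⟨Finset.mem_range.2 he, (iterTable_succ he).2 h⟩
  rw [← heq] at this
  exact (Finset.mem_filter.1 this).2

end IterTable

/-! ### Connections -/

section Pieces

variable (n K : ℕ) (E : ℕ → ℕ → Prop)

/-- `u` can be reached from `w` outside the slots `S`. -/
inductive Conn (S : ℕ → ℕ) : ℕ → ℕ → Prop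
  | refl {w : ℕ} : w < n → (∀ l < K, S l ≠ w) → Conn S w w
  | step {w u v : ℕ} : Conn S w u → E u v → v < n → (∀ l < K, S l ≠ v) → Conn S w v

/-- The union of the components outside the slots `S` that contain a vertex `w ≥ j` adjacent to
`y`, or any vertex `w ≥ j`, if `y = n`. -/
def Piece (S : ℕ → ℕ) (y j : ℕ) : Set ℕ := {u | ∃ w, j ≤ w ∧ (y = n ∨ E y w) ∧ Conn n K E S w u}

variable {n K E} {S S' : ℕ → ℕ}

theorem Conn.congr (h : ∀ l < K, S l = S' l) {w u : ℕ} (hc : Conn n K E S w u) :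
    Conn n K E S' w u := by
  induction hc with
  | refl hw hS => exact .refl hw fun l hl => h l hl ▸ hS l hl
  | step _ hE hv hS ih => exact .step ih hE hv fun l hl => h l hl ▸ hS l hl

theorem piece_congr (h : ∀ l < K, S l = S' l) (y j : ℕ) :
    Piece n K E S y j = Piece n K E S' y j := by
  ext u
  exact ⟨fun ⟨w, h1, h2, h3⟩ => ⟨w, h1, h2, h3.congr h⟩,
    fun ⟨w, h1, h2, h3⟩ => ⟨w, h1, h2, h3.congr fun l hl => (h l hl).symm⟩⟩

theorem Conn.lt {w u : ℕ} (h : Conn n K E S w u) : u < n := by cases h <;> assumption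

theorem Conn.notMem {w u : ℕ} (h : Conn n K E S w u) : ∀ l < K, S l ≠ u := by cases h <;> assumption

theorem Conn.lt_left {w u : ℕ} (h : Conn n K E S w u) : w < n := by
  induction h <;> assumption

theorem Conn.notMem_left {w u : ℕ} (h : Conn n K E S w u) : ∀ l < K, S l ≠ w := by
  induction h <;> assumption

theorem Conn.trans {w u v : ℕ} (h : Conn n K E S w u) (h' : Conn n K E S u v) :
    Conn n K E S w v := by
  induction h' with
  | refl => exact h
  | step _ hE hv hS ih => exact .step ih hE hv hS

theorem Conn.symm (hsymm : ∀ u v, E u v → E v u) {w u : ℕ} (h : Conn n K E S w u) :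
    Conn n K E S u w := by
  induction h with
  | refl hw hS => exact .refl hw hS
  | step h hE hv hS ih =>
    exact (Conn.step (.refl hv hS) (hsymm _ _ hE) h.lt h.notMem).trans ih

theorem lt_of_mem_piece {y j u : ℕ} (h : u ∈ Piece n K E S y j) : u < n := by
  obtain ⟨w, -, -, h⟩ := h
  exact h.lt

end Pieces

/-! ### Codes and the table of connections -/

namespace State

theorem le_of_N_eq {s : State} (h : s.N = (s.n + 2) ^ (3 * s.K + 4)) : 3 * s.K + 4 ≤ s.N := by
  rw [h]
  exact (Nat.lt_pow_self (by omega)).le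

theorem n_lt_of_N_eq {s : State} (h : s.N = (s.n + 2) ^ (3 * s.K + 4)) : s.n + 2 ≤ s.N := by
  rw [h]
  calc s.n + 2 = (s.n + 2) ^ 1 := (pow_one _).symm
    _ ≤ _ := Nat.pow_le_pow_right (by omega) (by omega)

theorem dig_eq {s : State} (h : s.N = (s.n + 2) ^ (3 * s.K + 4)) {a t : ℕ} (ha : a < s.N)
    (ht : t < 3 * s.K + 4) : s.dig a t = a / (s.n + 2) ^ t % (s.n + 2) :=
  digN_eq (by omega) ha.le (ht.le.trans (le_of_N_eq h))

theorem dig_lt {s : State} (h : s.N = (s.n + 2) ^ (3 * s.K + 4)) {a t : ℕ} (ha : a < s.N)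
    (ht : t < 3 * s.K + 4) : s.dig a t < s.n + 2 := by
  rw [dig_eq h ha ht]
  exact Nat.mod_lt _ (by omega)

theorem exists_code {s : State} (h : s.N = (s.n + 2) ^ (3 * s.K + 4)) (f : ℕ → ℕ)
    (hf : ∀ t < 3 * s.K + 4, f t < s.n + 2) : ∃ a < s.N, ∀ t < 3 * s.K + 4, s.dig a t = f t := by
  obtain ⟨a, ha, h1⟩ := exists_digits (by omega : 0 < s.n + 2) _ f hf
  rw [← h] at ha
  exact ⟨a, ha, fun t ht => by rw [dig_eq h ha ht, h1 t ht]⟩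

theorem reachClosure_eq (s : State) : s.reachClosure =
    { s with reach := iterTable s.N (fun A e => { s with reach := A }.reachRule e) s.reach s.N } := by
  have : ∀ k, stepReach^[k] s.clearReach = { s with
      reach := iterTable s.N (fun A e => { s with reach := A }.reachRule e) s.reach k } := by
    intro k
    induction k with
    | zero => rfl
    | succ k ih => rw [Function.iterate_succ_apply', ih]; rfl
  exact this _

theorem itemClosure_eq (s : State) : s.itemClosure =
    { s with tab := iterTable s.N (fun A e => { s with tab := A }.itemRule e) s.tab s.N } := by
  have : ∀ k, stepTab^[k] s.clearTab = { s with
      tab := iterTable s.N (fun A e => { s with tab := A }.itemRule e) s.tab k } := by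
    intro k
    induction k with
    | zero => rfl
    | succ k ih => rw [Function.iterate_succ_apply', ih]; rfl
  exact this _

/-- The table of connections is correct. -/
def ReachCorrect (s : State) : Prop :=
  ∀ e < s.N, s.reach e = 1 ↔ Conn s.n s.K s.E (s.dig e) (s.dig e s.K) (s.dig e (s.K + 1))

/-- Soundness is induction on the fixed point, completeness is induction on the connecting path. A
code lists the slots, then the start of the path at digit `K` and its end at digit `K + 1`. -/
theorem reachClosure_correct {s : State} (h : s.N = (s.n + 2) ^ (3 * s.K + 4)) :
    s.reachClosure.ReachCorrect := by
  have hN := le_of_N_eq h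
  rw [reachClosure_eq]
  set R : (ℕ → ℕ) → ℕ → Prop := fun A e => { s with reach := A }.reachRule e with hR
  change ∀ e < s.N, iterTable s.N R s.reach s.N e = 1 ↔
    Conn s.n s.K s.E (s.dig e) (s.dig e s.K) (s.dig e (s.K + 1))
  have hmono : ∀ A A' : ℕ → ℕ, (∀ e < s.N, A e = 1 → A' e = 1) → ∀ e < s.N, R A e → R A' e := by
    rintro A A' hA e - ⟨h1, h2, h3, h4⟩
    refine ⟨h1, h2, h3, h4.imp id ?_⟩
    rintro ⟨e', he', h5, h6⟩
    exact ⟨e', he', hA e' he' h5, h6⟩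
  intro e he
  constructor
  · refine iterTable_induction (N := s.N) (R := R)
      (fun e => Conn s.n s.K s.E (s.dig e) (s.dig e s.K) (s.dig e (s.K + 1))) ?_ _ e he
    rintro A hA e he ⟨h1, h2, h3, h4⟩
    change s.dig e s.K < s.n at h1
    change s.dig e (s.K + 1) < s.n at h2
    change ∀ l < s.N, l < s.K → s.dig e l ≠ s.dig e (s.K + 1) at h3
    rcases h4 with h4 | ⟨e', he', h5, h6, h7⟩
    · change s.dig e s.K = s.dig e (s.K + 1) at h4
      rw [h4]
      exact .refl h2 fun l hl => h3 l (by omega) hl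
    · change ∀ l < s.N, l < s.K + 1 → s.dig e' l = s.dig e l at h6
      have := hA e' he' h5
      rw [h6 s.K (by omega) (by omega)] at this
      exact .step (this.congr fun l hl => h6 l (by omega) (by omega)) h7 h2
        fun l hl => h3 l (by omega) hl
  · have key : ∀ w u, Conn s.n s.K s.E (s.dig e) w u → ∀ e' < s.N,
        (∀ l < s.K, s.dig e' l = s.dig e l) → s.dig e' s.K = w → s.dig e' (s.K + 1) = u →
        iterTable s.N R s.reach s.N e' = 1 := by
      intro w u hc
      induction hc with
      | refl hw hS =>
        intro e' he' h1 h2 h3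
        refine iterTable_closed hmono e' he' ⟨?_, ?_, fun l _ hl => ?_, .inl ?_⟩
        · exact h2 ▸ hw
        · exact h3 ▸ hw
        · exact fun h => hS l hl ((h1 l hl).symm.trans (h.trans h3))
        · exact h2.trans h3.symm
      | @step u v hc hE hv hS ih =>
        intro e' he' h1 h2 h3
        -- The code for the path without its last edge.
        obtain ⟨e'', he'', h4⟩ := exists_code h
          (fun t => if t < s.K + 1 then s.dig e' t else if t = s.K + 1 then u else 0) (by
            intro t ht
            have := dig_lt h he' ht
            have := hc.lt
            split_ifs <;> omega)
        have h5 : ∀ l < s.K + 1, s.dig e'' l = s.dig e' l := fun l hl => by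
          rw [h4 l (by omega), if_pos hl]
        have h6 : s.dig e'' (s.K + 1) = u := by rw [h4 _ (by omega)]; simp
        refine iterTable_closed hmono e' he' ⟨?_, ?_, fun l _ hl => ?_, .inr ⟨e'', he'', ?_, ?_, ?_⟩⟩
        · exact h2 ▸ hc.lt_left
        · exact h3 ▸ hv
        · exact fun h => hS l hl ((h1 l hl).symm.trans (h.trans h3))
        · exact ih e'' he'' (fun l hl => (h5 l (by omega)).trans (h1 l hl))
            ((h5 _ (by omega)).trans h2) h6
        · exact fun l _ hl => h5 l hl
        · change s.E (s.dig e'' (s.K + 1)) (s.dig e' (s.K + 1))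
          rw [h6, h3]
          exact hE
    exact fun hc => key _ _ hc e he (fun _ _ => rfl) rfl rfl

/-- The vertex set of an item. -/
def piece (s : State) (a : ℕ) : Set ℕ := Piece s.n s.K s.E (s.slot a) (s.root a) (s.low a)

/-- Slots and vertices are valid digits, so each connection that witnesses membership in the piece
has a code in the range. -/
theorem mem_iff {s : State} (h : s.N = (s.n + 2) ^ (3 * s.K + 4)) (hr : s.ReachCorrect) {a : ℕ}
    (ha : a < s.N) (u : ℕ) : s.mem a u ↔ u ∈ s.piece a := by
  have hN := le_of_N_eq h
  constructor
  · rintro ⟨e, he, h1, h2, rfl, h4, h5⟩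
    exact ⟨s.dig e s.K, h4, h5, ((hr e he).1 h1).congr fun l hl => h2 l (by omega) hl⟩
  · rintro ⟨w, h1, h2, h3⟩
    obtain ⟨e, he, h4⟩ := exists_code h
      (fun t => if t < s.K then s.slot a t else if t = s.K then w else if t = s.K + 1 then u else 0)
      (by
        intro t ht
        have : s.slot a t < s.n + 2 := dig_lt h ha ht
        have := h3.lt
        have := h3.lt_left
        split_ifs <;> omega)
    have h5 : ∀ l < s.K, s.dig e l = s.slot a l := fun l hl => by
      rw [h4 l (by omega), if_pos hl]
    have h6 : s.dig e s.K = w := by rw [h4 _ (by omega)]; simp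
    have h7 : s.dig e (s.K + 1) = u := by rw [h4 _ (by omega)]; simp
    refine ⟨e, he, (hr e he).2 ?_, fun l _ hl => h5 l hl, h7, h6 ▸ h1, h6 ▸ h2⟩
    rw [h6, h7]
    exact h3.congr fun l hl => (h5 l hl).symm

end State

/-! ### Weighted sums over vertex sets -/

theorem ind_le_one (P : Prop) : ind P ≤ 1 := by
  by_cases h : P
  · rw [ind_of h]
  · rw [ind_of_not h]; exact Nat.zero_le _

theorem ind_mono {P Q : Prop} (h : P → Q) : ind P ≤ ind Q := by
  by_cases hP : P
  · rw [ind_of hP, ind_of (h hP)]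
  · rw [ind_of_not hP]; exact Nat.zero_le _

theorem ind_congr {P Q : Prop} (h : P ↔ Q) : ind P = ind Q := by rw [propext h]

/-- The sum of `f` over the elements of `X` below `n`. -/
noncomputable def wsum (n : ℕ) (X : Set ℕ) (f : ℕ → ℕ) : ℕ :=
  ∑ u ∈ Finset.range n, ind (u ∈ X) * f u

section WSum

variable {n : ℕ} {X Xa Xb Xc : Set ℕ} {f g : ℕ → ℕ}

theorem wsum_mono (h : ∀ u < n, u ∈ X → f u ≤ g u) : wsum n X f ≤ wsum n X g := by
  refine Finset.sum_le_sum fun u hu => ?_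
  by_cases hX : u ∈ X
  · exact Nat.mul_le_mul_left _ (h u (Finset.mem_range.1 hu) hX)
  · simp [ind_of_not hX]

theorem wsum_congr (h : ∀ u < n, u ∈ X → f u = g u) : wsum n X f = wsum n X g :=
  (wsum_mono fun u hu hX => (h u hu hX).le).antisymm (wsum_mono fun u hu hX => (h u hu hX).ge)

theorem wsum_of_forall (h : ∀ u < n, u ∈ X) : wsum n X f = ∑ u ∈ Finset.range n, f u :=
  Finset.sum_congr rfl fun u hu => by rw [ind_of (h u (Finset.mem_range.1 hu)), one_mul]

theorem wsum_le (X : Set ℕ) {c : ℕ} (h : ∀ u < n, f u ≤ c) : wsum n X f ≤ n * c := by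
  calc wsum n X f ≤ ∑ u ∈ Finset.range n, c := Finset.sum_le_sum fun u hu => by
        calc ind (u ∈ X) * f u ≤ 1 * c :=
              Nat.mul_le_mul (ind_le_one _) (h u (Finset.mem_range.1 hu))
          _ = c := one_mul c
    _ = n * c := by simp

theorem wsum_subset_le (h : ∀ u, u ∈ Xb → u ∈ Xa) : wsum n Xb f ≤ wsum n Xa f :=
  Finset.sum_le_sum fun u _ => Nat.mul_le_mul_right _ (ind_mono (h u))

theorem wsum_split {x : ℕ} (hx : x < n) (h : ∀ u, u ∈ Xa ↔ u = x ∨ u ∈ Xb ∨ u ∈ Xc)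
    (hb : x ∉ Xb) (hc : x ∉ Xc) (hbc : ∀ u, ¬ (u ∈ Xb ∧ u ∈ Xc)) (f : ℕ → ℕ) :
    wsum n Xa f = wsum n Xb f + wsum n Xc f + f x := by
  have hfx : f x = ∑ u ∈ Finset.range n, ind (u = x) * f u := by
    rw [Finset.sum_eq_single x]
    · rw [ind_of rfl, one_mul]
    · intro u _ hu
      rw [ind_of_not hu, zero_mul]
    · exact fun h => absurd (Finset.mem_range.2 hx) h
  rw [hfx]
  unfold wsum
  rw [← Finset.sum_add_distrib, ← Finset.sum_add_distrib]
  refine Finset.sum_congr rfl fun u _ => ?_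
  rw [← add_mul, ← add_mul, ind_congr (h u)]
  congr 1
  by_cases hux : u = x
  · subst hux
    rw [ind_of (.inl rfl), ind_of_not hb, ind_of_not hc, ind_of rfl]
  · by_cases hub : u ∈ Xb
    · rw [ind_of (.inr (.inl hub)), ind_of hub, ind_of_not fun h => hbc u ⟨hub, h⟩, ind_of_not hux]
    · by_cases huc : u ∈ Xc
      · rw [ind_of (.inr (.inr huc)), ind_of_not hub, ind_of huc, ind_of_not hux]
      · rw [ind_of_not (by tauto), ind_of_not hub, ind_of_not huc, ind_of_not hux]

end WSum

/-- The number of neighbours of `y` in `X` with a label less than `p`. -/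
noncomputable def before (n : ℕ) (E : ℕ → ℕ → Prop) (P : ℕ → ℕ) (X : Set ℕ) (y p : ℕ) : ℕ :=
  wsum n X fun u => ind (E y u ∧ P u < p)

theorem before_le (n : ℕ) (E : ℕ → ℕ → Prop) (P : ℕ → ℕ) (X : Set ℕ) (y p : ℕ) :
    before n E P X y p ≤ n := by
  unfold before
  simpa using wsum_le (n := n) X (c := 1) fun u _ => ind_le_one (E y u ∧ P u < p)

/-- With the thresholds `T`, some labelling of the vertices has cost at most `q`. -/
def Feasible (n : ℕ) (E : ℕ → ℕ → Prop) (T : ℕ → ℕ) (q : ℕ) : Prop :=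
  ∃ P : ℕ → ℕ, ∑ v ∈ Finset.range n, (T v - before n E P Set.univ v (P v)) ≤ q

/-- Each label is replaced by the number of vertices with smaller labels. This keeps strict
inequalities, so no deficit grows, and the new labels fit into single digits. -/
theorem Feasible.exists_lt {n : ℕ} {E : ℕ → ℕ → Prop} {T : ℕ → ℕ} {q : ℕ}
    (h : Feasible n E T q) : ∃ P : ℕ → ℕ, (∀ u < n, P u < n) ∧
      ∑ v ∈ Finset.range n, (T v - before n E P Set.univ v (P v)) ≤ q := by
  obtain ⟨P, hP⟩ := h
  let r : ℕ → ℕ := fun v => ((Finset.range n).filter fun u => P u < P v).card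
  have hr : ∀ u < n, ∀ v, P u < P v → r u < r v := by
    intro u hu v huv
    refine Finset.card_lt_card ⟨fun w hw => ?_, fun hsub => ?_⟩
    · simp only [Finset.mem_filter, Finset.mem_range] at hw ⊢
      exact ⟨hw.1, by omega⟩
    · have : u ∈ (Finset.range n).filter fun w => P w < P u := hsub (by simp [hu, huv])
      simp at this
  refine ⟨r, fun u hu => ?_, (Finset.sum_le_sum fun v _ => ?_).trans hP⟩
  · calc r u < (Finset.range n).card := Finset.card_lt_card
          ⟨Finset.filter_subset _ _, fun hsub => by simpa using hsub (Finset.mem_range.2 hu)⟩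
      _ = n := Finset.card_range n
  · exact Nat.sub_le_sub_left (wsum_mono fun u hu _ => ind_mono fun h => ⟨h.1, hr u hu v h.2⟩) _

/-! ### Derivations -/

/-- Elimination of the vertices of a piece, one after the other, with `K` slots. -/
inductive Deriv (n K : ℕ) (E : ℕ → ℕ → Prop) : (ℕ → ℕ) → ℕ → ℕ → Prop
  | empty {S : ℕ → ℕ} {y j : ℕ} : (∀ u, u ∉ Piece n K E S y j) → Deriv n K E S y j
  | join {S S' S'' : ℕ → ℕ} {y j y' j' y'' j'' : ℕ} (i : ℕ) : i < K → S' i < n →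
      (∀ l < K, l ≠ i → S' l = S l) → (∀ l < K, S'' l = S l) →
      y' < n + 2 → j' < n + 2 → y'' < n + 2 → j'' < n + 2 →
      Deriv n K E S' y' j' → Deriv n K E S'' y'' j'' →
      (∀ u, u ∈ Piece n K E S y j ↔
        u = S' i ∨ u ∈ Piece n K E S' y' j' ∨ u ∈ Piece n K E S'' y'' j'') →
      S' i ∉ Piece n K E S' y' j' → S' i ∉ Piece n K E S'' y'' j'' →
      (∀ u, ¬ (u ∈ Piece n K E S' y' j' ∧ u ∈ Piece n K E S'' y'' j'')) →
      (∀ u, u = S' i ∨ u ∈ Piece n K E S' y' j' →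
        ¬ E (S i) u ∧ ∀ v ∈ Piece n K E S'' y'' j'', ¬ E u v) →
      Deriv n K E S y j

theorem Deriv.congr {n K : ℕ} {E : ℕ → ℕ → Prop} {S T : ℕ → ℕ} {y j z k : ℕ}
    (h : Deriv n K E S y j) (hST : ∀ l < K, S l = T l)
    (hP : Piece n K E S y j = Piece n K E T z k) : Deriv n K E T z k := by
  cases h with
  | empty h => exact .empty (hP ▸ h)
  | join i h1 h2 h3 h4 h5 h6 h7 h8 h9 h10 h11 h12 h13 h14 h15 =>
    refine .join i h1 h2 (fun l hl hli => (h3 l hl hli).trans (hST l hl))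
      (fun l hl => (h4 l hl).trans (hST l hl)) h5 h6 h7 h8 h9 h10 (hP ▸ h11) h12 h13 h14 ?_
    rw [← hST i h1]
    exact h15

theorem piece_closed {n K : ℕ} {E : ℕ → ℕ → Prop} {S : ℕ → ℕ} {y j u v : ℕ}
    (hE : ∀ u v, E u v → v < n) (hu : u ∈ Piece n K E S y j) (huv : E u v) :
    v ∈ Piece n K E S y j ∨ ∃ l < K, S l = v := by
  by_cases h : ∃ l < K, S l = v
  · exact .inr h
  · push Not at h
    obtain ⟨w, h1, h2, h3⟩ := hu
    exact .inl ⟨w, h1, h2, .step h3 huv (hE u v huv) h⟩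

/-! ### Soundness and completeness of the table of items -/

namespace State

variable {s : State}

theorem splits_iff (hN : s.N = (s.n + 2) ^ (3 * s.K + 4)) (hr : s.ReachCorrect) {a b c i : ℕ}
    (ha : a < s.N) (hb : b < s.N) (hc : c < s.N) (hx : s.slot b i < s.n) :
    s.Splits a b c i ↔
      (∀ u, u ∈ s.piece a ↔ u = s.slot b i ∨ u ∈ s.piece b ∨ u ∈ s.piece c) ∧
      s.slot b i ∉ s.piece b ∧ s.slot b i ∉ s.piece c ∧
      ∀ u, ¬ (u ∈ s.piece b ∧ u ∈ s.piece c) := by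
  have hn := n_lt_of_N_eq hN
  simp only [Splits, mem_iff hN hr ha, mem_iff hN hr hb, mem_iff hN hr hc]
  constructor
  · rintro ⟨h1, h2, h3, h4⟩
    refine ⟨fun u => ⟨fun h => (h1 u ?_).1 h, fun h => (h1 u ?_).2 h⟩, h2, h3, fun u h => h4 u ?_ h⟩
    · have : u < s.n := lt_of_mem_piece h
      omega
    · have : u < s.n := by
        rcases h with h | h | h
        · omega
        · exact lt_of_mem_piece h
        · exact lt_of_mem_piece h
      omega
    · have : u < s.n := lt_of_mem_piece h.1
      omega
  · rintro ⟨h1, h2, h3, h4⟩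
    exact ⟨fun u _ => ⟨(h1 u).1, (h1 u).2⟩, h2, h3, fun u _ => h4 u⟩

theorem separates_iff (hN : s.N = (s.n + 2) ^ (3 * s.K + 4)) (hr : s.ReachCorrect) {a b c i : ℕ}
    (hb : b < s.N) (hc : c < s.N) :
    s.Separates a b c i ↔ ∀ u, u = s.slot b i ∨ u ∈ s.piece b →
      ¬ s.E (s.slot a i) u ∧ ∀ v ∈ s.piece c, ¬ s.E u v := by
  have hn := n_lt_of_N_eq hN
  simp only [Separates, mem_iff hN hr hb, mem_iff hN hr hc]
  constructor
  · intro h u hu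
    refine ⟨fun hE => ?_, fun v hv hE => ?_⟩
    · have := hE.2.1
      exact (h u (by omega) hu).1 hE
    · have := hE.1
      have := hE.2.1
      exact (h u (by omega) hu).2 v (by omega) hv hE
  · exact fun h u _ hu => ⟨(h u hu).1, fun v _ hv => (h u hu).2 v hv⟩

/-- The number of slots of `a` that hold a neighbour of `v` with a label less than `p`. -/
noncomputable def slotsBefore (s : State) (a v p : ℕ) : ℕ :=
  ∑ l ∈ Finset.range s.K, ind (s.E (s.slot a l) v ∧ s.lab a l < p)

/-- The number of slots of `a` other than `i` that hold a neighbour of `v` with a label less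
than `p`. -/
noncomputable def othersBefore (s : State) (a i v p : ℕ) : ℕ :=
  ∑ l ∈ Finset.range s.K, ind (l ≠ i ∧ s.E (s.slot a l) v ∧ s.lab a l < p)

theorem slotCount_eq (hN : s.N = (s.n + 2) ^ (3 * s.K + 4)) (b i : ℕ) :
    s.slotCount b i = s.othersBefore b i (s.slot b i) (s.lab b i) := by
  have := le_of_N_eq hN
  unfold slotCount othersBefore
  rw [← Finset.sum_subset (Finset.range_mono (by omega : s.K ≤ s.N))]
  · exact Finset.sum_congr rfl fun l hl =>
      ind_congr ⟨fun h => h.2, fun h => ⟨Finset.mem_range.1 hl, h⟩⟩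
  · intro l _ hl
    exact ind_of_not fun h => hl (Finset.mem_range.2 h.1)

theorem slotsBefore_eq {i : ℕ} (hi : i < s.K) (b v p : ℕ) : s.slotsBefore b v p =
    s.othersBefore b i v p + ind (s.E (s.slot b i) v ∧ s.lab b i < p) := by
  unfold slotsBefore othersBefore
  rw [← Finset.add_sum_erase _ _ (Finset.mem_range.2 hi),
    ← Finset.add_sum_erase _ (fun l => ind (l ≠ i ∧ s.E (s.slot b l) v ∧ s.lab b l < p))
      (Finset.mem_range.2 hi),
    ind_of_not (fun h => h.1 rfl : ¬ (i ≠ i ∧ s.E (s.slot b i) v ∧ s.lab b i < p)), zero_add,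
    add_comm]
  congr 1
  exact Finset.sum_congr rfl fun l hl =>
    ind_congr ⟨fun h => ⟨Finset.ne_of_mem_erase hl, h⟩, fun h => h.2⟩

theorem othersBefore_congr (hN : s.N = (s.n + 2) ^ (3 * s.K + 4)) {a b c i : ℕ}
    (h : s.Fits a b c i) (v p : ℕ) : s.othersBefore b i v p = s.othersBefore a i v p := by
  have := le_of_N_eq hN
  refine Finset.sum_congr rfl fun l hl => ?_
  rw [Finset.mem_range] at hl
  by_cases hli : l = i
  · exact ind_congr ⟨fun h => absurd hli h.1, fun h => absurd hli h.1⟩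
  · obtain ⟨h1, h2, -⟩ := (h l (by omega) hl).2.2 hli
    rw [h1, h2]

/-- The item `a` is realized by a labelling. -/
def Good (s : State) (a : ℕ) : Prop :=
  ∃ P : ℕ → ℕ,
    (∀ l < s.K, s.cnt a l ≤ before s.n s.E P (s.piece a) (s.slot a l) (s.lab a l)) ∧
    wsum s.n (s.piece a) (fun v =>
      s.thrAt v - (before s.n s.E P (s.piece a) v (P v) + s.slotsBefore a v (P v))) ≤ s.cost a

/-- The labellings of the two smaller pieces are glued, and the eliminated vertex gets the label
recorded in its slot of `b`. Counts are only promised lower bounds and costs only upper bounds, so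
inequalities between them suffice. -/
theorem good_of_joinRule (hN : s.N = (s.n + 2) ^ (3 * s.K + 4)) (hr : s.ReachCorrect)
    (hsymm : ∀ u v, s.E u v → s.E v u) {a b c i : ℕ} (ha : a < s.N) (hb : b < s.N) (hc : c < s.N)
    (h : s.joinRule a b c i) (gb : s.Good b) (gc : s.Good c) : s.Good a := by
  classical
  have hNK := le_of_N_eq hN
  obtain ⟨hi, hx, hfit, hcnt, hcost, hsplit, -⟩ := h
  rw [splits_iff hN hr ha hb hc hx] at hsplit
  obtain ⟨hmem, hxb, hxc, hdisj⟩ := hsplit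
  obtain ⟨Pb, hPb, hPb'⟩ := gb
  obtain ⟨Pc, hPc, hPc'⟩ := gc
  let P : ℕ → ℕ := fun u => if u = s.slot b i then s.lab b i else if u ∈ s.piece b then Pb u else Pc u
  have Px : P (s.slot b i) = s.lab b i := if_pos rfl
  have PXb : ∀ u ∈ s.piece b, P u = Pb u := fun u hu => by
    have : u ≠ s.slot b i := fun h => hxb (h ▸ hu)
    simp [P, this, hu]
  have PXc : ∀ u ∈ s.piece c, P u = Pc u := fun u hu => by
    have h1 : u ≠ s.slot b i := fun h => hxc (h ▸ hu)
    have h2 : u ∉ s.piece b := fun h => hdisj u ⟨h, hu⟩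
    simp [P, h1, h2]
  have hbef : ∀ y p, before s.n s.E P (s.piece a) y p = before s.n s.E Pb (s.piece b) y p +
      before s.n s.E Pc (s.piece c) y p + ind (s.E y (s.slot b i) ∧ s.lab b i < p) := by
    intro y p
    unfold before
    rw [wsum_split hx hmem hxb hxc hdisj, Px]
    congr 2
    · exact wsum_congr fun u _ hu => by rw [PXb u hu]
    · exact wsum_congr fun u _ hu => by rw [PXc u hu]
  have hcs : ∀ v p, s.slotsBefore c v p = s.slotsBefore a v p := fun v p =>
    Finset.sum_congr rfl fun l hl => by
      rw [Finset.mem_range] at hl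
      obtain ⟨h1, h2, -⟩ := hfit l (by omega) hl
      rw [h1, h2]
  have hba : ∀ v p, s.othersBefore b i v p ≤ s.slotsBefore a v p := fun v p => by
    rw [othersBefore_congr hN hfit, slotsBefore_eq hi]
    exact Nat.le_add_right _ _
  refine ⟨P, fun l hl => ?_, ?_⟩
  · obtain ⟨h1, h2, h3⟩ := hfit l (by omega) hl
    have hc' := hPc l hl
    rw [hbef]
    by_cases hli : l = i
    · subst hli
      rw [h1, h2] at hc'
      omega
    · obtain ⟨h4, h5, h6⟩ := h3 hli
      have hb' := hPb l hl
      rw [h4, h5] at hb'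
      rw [h1, h2] at hc'
      omega
  · rw [wsum_split hx hmem hxb hxc hdisj]
    refine le_trans (Nat.add_le_add (Nat.add_le_add (le_trans (wsum_mono fun v _ hv => ?_) hPb')
      (le_trans (wsum_mono fun v _ hv => ?_) hPc')) ?_) hcost
    -- The eliminated vertex, counted as a slot of `b`, is counted for `a` as a vertex of the piece.
    · refine Nat.sub_le_sub_left ?_ _
      rw [hbef, PXb v hv, slotsBefore_eq hi]
      have h1 := hba v (Pb v)
      have h2 : ind (s.E (s.slot b i) v ∧ s.lab b i < Pb v) =
          ind (s.E v (s.slot b i) ∧ s.lab b i < Pb v) :=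
        ind_congr ⟨fun h => ⟨hsymm _ _ h.1, h.2⟩, fun h => ⟨hsymm _ _ h.1, h.2⟩⟩
      omega
    · refine Nat.sub_le_sub_left ?_ _
      rw [hbef, PXc v hv, hcs]
      omega
    · refine Nat.sub_le_sub_left ?_ _
      rw [hbef, Px, slotCount_eq hN]
      have h1 := hba (s.slot b i) (s.lab b i)
      have h2 := hPb i hi
      omega

theorem good_of_emptyRule (hN : s.N = (s.n + 2) ^ (3 * s.K + 4)) (hr : s.ReachCorrect) {a : ℕ}
    (ha : a < s.N) (h : s.emptyRule a) : s.Good a := by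
  have hNK := le_of_N_eq hN
  have hn := n_lt_of_N_eq hN
  have hempty : ∀ u, u ∉ s.piece a := fun u hu => by
    have : u < s.n := lt_of_mem_piece hu
    exact h.1 u (by omega) ((mem_iff hN hr ha u).2 hu)
  refine ⟨fun _ => 0, fun l hl => ?_, ?_⟩
  · rw [h.2 l (by omega) hl]
    exact Nat.zero_le _
  · exact (wsum_mono (g := fun _ => 0) fun u _ hu => absurd hu (hempty u)).trans (by simp [wsum])

/-- The table of items that results from the rule for items. -/
noncomputable def items (s : State) : ℕ → ℕ :=
  iterTable s.N (fun A e => { s with tab := A }.itemRule e) s.tab s.N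

theorem good_of_items (hN : s.N = (s.n + 2) ^ (3 * s.K + 4)) (hr : s.ReachCorrect)
    (hsymm : ∀ u v, s.E u v → s.E v u) : ∀ a < s.N, s.items a = 1 → s.Good a := by
  refine iterTable_induction s.Good ?_ _
  rintro A hA a ha (h | ⟨b, hb, hAb, c, hc, hAc, i, hi, h⟩)
  · exact good_of_emptyRule hN hr ha h
  · exact good_of_joinRule hN hr hsymm ha hb hc h (hA b hb hAb) (hA c hc hAc)

/-- What remains of the rule for items when labels, counts and costs are forgotten is the rule for
derivations. -/
theorem deriv_of_items (hN : s.N = (s.n + 2) ^ (3 * s.K + 4)) (hr : s.ReachCorrect) :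
    ∀ a < s.N, s.items a = 1 → Deriv s.n s.K s.E (s.slot a) (s.root a) (s.low a) := by
  have hNK := le_of_N_eq hN
  have hn := n_lt_of_N_eq hN
  refine iterTable_induction (fun a => Deriv s.n s.K s.E (s.slot a) (s.root a) (s.low a)) ?_ _
  rintro A hA a ha (h | ⟨b, hb, hAb, c, hc, hAc, i, hi, h⟩)
  · refine .empty fun u hu => h.1 u ?_ ((mem_iff hN hr ha u).2 hu)
    have : u < s.n := lt_of_mem_piece hu
    change u < s.N
    omega
  · obtain ⟨hi, hx, hfit, hcnt, hcost, hsplit, hsep⟩ : s.joinRule a b c i := h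
    rw [splits_iff hN hr ha hb hc hx] at hsplit
    rw [separates_iff hN hr hb hc] at hsep
    obtain ⟨hmem, hxb, hxc, hdisj⟩ := hsplit
    exact .join i hi hx (fun l hl hli => ((hfit l (by omega) hl).2.2 hli).1)
      (fun l hl => (hfit l (by omega) hl).1) (dig_lt hN hb (by omega)) (dig_lt hN hb (by omega))
      (dig_lt hN hc (by omega)) (dig_lt hN hc (by omega)) (hA b hb hAb) (hA c hc hAc) hmem hxb hxc
      hdisj hsep

theorem items_closed : ∀ a < s.N, { s with tab := s.items }.itemRule a → s.items a = 1 := by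
  refine iterTable_closed (R := fun A e => { s with tab := A }.itemRule e) (A := s.tab) ?_
  rintro A A' hA a - (h | ⟨b, hb, hAb, c, hc, hAc, h⟩)
  · exact .inl h
  · exact .inr ⟨b, hb, hA b hb hAb, c, hc, hA c hc hAc, h⟩

/-- Relevant costs are at most n², so two digits are reserved for them. With two digits for the
piece and three per slot this makes `3 * K + 4`. -/
theorem exists_item (hN : s.N = (s.n + 2) ^ (3 * s.K + 4)) (S L C : ℕ → ℕ) {y j q : ℕ}
    (hS : ∀ l < s.K, S l < s.n + 2) (hL : ∀ l < s.K, L l < s.n + 2)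
    (hC : ∀ l < s.K, C l < s.n + 2) (hy : y < s.n + 2) (hj : j < s.n + 2)
    (hq : q < (s.n + 2) * (s.n + 2)) :
    ∃ a < s.N, (∀ l < s.K, s.slot a l = S l) ∧ (∀ l < s.K, s.lab a l = L l) ∧
      (∀ l < s.K, s.cnt a l = C l) ∧ s.root a = y ∧ s.low a = j ∧ s.cost a = q := by
  obtain ⟨a, ha, h⟩ := exists_code hN (fun t => if t < s.K then S t else
    if t < 2 * s.K then L (t - s.K) else if t < 3 * s.K then C (t - 2 * s.K) else
    if t = 3 * s.K then y else if t = 3 * s.K + 1 then j else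
    if t = 3 * s.K + 2 then q % (s.n + 2) else q / (s.n + 2)) (by
      intro t ht
      split_ifs
      · exact hS _ (by omega)
      · exact hL _ (by omega)
      · exact hC _ (by omega)
      · exact hy
      · exact hj
      · exact Nat.mod_lt _ (by omega)
      · exact Nat.div_lt_of_lt_mul hq)
  refine ⟨a, ha, fun l hl => ?_, fun l hl => ?_, fun l hl => ?_, ?_, ?_, ?_⟩
  · rw [slot, h l (by omega), if_pos hl]
  · rw [lab, h _ (by omega), if_neg (by omega), if_pos (by omega)]
    congr 1
    omega
  · rw [cnt, h _ (by omega), if_neg (by omega), if_neg (by omega), if_pos (by omega)]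
    congr 1
    omega
  · rw [root, h _ (by omega), if_neg (by omega), if_neg (by omega), if_neg (by omega),
      if_pos (by omega)]
  · rw [low, h _ (by omega), if_neg (by omega), if_neg (by omega), if_neg (by omega),
      if_neg (by omega), if_pos (by omega)]
  · rw [cost, h _ (by omega), h _ (by omega), mulN_eq (n_lt_of_N_eq hN), if_neg (by omega),
      if_neg (by omega), if_neg (by omega), if_neg (by omega), if_neg (by omega),
      if_pos (by omega), if_neg (by omega), if_neg (by omega), if_neg (by omega),
      if_neg (by omega), if_neg (by omega), if_neg (by omega)]
    exact Nat.mod_add_div q (s.n + 2)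

theorem before_eq_zero {P : ℕ → ℕ} {X : Set ℕ} {y p : ℕ} (hy : s.n ≤ y) :
    before s.n s.E P X y p = 0 :=
  Nat.le_zero.1 <| (wsum_mono (g := fun _ => 0) fun u _ _ =>
    (ind_of_not fun h => absurd h.1.1 (by omega)).le).trans (by simp [wsum])

/-- The neighbours of the vertex in slot `i` of `b` are in the piece of `b` or in other slots. -/
theorem before_univ_le {P : ℕ → ℕ} {b i : ℕ} (hsymm : ∀ u v, s.E u v → s.E v u)
    (hlab : s.lab b i = P (s.slot b i))
    (h : ∀ u, s.E (s.slot b i) u → P u < P (s.slot b i) →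
      u ∈ s.piece b ∨ ∃ l < s.K, l ≠ i ∧ s.slot b l = u ∧ s.lab b l = P u) :
    before s.n s.E P Set.univ (s.slot b i) (P (s.slot b i)) ≤
      before s.n s.E P (s.piece b) (s.slot b i) (P (s.slot b i)) +
        s.othersBefore b i (s.slot b i) (s.lab b i) := by
  -- Double counting of pairs of a slot and the vertex in it: a slot holds at most one vertex, and
  -- each relevant neighbour outside the piece has a slot.
  have h1 : s.othersBefore b i (s.slot b i) (s.lab b i) ≥ ∑ u ∈ Finset.range s.n,
      ∑ l ∈ Finset.range s.K, ind (s.slot b l = u ∧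
        (l ≠ i ∧ s.E (s.slot b l) (s.slot b i) ∧ s.lab b l < s.lab b i)) := by
    rw [Finset.sum_comm]
    refine Finset.sum_le_sum fun l _ => ?_
    by_cases hl : s.slot b l < s.n
    · rw [Finset.sum_eq_single (s.slot b l)]
      · exact ind_mono fun h => h.2
      · exact fun u _ hu => ind_of_not fun h => hu h.1.symm
      · exact fun h => absurd (Finset.mem_range.2 hl) h
    · rw [Finset.sum_eq_zero]
      · exact Nat.zero_le _
      · intro u hu
        rw [Finset.mem_range] at hu
        exact ind_of_not fun h => by omega
  refine le_trans ?_ (Nat.add_le_add_left h1 _)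
  unfold before wsum
  rw [← Finset.sum_add_distrib]
  refine Finset.sum_le_sum fun u _ => ?_
  rw [ind_of (Set.mem_univ u), one_mul]
  beta_reduce
  by_cases hu : s.E (s.slot b i) u ∧ P u < P (s.slot b i)
  · rcases h u hu.1 hu.2 with hm | ⟨l, hl, hli, hlu, hll⟩
    · rw [ind_of hm, one_mul]
      exact Nat.le_add_right _ _
    · refine le_trans (ind_le_one _) (le_trans ?_ (Nat.le_add_left _ _))
      rw [← ind_of (P := s.slot b l = u ∧ (l ≠ i ∧ s.E (s.slot b l) (s.slot b i) ∧
        s.lab b l < s.lab b i)) ⟨hlu, hli, hlu ▸ hsymm _ _ hu.1, by rw [hll, hlab]; exact hu.2⟩]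
      exact Finset.single_le_sum (f := fun l => ind (s.slot b l = u ∧ (l ≠ i ∧
        s.E (s.slot b l) (s.slot b i) ∧ s.lab b l < s.lab b i))) (fun _ _ => Nat.zero_le _)
        (Finset.mem_range.2 hl)
  · rw [ind_of_not hu]
    exact Nat.zero_le _

/-- One labelling `P` is fixed for the whole derivation. Every item that follows it, with labels
taken from `P`, counts not too large and cost not too small, gets into the table; the smaller items
are chosen with the exact counts and costs of `P`. Separation ensures that no earlier neighbour is
lost when a slot is taken over. -/
theorem items_of_deriv (hN : s.N = (s.n + 2) ^ (3 * s.K + 4)) (hr : s.ReachCorrect)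
    (hsymm : ∀ u v, s.E u v → s.E v u) {P : ℕ → ℕ} (hP : ∀ u < s.n, P u < s.n)
    (hT : ∀ u < s.n, s.thrAt u ≤ s.n) {S : ℕ → ℕ} {y j : ℕ} (h : Deriv s.n s.K s.E S y j) :
    ∀ a < s.N, (∀ l < s.K, s.slot a l = S l) → s.root a = y → s.low a = j →
      (∀ l < s.K, s.slot a l < s.n → s.lab a l = P (s.slot a l)) →
      (∀ l < s.K, s.cnt a l ≤ before s.n s.E P (s.piece a) (s.slot a l) (P (s.slot a l))) →
      wsum s.n (s.piece a) (fun v => s.thrAt v - before s.n s.E P Set.univ v (P v)) ≤ s.cost a →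
      s.items a = 1 := by
  have hNK := le_of_N_eq hN
  have hn := n_lt_of_N_eq hN
  induction h with
  | @empty S y j hempty =>
    intro a ha hS hy hj hlab hcnt hcost
    have hpa : s.piece a = Piece s.n s.K s.E S y j := by
      rw [piece, hy, hj]
      exact piece_congr hS y j
    rw [← hpa] at hempty
    refine items_closed a ha (.inl ⟨fun u _ hu => hempty u ((mem_iff hN hr ha u).1 hu), ?_⟩)
    intro l _ hl
    refine Nat.le_zero.1 ((hcnt l hl).trans ?_)
    exact (wsum_mono (g := fun _ => 0) fun u _ hu => absurd hu (hempty u)).trans (by simp [wsum])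
  | @join S S' S'' y j y' j' y'' j'' i hi hx hS' hS'' hy' hj' hy'' hj'' _ _ hmem hxb hxc hdisj hsep
      ihb ihc =>
    intro a ha hS hy hj hlab hcnt hcost
    have hpa : s.piece a = Piece s.n s.K s.E S y j := by
      rw [piece, hy, hj]
      exact piece_congr hS y j
    let f : ℕ → ℕ := fun v => s.thrAt v - before s.n s.E P Set.univ v (P v)
    have hf : ∀ X, wsum s.n X f < (s.n + 2) * (s.n + 2) := fun X =>
      lt_of_le_of_lt (wsum_le X fun u hu => (Nat.sub_le _ _).trans (hT u hu)) (by nlinarith)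
    have hSlt : ∀ l < s.K, S l < s.n + 2 := fun l hl => hS l hl ▸ dig_lt hN ha (by omega)
    have hLlt : ∀ l < s.K, s.lab a l < s.n + 2 := fun l hl => dig_lt hN ha (by omega)
    have hClt : ∀ (X : Set ℕ) (u : ℕ), before s.n s.E P X u (P u) < s.n + 2 := fun X u =>
      lt_of_le_of_lt (before_le _ _ _ _ _ _) (by omega)
    obtain ⟨b, hb, b1, b2, b3, b4, b5, b6⟩ := exists_item hN S'
      (fun l => if l = i then P (S' i) else s.lab a l)
      (fun l => before s.n s.E P (Piece s.n s.K s.E S' y' j') (S' l) (P (S' l)))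
      (fun l hl => by
        by_cases hli : l = i
        · rw [hli]; omega
        · rw [hS' l hl hli]; exact hSlt l hl)
      (fun l hl => by
        have := hP _ hx
        have := hLlt l hl
        split_ifs <;> omega)
      (fun l _ => hClt _ _) hy' hj' (hf (Piece s.n s.K s.E S' y' j'))
    obtain ⟨c, hc, c1, c2, c3, c4, c5, c6⟩ := exists_item hN S'' (s.lab a)
      (fun l => before s.n s.E P (Piece s.n s.K s.E S'' y'' j'') (S'' l) (P (S'' l)))
      (fun l hl => by rw [hS'' l hl]; exact hSlt l hl) hLlt (fun l _ => hClt _ _) hy'' hj''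
      (hf (Piece s.n s.K s.E S'' y'' j''))
    have hpb : s.piece b = Piece s.n s.K s.E S' y' j' := by
      rw [piece, b4, b5]
      exact piece_congr b1 _ _
    have hpc : s.piece c = Piece s.n s.K s.E S'' y'' j'' := by
      rw [piece, c4, c5]
      exact piece_congr c1 _ _
    have hbx : s.slot b i = S' i := b1 i hi
    have hbi : s.lab b i = P (S' i) := by rw [b2 i hi, if_pos rfl]
    have hab : ∀ l < s.K, l ≠ i → s.slot b l = s.slot a l ∧ s.lab b l = s.lab a l := by
      intro l hl hli
      rw [b1 l hl, hS' l hl hli, hS l hl, b2 l hl, if_neg hli]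
      exact ⟨rfl, rfl⟩
    have hac : ∀ l < s.K, s.slot c l = s.slot a l := fun l hl => by
      rw [c1 l hl, hS'' l hl, hS l hl]
    have hitb : s.items b = 1 := by
      refine ihb b hb b1 b4 b5 (fun l hl hlt => ?_) (fun l hl => ?_) ?_
      · by_cases hli : l = i
        · rw [hli, hbi, hbx]
        · rw [(hab l hl hli).1] at hlt ⊢
          rw [(hab l hl hli).2, hlab l hl hlt]
      · rw [b3 l hl, hpb, b1 l hl]
      · rw [b6, hpb]
    have hitc : s.items c = 1 := by
      refine ihc c hc c1 c4 c5 (fun l hl hlt => ?_) (fun l hl => ?_) ?_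
      · rw [hac l hl] at hlt ⊢
        rw [c2 l hl, hlab l hl hlt]
      · rw [c3 l hl, hpc, c1 l hl]
      · rw [c6, hpc]
    rw [← hpa, ← hpb, ← hpc, ← hbx] at hmem
    rw [← hpb, ← hbx] at hxb
    rw [← hpc, ← hbx] at hxc
    rw [← hpb, ← hpc] at hdisj
    rw [← hpb, ← hpc, ← hbx, ← hS i hi] at hsep
    rw [← hbx] at hx hbi
    have hbef : ∀ u p, before s.n s.E P (s.piece a) u p = before s.n s.E P (s.piece b) u p +
        before s.n s.E P (s.piece c) u p + ind (s.E u (s.slot b i) ∧ P (s.slot b i) < p) :=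
      fun u p => wsum_split hx hmem hxb hxc hdisj _
    refine items_closed a ha (.inr ⟨b, hb, hitb, c, hc, hitc, i, by change i < s.N; omega, ?_⟩)
    change s.joinRule a b c i
    refine ⟨hi, hx, fun l _ hl => ⟨hac l hl, c2 l hl, fun hli => ⟨(hab l hl hli).1,
      (hab l hl hli).2, ?_⟩⟩, ?_, ?_, (splits_iff hN hr ha hb hc hx).2 ⟨hmem, hxb, hxc, hdisj⟩,
      (separates_iff hN hr hb hc).2 hsep⟩
    · have h1 := hcnt l hl
      by_cases hlt : s.slot a l < s.n
      · rw [hbef] at h1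
        rw [b3 l hl, c3 l hl, ← hpb, ← hpc, ← b1 l hl, ← c1 l hl, (hab l hl hli).1, hac l hl, hbi,
          hlab l hl hlt]
        exact h1
      · rw [before_eq_zero (not_lt.1 hlt)] at h1
        omega
    · have h1 := hcnt i hi
      rw [hbef] at h1
      -- The displaced occupant of slot `i` has no neighbour in the component being split off, so
      -- its whole count comes from `c`.
      have h2 : before s.n s.E P (s.piece b) (s.slot a i) (P (s.slot a i)) = 0 :=
        Nat.le_zero.1 <| (wsum_mono (g := fun _ => 0) fun u _ hu =>
          (ind_of_not fun h => (hsep u (.inr hu)).1 h.1).le).trans (by simp [wsum])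
      rw [h2, ind_of_not fun h => (hsep _ (.inl rfl)).1 h.1, zero_add, add_zero] at h1
      rw [c3 i hi, ← hpc, ← c1 i hi, hac i hi]
      exact h1
    · refine le_trans ?_ hcost
      rw [wsum_split hx hmem hxb hxc hdisj, b6, c6, ← hpb, ← hpc]
      refine Nat.add_le_add_left (Nat.sub_le_sub_left ?_ _) _
      rw [slotCount_eq hN, b3 i hi, ← hpb, ← b1 i hi]
      -- A neighbour of the eliminated vertex lies in the piece of `a` or in a slot of `a`. In the
      -- first case it cannot belong to `c`; in the second it is not the displaced occupant, so its
      -- slot is the same in `b`.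
      refine before_univ_le hsymm hbi fun u hE hlt => ?_
      have hxa : s.slot b i ∈ s.piece a := (hmem _).2 (.inl rfl)
      rcases piece_closed (fun u v h => h.2.1) hxa hE with hua | ⟨l, hl, hlu⟩
      · rcases (hmem u).1 hua with h | h | h
        · rw [h] at hlt
          omega
        · exact .inl h
        · exact absurd hE ((hsep _ (.inl rfl)).2 u h)
      · have hli : l ≠ i := fun h => (hsep _ (.inl rfl)).1 <| by
          have h' : s.slot a i = u := h ▸ hlu
          rw [h']
          exact hsymm _ _ hE
        refine .inr ⟨l, hl, hli, (hab l hl hli).1.trans hlu, ?_⟩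
        rw [(hab l hl hli).2, hlab l hl (by rw [hlu]; exact hE.2.1), hlu]

theorem mem_piece_of_root {a : ℕ} (h : ∀ l < s.K, s.slot a l = s.n) (hy : s.root a = s.n)
    (hj : s.low a = 0) : ∀ u < s.n, u ∈ s.piece a := fun u hu =>
  ⟨u, by rw [hj]; exact Nat.zero_le _, .inl hy, .refl hu fun l hl => by rw [h l hl]; omega⟩

theorem decides_iff (hN : s.N = (s.n + 2) ^ (3 * s.K + 4)) (q : ℕ) :
    s.itemClosure.Decides q ↔ ∃ a < s.N, s.items a = 1 ∧ (∀ l < s.K, s.slot a l = s.n) ∧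
      s.root a = s.n ∧ s.low a = 0 ∧ s.cost a ≤ q := by
  have hNK := le_of_N_eq hN
  rw [itemClosure_eq]
  constructor
  · rintro ⟨a, ha, h1, h2, h3⟩
    exact ⟨a, ha, h1, fun l hl => h2 l (by change l < s.N; omega) hl, h3⟩
  · rintro ⟨a, ha, h1, h2, h3⟩
    exact ⟨a, ha, h1, fun l _ hl => h2 l hl, h3⟩

theorem feasible_of_decides (hN : s.N = (s.n + 2) ^ (3 * s.K + 4)) (hr : s.ReachCorrect)
    (hsymm : ∀ u v, s.E u v → s.E v u) {q : ℕ} (h : s.itemClosure.Decides q) :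
    Feasible s.n s.E s.thrAt q := by
  obtain ⟨a, ha, h1, h2, h3, h4, h5⟩ := (decides_iff hN q).1 h
  obtain ⟨P, -, hP⟩ := good_of_items hN hr hsymm a ha h1
  have hall := mem_piece_of_root h2 h3 h4
  refine ⟨P, le_trans ?_ (hP.trans h5)⟩
  rw [wsum_of_forall hall]
  refine Finset.sum_le_sum fun v _ => Nat.sub_le_sub_left ?_ _
  have hslots : s.slotsBefore a v (P v) = 0 := Finset.sum_eq_zero fun l hl =>
    ind_of_not fun h => by
      have := h.1.1
      rw [h2 l (Finset.mem_range.1 hl)] at this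
      omega
  rw [hslots, add_zero]
  unfold before
  rw [wsum_of_forall hall, wsum_of_forall fun u _ => Set.mem_univ u]

theorem deriv_of_decides (hN : s.N = (s.n + 2) ^ (3 * s.K + 4)) (hr : s.ReachCorrect) {q : ℕ}
    (h : s.itemClosure.Decides q) : Deriv s.n s.K s.E (fun _ => s.n) s.n 0 := by
  obtain ⟨a, ha, h1, h2, h3, h4, h5⟩ := (decides_iff hN q).1 h
  have := deriv_of_items hN hr a ha h1
  rw [h3, h4] at this
  exact this.congr h2 (piece_congr h2 _ _)

/-- The item for the whole graph has empty slots, root `n` and low `0`; its cost is taken to be the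
exact cost of a labelling with labels below `n`. -/
theorem decides_of_feasible (hN : s.N = (s.n + 2) ^ (3 * s.K + 4)) (hr : s.ReachCorrect)
    (hsymm : ∀ u v, s.E u v → s.E v u) (hT : ∀ u < s.n, s.thrAt u ≤ s.n)
    (hd : Deriv s.n s.K s.E (fun _ => s.n) s.n 0) {q : ℕ} (h : Feasible s.n s.E s.thrAt q) :
    s.itemClosure.Decides q := by
  obtain ⟨P, hP, hq⟩ := h.exists_lt
  rw [← wsum_of_forall fun u _ => Set.mem_univ u] at hq
  set f : ℕ → ℕ := fun v => s.thrAt v - before s.n s.E P Set.univ v (P v) with hf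
  have hlt : wsum s.n Set.univ f < (s.n + 2) * (s.n + 2) :=
    lt_of_le_of_lt (wsum_le _ fun u hu => (Nat.sub_le _ _).trans (hT u hu)) (by nlinarith)
  obtain ⟨a, ha, h1, h2, h3, h4, h5, h6⟩ := exists_item hN (fun _ => s.n) (fun _ => 0)
    (fun _ => 0) (y := s.n) (j := 0) (fun _ _ => by omega) (fun _ _ => by omega)
    (fun _ _ => by omega) (by omega) (by omega) hlt
  refine (decides_iff hN q).2 ⟨a, ha, ?_, h1, h4, h5, h6.trans_le hq⟩
  refine items_of_deriv hN hr hsymm hP hT hd a ha h1 h4 h5 (fun l hl hlt => ?_) (fun l hl => ?_) ?_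
  · rw [h1 l hl] at hlt
    omega
  · rw [h3 l hl]
    exact Nat.zero_le _
  · rw [h6]
    exact wsum_subset_le fun u _ => Set.mem_univ u

end State

/-! ### Depth in a tree -/

section Tree

variable {N : Type} {T : SimpleGraph N}

/-- Shortest walks through `a` and through `b` are both paths from `r` to `t`. A tree has only one,
so their penultimate vertices agree. -/
theorem eq_of_adj_of_dist (hT : T.IsTree) (r : N) {t a b : N} (ha : T.Adj a t) (hb : T.Adj b t)
    (hda : T.dist r t = T.dist r a + 1) (hdb : T.dist r t = T.dist r b + 1) : a = b := by
  obtain ⟨p, hp⟩ := hT.connected.exists_walk_length_eq_dist r a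
  obtain ⟨q, hq⟩ := hT.connected.exists_walk_length_eq_dist r b
  have h1 : (p.concat ha).IsPath :=
    SimpleGraph.Walk.isPath_of_length_eq_dist _ (by rw [SimpleGraph.Walk.length_concat, hp, hda])
  have h2 : (q.concat hb).IsPath :=
    SimpleGraph.Walk.isPath_of_length_eq_dist _ (by rw [SimpleGraph.Walk.length_concat, hq, hdb])
  have h3 := (hT.existsUnique_path r t).unique h1 h2
  have h4 := congrArg SimpleGraph.Walk.penultimate h3
  simpa using h4

open Classical in
/-- The neighbour of `t` that is closer to `r`. -/
noncomputable def parent (T : SimpleGraph N) (r t : N) : N :=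
  if h : ∃ a, T.Adj a t ∧ T.dist r t = T.dist r a + 1 then h.choose else t

theorem parent_eq (hT : T.IsTree) {r t a : N} (ha : T.Adj a t)
    (hda : T.dist r t = T.dist r a + 1) : parent T r t = a := by
  have h : ∃ a, T.Adj a t ∧ T.dist r t = T.dist r a + 1 := ⟨a, ha, hda⟩
  rw [parent, dif_pos h]
  exact eq_of_adj_of_dist hT r h.choose_spec.1 ha h.choose_spec.2 hda

/-- The ancestor of `t` at depth `D`. -/
noncomputable def ancestor (T : SimpleGraph N) (r : N) (D : ℕ) (t : N) : N :=
  (parent T r)^[T.dist r t - D] t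

theorem ancestor_self {r t : N} {D : ℕ} (h : T.dist r t = D) : ancestor T r D t = t := by
  simp [ancestor, h]

/-- One end of a tree edge is the parent of the other. -/
theorem ancestor_eq_of_adj (hT : T.IsTree) {r t t' : N} {D : ℕ} (h : T.Adj t t')
    (ht : D ≤ T.dist r t) (ht' : D ≤ T.dist r t') : ancestor T r D t = ancestor T r D t' := by
  have key : ∀ {t t' : N}, T.Adj t t' → D ≤ T.dist r t → T.dist r t' = T.dist r t + 1 →
      ancestor T r D t = ancestor T r D t' := by
    intro t t' h ht hd
    unfold ancestor
    rw [hd, show T.dist r t + 1 - D = T.dist r t - D + 1 by omega, Function.iterate_succ_apply,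
      parent_eq hT h hd]
  rcases hT.dist_eq_dist_add_one_of_adj r h with hd | hd
  · exact (key h.symm ht' hd).symm
  · exact key h ht hd

theorem ancestor_eq_of_connected (hT : T.IsTree) {r : N} {D : ℕ} {U : Set N}
    (hU : (T.induce U).Connected) (hD : ∀ t ∈ U, D ≤ T.dist r t) {t t' : N} (ht : t ∈ U)
    (ht' : t' ∈ U) : ancestor T r D t = ancestor T r D t' := by
  obtain ⟨p⟩ := hU.preconnected ⟨t, ht⟩ ⟨t', ht'⟩
  have key : ∀ {a b : U} (_ : (T.induce U).Walk a b), ancestor T r D a = ancestor T r D b := by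
    intro a b p
    induction p with
    | nil => rfl
    | @cons a b c h _ ih => exact (ancestor_eq_of_adj hT h (hD _ a.2) (hD _ b.2)).trans ih
  exact key p

/-- Depths change by one along a walk in `U`, so the walk meets depth `D`. Until it does, the
ancestor at depth `D` stays the same, and the first node at that depth is this ancestor. -/
theorem ancestor_mem_of_connected (hT : T.IsTree) {r : N} {D : ℕ} {U : Set N}
    (hU : (T.induce U).Connected) {t t' : N} (ht : t ∈ U) (ht' : t' ∈ U) (hD : D ≤ T.dist r t)
    (hD' : T.dist r t' ≤ D) : ancestor T r D t ∈ U := by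
  obtain ⟨p⟩ := hU.preconnected ⟨t, ht⟩ ⟨t', ht'⟩
  have key : ∀ {a b : U} (_ : (T.induce U).Walk a b), D ≤ T.dist r a → T.dist r b ≤ D →
      ancestor T r D a ∈ U := by
    intro a b p
    induction p with
    | @nil a =>
      intro h1 h2
      rw [ancestor_self (by omega)]
      exact a.2
    | @cons a b c h _ ih =>
      intro h1 h2
      by_cases h3 : T.dist r a = D
      · rw [ancestor_self h3]
        exact a.2
      · have hadj : T.Adj a b := h
        have h4 : D ≤ T.dist r b := by
          rcases hT.dist_eq_dist_add_one_of_adj r hadj with hd | hd <;> omega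
        rw [ancestor_eq_of_adj hT hadj h1 h4]
        exact ih h4 h2
  exact key p hD hD'

end Tree

/-- The adjacency relation of a graph on `0, …, n - 1`, as a relation on natural numbers. -/
def natAdj {n : ℕ} (G : SimpleGraph (Fin n)) (y u : ℕ) : Prop :=
  ∃ (hy : y < n) (hu : u < n), G.Adj ⟨y, hy⟩ ⟨u, hu⟩

/-- The only fact about treewidth that is needed. `D u` is the depth of the topmost bag with `u`. If
`x` has minimum depth in its component, then all bags that meet the component lie below the topmost
bag of `x`. A neighbour `z` of the component with `D z ≤ D x` occurs in one of these bags and in one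
at depth at most `D x`, hence in the topmost bag of `x`. -/
theorem exists_depth {n k : ℕ} {G : SimpleGraph (Fin n)} (hG : TreewidthAtMost G k) :
    ∃ (D : ℕ → ℕ) (F : ℕ → Finset ℕ), (∀ x, (F x).card ≤ k) ∧
      ∀ (K : ℕ) (S : ℕ → ℕ) (x : ℕ), (∀ u, Conn n K (natAdj G) S x u → D x ≤ D u) →
        ∀ u z, Conn n K (natAdj G) S x u → natAdj G u z → D z ≤ D x → z ≠ x → z ∈ F x := by
  classical
  obtain ⟨TD, hw⟩ := hG
  obtain ⟨r⟩ := TD.isTree.connected.nonempty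
  have hbag : ∀ t, (TD.bag t).card ≤ k + 1 := by
    intro t
    have h1 : (TD.bag t).card ≤ Finset.univ.sup fun t => (TD.bag t).card :=
      Finset.le_sup (f := fun t => (TD.bag t).card) (Finset.mem_univ t)
    unfold TreeDecomposition.width at hw
    omega
  have htop : ∀ v : Fin n, ∃ t, v ∈ TD.bag t ∧
      ∀ t', v ∈ TD.bag t' → TD.tree.dist r t ≤ TD.tree.dist r t' := by
    intro v
    obtain ⟨t, ht, hmin⟩ := Finset.exists_min_image
      (Finset.univ.filter fun t => v ∈ TD.bag t) (TD.tree.dist r) (by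
        obtain ⟨t, ht⟩ := TD.cover v
        exact ⟨t, by simp [ht]⟩)
    exact ⟨t, by simpa using ht, fun t' ht' => hmin t' (by simp [ht'])⟩
  choose top htop hmin using htop
  let D : ℕ → ℕ := fun u => if h : u < n then TD.tree.dist r (top ⟨u, h⟩) else 0
  have hD : ∀ {u} (h : u < n), D u = TD.tree.dist r (top ⟨u, h⟩) := fun h => dif_pos h
  -- Removing `x` from its topmost bag leaves at most `k` vertices.
  refine ⟨D, fun x => if h : x < n then
    ((TD.bag (top ⟨x, h⟩)).erase ⟨x, h⟩).image Fin.val else ∅, fun x => ?_, ?_⟩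
  · by_cases h : x < n
    · beta_reduce
      rw [dif_pos h]
      refine Finset.card_image_le.trans ?_
      rw [Finset.card_erase_of_mem (htop _)]
      have := hbag (top ⟨x, h⟩)
      omega
    · simp [h]
  · intro K S x hx u z hu huz hz hzx
    have hxn := hu.lt_left
    -- Along an edge of the component the subtrees of its ends share a node, and both subtrees stay
    -- at depth at least `D x`, so the ancestor at that depth does not change.
    have key : ∀ u, Conn n K (natAdj G) S x u → ∀ (h : u < n) (t), (⟨u, h⟩ : Fin n) ∈ TD.bag t →
        ancestor TD.tree r (D x) t = top ⟨x, hxn⟩ := by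
      intro u hu
      induction hu with
      | refl hw hS =>
        intro h t ht
        rw [ancestor_eq_of_connected TD.isTree (TD.subtree ⟨x, h⟩)
          (fun t ht => by rw [hD h]; exact hmin _ t ht) ht (htop _)]
        exact ancestor_self (hD h).symm
      | @step u v hu hE hv hS ih =>
        intro h t ht
        obtain ⟨hun, hvn, hadj⟩ := hE
        obtain ⟨t0, ht0, ht0'⟩ := TD.edge _ _ hadj
        rw [ancestor_eq_of_connected TD.isTree (TD.subtree ⟨v, h⟩)
          (fun t ht => (hx v (.step hu ⟨hun, hvn, hadj⟩ hv hS)).trans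
            (by rw [hD h]; exact hmin _ t ht)) ht ht0']
        exact ih hun t0 ht0
    obtain ⟨hun, hzn, hadj⟩ := huz
    obtain ⟨t0, ht0, ht0'⟩ := TD.edge _ _ hadj
    have h1 : D x ≤ TD.tree.dist r t0 := (hx u hu).trans (by rw [hD hun]; exact hmin _ t0 ht0)
    have h2 := ancestor_mem_of_connected TD.isTree (TD.subtree ⟨z, hzn⟩) ht0' (htop ⟨z, hzn⟩) h1
      (by rw [← hD hzn]; exact hz)
    rw [key u hu hun t0 ht0] at h2
    beta_reduce
    rw [dif_pos hxn, Finset.mem_image]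
    refine ⟨⟨z, hzn⟩, Finset.mem_erase.2 ⟨?_, h2⟩, rfl⟩
    simpa [Fin.ext_iff] using hzx

/-! ### Derivations from depths -/

section Depth

variable {n K k : ℕ} {E : ℕ → ℕ → Prop} {D : ℕ → ℕ} {F : ℕ → Finset ℕ} {S : ℕ → ℕ}

/-- If slot `i` holds no neighbour of the component of `x`, then `x` may be put into slot `i`
without the component growing. -/
theorem Conn.of_update {x i : ℕ} (hi : ∀ u, Conn n K E S x u → ¬ E u (S i)) {u u' : ℕ}
    (h : Conn n K E (Function.update S i x) u u') (hu : Conn n K E S x u) :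
    Conn n K E S x u' := by
  induction h with
  | refl => exact hu
  | step _ hE hv hS ih =>
    refine .step ih hE hv fun l hl hlv => ?_
    by_cases hli : l = i
    · rw [hli] at hlv
      exact hi _ ih (hlv ▸ hE)
    · exact hS l hl (by rw [Function.update_of_ne hli, hlv])

/-- Each component of the connected set without `x` contains a neighbour of `x`, so root `x` and low
`0` describe the rest of the component once `x` is in a slot. The vertex released from slot `i` is
not adjacent to the component and cannot enter. -/
theorem component_eq {x i : ℕ} (hx : Conn n K E S x x)
    (hi : ∀ u, Conn n K E S x u → ¬ E u (S i)) (u : ℕ) :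
    Conn n K E S x u ↔ u = x ∨ u ∈ Piece n K E (Function.update S i x) x 0 := by
  constructor
  · intro h
    induction h with
    | refl => exact .inl rfl
    | @step u v h huv hv hS ih =>
      by_cases hvx : v = x
      · exact .inl hvx
      · have hS' : ∀ l < K, Function.update S i x l ≠ v := by
          intro l hl
          by_cases hli : l = i
          · rw [hli, Function.update_self]
            exact Ne.symm hvx
          · rw [Function.update_of_ne hli]
            exact hS l hl
        rcases ih with ih | ⟨w, h1, h2, h3⟩
        · subst ih
          exact .inr ⟨v, Nat.zero_le _, .inr huv, .refl hv hS'⟩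
        · exact .inr ⟨w, h1, h2, .step h3 huv hv hS'⟩
  · rintro (rfl | ⟨w, -, h2, h3⟩)
    · exact hx
    · have hxw : E x w := h2.resolve_left (by have := hx.lt; omega)
      refine h3.of_update hi (.step hx hxw h3.lt_left fun l hl hlw => ?_)
      by_cases hli : l = i
      · rw [hli] at hlw
        exact hi x hx (hlw ▸ hxw)
      · exact h3.notMem_left l hl (by rw [Function.update_of_ne hli, hlw])

/-- If every slot held a neighbour of the component, then the slots would hold `K` distinct elements
of `F x`, which has at most `k < K` elements. -/
theorem exists_free_slot (hF : ∀ x, (F x).card ≤ k) (hK : k < K)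
    (hDF : ∀ (S : ℕ → ℕ) (x : ℕ), (∀ u, Conn n K E S x u → D x ≤ D u) →
        ∀ u z, Conn n K E S x u → E u z → D z ≤ D x → z ≠ x → z ∈ F x)
    (hE : ∀ u v, E u v → v < n) {x : ℕ} (hx : Conn n K E S x x)
    (hmin : ∀ u, Conn n K E S x u → D x ≤ D u)
    (hinj : ∀ l < K, ∀ l' < K, l ≠ l' → S l = S l' → n ≤ S l)
    (hInv : ∀ u' z, Conn n K E S x u' → E u' z → (∃ l < K, S l = z) → D z ≤ D x) :
    ∃ i < K, ∀ u, Conn n K E S x u → ¬ E u (S i) := by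
  by_contra! hcon
  have hmem : ∀ i ∈ Finset.range K, S i ∈ F x := by
    intro i hi
    rw [Finset.mem_range] at hi
    obtain ⟨u, hu, huE⟩ := hcon i hi
    exact hDF S x hmin u (S i) hu huE (hInv u _ hu huE ⟨i, hi, rfl⟩) (hx.notMem i hi)
  have hcard : (Finset.range K).card ≤ (F x).card := by
    refine Finset.card_le_card_of_injOn S hmem fun l hl l' hl' h => ?_
    by_contra hne
    rw [Finset.mem_coe, Finset.mem_range] at hl hl'
    obtain ⟨u, hu, huE⟩ := hcon l hl
    have := hE _ _ huE
    have := hinj l hl l' hl' hne h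
    omega
  rw [Finset.card_range] at hcard
  have := hF x
  omega

open Classical in
/-- The elements of a piece. -/
noncomputable def pieceFinset (n K : ℕ) (E : ℕ → ℕ → Prop) (S : ℕ → ℕ) (y j : ℕ) : Finset ℕ :=
  (Finset.range n).filter fun u => u ∈ Piece n K E S y j

theorem mem_pieceFinset {y j u : ℕ} :
    u ∈ pieceFinset n K E S y j ↔ u ∈ Piece n K E S y j := by
  simp only [pieceFinset, Finset.mem_filter, Finset.mem_range, and_iff_right_iff_imp]
  exact lt_of_mem_piece

/-- Two invariants are kept: no vertex occupies two slots, and a slot vertex adjacent to a component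
of the piece has depth at most that of each vertex of the component. Eliminating a vertex of minimum
depth preserves the second. The measure orders pairs lexicographically, by the size of the piece and
then by `n - j`. -/
theorem deriv_of_depth (hF : ∀ x, (F x).card ≤ k) (hK : k < K)
    (hDF : ∀ (S : ℕ → ℕ) (x : ℕ), (∀ u, Conn n K E S x u → D x ≤ D u) →
        ∀ u z, Conn n K E S x u → E u z → D z ≤ D x → z ≠ x → z ∈ F x)
    (hE : ∀ u v, E u v → v < n) (hsymm : ∀ u v, E u v → E v u) (m : ℕ) :
    ∀ (S : ℕ → ℕ) (y j : ℕ), y < n + 2 → j ≤ n →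
      (pieceFinset n K E S y j).card * (n + 1) + (n - j) ≤ m →
      (∀ l < K, ∀ l' < K, l ≠ l' → S l = S l' → n ≤ S l) →
      (∀ u ∈ Piece n K E S y j, ∀ u' z, Conn n K E S u u' → E u' z → (∃ l < K, S l = z) →
        D z ≤ D u) →
      Deriv n K E S y j := by
  induction m using Nat.strong_induction_on with
  | _ m ih =>
  intro S y j hy hj hm hinj hInv
  rcases hj.eq_or_lt with rfl | hjn
  · refine .empty ?_
    rintro u ⟨w, h1, -, h3⟩
    have := h3.lt_left
    omega
  have hsub : ∀ u, u ∈ Piece n K E S y (j + 1) → u ∈ Piece n K E S y j :=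
    fun u ⟨w, h1, h2⟩ => ⟨w, by omega, h2⟩
  have hcard : (pieceFinset n K E S y (j + 1)).card ≤ (pieceFinset n K E S y j).card :=
    Finset.card_le_card fun u hu => mem_pieceFinset.2 (hsub u (mem_pieceFinset.1 hu))
  have hc : Deriv n K E S y (j + 1) := by
    refine ih (m - 1) ?_ S y (j + 1) hy hjn ?_ hinj fun u hu => hInv u (hsub u hu)
    · omega
    · have := Nat.mul_le_mul_right (n + 1) hcard
      omega
  -- Passing from `j` to `j + 1` changes the piece only if `j` is the largest vertex of its
  -- component that is adjacent to `y` (the largest of all, if `y = n`). Then exactly this component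
  -- is split off.
  by_cases hnew : ((y = n ∨ E y j) ∧ Conn n K E S j j) ∧ j ∉ Piece n K E S y (j + 1)
  swap
  · refine hc.congr (fun _ _ => rfl) (Set.Subset.antisymm hsub ?_)
    rintro u ⟨w, h1, h2, h3⟩
    by_cases hwj : w = j
    · subst hwj
      have hjj : Conn n K E S w w := .refl hjn h3.notMem_left
      have : w ∈ Piece n K E S y (w + 1) := by
        by_contra hcon
        exact hnew ⟨⟨h2, hjj⟩, hcon⟩
      obtain ⟨w', h4, h5, h6⟩ := this
      exact ⟨w', h4, h5, h6.trans h3⟩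
    · exact ⟨w, by omega, h2, h3⟩
  obtain ⟨⟨hyj, hjj⟩, hjnot⟩ := hnew
  obtain ⟨x, hjx, hxmin⟩ : ∃ x, Conn n K E S j x ∧ ∀ u, Conn n K E S j u → D x ≤ D u := by
    obtain ⟨x, hx, hmin⟩ := (measure D).wf.has_min {x | Conn n K E S j x} ⟨j, hjj⟩
    exact ⟨x, hx, fun u hu => not_lt.1 (hmin u hu)⟩
  have hxj := hjx.symm hsymm
  have hxx := hxj.trans hjx
  have hcomp : ∀ u, Conn n K E S j u ↔ Conn n K E S x u :=
    fun u => ⟨fun h => hxj.trans h, fun h => hjx.trans h⟩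
  have hmin : ∀ u, Conn n K E S x u → D x ≤ D u := fun u hu => hxmin u (hjx.trans hu)
  have hxP : x ∈ Piece n K E S y j := ⟨j, le_rfl, hyj, hjx⟩
  obtain ⟨i, hiK, hi⟩ := exists_free_slot hF hK hDF hE hxx hmin hinj (hInv x hxP)
  have hxC := component_eq hxx hi
  have hS'i : Function.update S i x i = x := Function.update_self ..
  have hdisj : ∀ u, Conn n K E S x u → u ∉ Piece n K E S y (j + 1) := by
    rintro u hu ⟨w, h1, h2, h3⟩
    exact hjnot ⟨w, h1, h2, h3.trans ((hjx.trans hu).symm hsymm)⟩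
  have hmem : ∀ u, u ∈ Piece n K E S y j ↔
      u = x ∨ u ∈ Piece n K E (Function.update S i x) x 0 ∨ u ∈ Piece n K E S y (j + 1) := by
    intro u
    rw [← or_assoc, ← hxC]
    constructor
    · rintro ⟨w, h1, h2, h3⟩
      by_cases hwj : w = j
      · exact .inl (hxj.trans (hwj ▸ h3))
      · exact .inr ⟨w, by omega, h2, h3⟩
    · rintro (h | h)
      · exact ⟨j, le_rfl, hyj, hjx.trans h⟩
      · exact hsub u h
  have hxb : x ∉ Piece n K E (Function.update S i x) x 0 := by
    rintro ⟨w, -, -, h⟩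
    exact h.notMem i hiK hS'i
  have hb : Deriv n K E (Function.update S i x) x 0 := by
    have hlt : (pieceFinset n K E (Function.update S i x) x 0).card <
        (pieceFinset n K E S y j).card := by
      refine Finset.card_lt_card ⟨fun u hu => ?_, fun h => ?_⟩
      · exact mem_pieceFinset.2 ((hmem u).2 (.inr (.inl (mem_pieceFinset.1 hu))))
      · exact hxb (mem_pieceFinset.1 (h (mem_pieceFinset.2 hxP)))
    -- The loss of `x` lowers the measure by at least `n + 1`, which pays for resetting `j` to 0.
    have h1 := Nat.mul_le_mul_right (n + 1) hlt
    rw [Nat.succ_mul] at h1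
    refine ih (m - 1) (by omega) _ x 0 (by have := hxx.lt; omega) (Nat.zero_le _) (by omega) ?_ ?_
    · intro l hl l' hl' hne heq
      have hxS := hxx.notMem
      by_cases h2 : l = i
      · rw [h2, hS'i, Function.update_of_ne (by omega)] at heq
        exact absurd heq.symm (hxS l' hl')
      · rw [Function.update_of_ne h2] at heq ⊢
        by_cases h3 : l' = i
        · rw [h3, hS'i] at heq
          exact absurd heq (hxS l hl)
        · rw [Function.update_of_ne h3] at heq
          exact hinj l hl l' hl' hne heq
    · rintro u hu u' z huu' hE' ⟨l, hl, hlz⟩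
      have hxu : Conn n K E S x u := (hxC u).2 (.inr hu)
      have hxu' := huu'.of_update hi hxu
      by_cases h2 : l = i
      · rw [h2, hS'i] at hlz
        rw [← hlz]
        exact hmin u hxu
      · rw [Function.update_of_ne h2] at hlz
        exact hInv u ⟨j, le_rfl, hyj, hjx.trans hxu⟩ u' z ((hxu.symm hsymm).trans hxu') hE'
          ⟨l, hl, hlz⟩
  refine .join (S' := Function.update S i x) (S'' := S) i hiK (by rw [hS'i]; exact hxx.lt)
    (fun l _ hli => Function.update_of_ne hli _ _) (fun _ _ => rfl) (y' := x) (j' := 0) (y'' := y)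
    (j'' := j + 1) (by have := hxx.lt; omega) (by omega) hy (by omega) hb hc ?_ ?_ ?_ ?_ ?_
  · rw [hS'i]
    exact hmem
  · rw [hS'i]
    exact hxb
  · rw [hS'i]
    exact hdisj x hxx
  · rintro u ⟨h1, h2⟩
    exact hdisj u ((hxC u).2 (.inr h1)) h2
  · rw [hS'i]
    intro u hu
    have hxu := (hxC u).2 hu
    refine ⟨fun h => hi u hxu (hsymm _ _ h), fun v hv huv => ?_⟩
    have hv' : Conn n K E S x v := .step hxu huv (hE _ _ huv) (by
      obtain ⟨w, -, -, h⟩ := hv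
      exact h.notMem)
    exact hdisj v hv' hv

end Depth

/-- At the start all slots hold `n`, which is no vertex and has no neighbours, so both invariants
hold trivially. -/
theorem deriv_of_treewidth {n k : ℕ} {G : SimpleGraph (Fin n)} (hG : TreewidthAtMost G k) :
    Deriv n (k + 1) (natAdj G) (fun _ => n) n 0 := by
  obtain ⟨D, F, hF, hDF⟩ := exists_depth hG
  refine deriv_of_depth hF (Nat.lt_succ_self k) (hDF (k + 1)) (fun u v h => h.2.1)
    (fun u v ⟨h1, h2, h3⟩ => ⟨h2, h1, h3.symm⟩) _ _ n 0 (by omega) (Nat.zero_le _) le_rfl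
    (fun _ _ _ _ _ _ => le_rfl) ?_
  rintro u - u' z - ⟨h1, h2, -⟩ ⟨l, -, rfl⟩
  omega

/-! ### Distribution of the optimal weight -/

section Feasible

variable {n : ℕ} {E : ℕ → ℕ → Prop} {T T' : ℕ → ℕ} {q : ℕ}

theorem Feasible.congr (h : Feasible n E T q) (hT : ∀ u < n, T u = T' u) : Feasible n E T' q := by
  obtain ⟨P, hP⟩ := h
  refine ⟨P, le_trans (le_of_eq ?_) hP⟩
  exact Finset.sum_congr rfl fun v hv => by rw [hT v (Finset.mem_range.1 hv)]

theorem sum_ind_eq {z : ℕ} (hz : z < n) : ∑ u ∈ Finset.range n, ind (u = z) = 1 := by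
  rw [Finset.sum_eq_single z]
  · exact ind_of rfl
  · exact fun u _ hu => ind_of_not hu
  · exact fun h => absurd (Finset.mem_range.2 hz) h

theorem Feasible.of_sub_ind {z : ℕ} (hz : z < n) (h : Feasible n E (fun u => T u - ind (u = z)) q) :
    Feasible n E T (q + 1) := by
  obtain ⟨P, hP⟩ := h
  refine ⟨P, ?_⟩
  rw [← sum_ind_eq hz]
  refine le_trans ?_ (Nat.add_le_add_right hP _)
  rw [← Finset.sum_add_distrib]
  exact Finset.sum_le_sum fun v _ => by beta_reduce; omega

/-- If the optimal weight is positive, then some vertex can be charged. -/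
theorem Feasible.exists_sub_ind (h : Feasible n E T q) (hq : 0 < q)
    (hmin : ∀ q', Feasible n E T q' → q ≤ q') :
    ∃ z < n, 0 < T z ∧ Feasible n E (fun u => T u - ind (u = z)) (q - 1) := by
  obtain ⟨P, hP⟩ := h
  -- By minimality the cost is positive, so some vertex has a positive deficit. Charging it lowers
  -- the cost of the same labelling by one.
  have hpos : 0 < ∑ v ∈ Finset.range n, (T v - before n E P Set.univ v (P v)) :=
    hq.trans_le (hmin _ ⟨P, le_rfl⟩)
  obtain ⟨z, hz, hz0⟩ := Finset.exists_ne_zero_of_sum_ne_zero hpos.ne'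
  have hzn := Finset.mem_range.1 hz
  refine ⟨z, hzn, by omega, P, ?_⟩
  suffices h : ∑ v ∈ Finset.range n, (T v - ind (v = z) - before n E P Set.univ v (P v)) +
      ∑ v ∈ Finset.range n, ind (v = z) ≤ q by
    rw [sum_ind_eq hzn] at h
    beta_reduce
    omega
  rw [← Finset.sum_add_distrib]
  refine (Finset.sum_le_sum fun v _ => ?_).trans hP
  by_cases hv : v = z
  · subst hv
    rw [ind_of rfl]
    omega
  · rw [ind_of_not hv]
    omega

end Feasible

/-- The number of failures of an upward closed predicate is the least witness. -/
theorem sum_ind_not {p : ℕ → Prop} (hp : ∀ a b, a ≤ b → p a → p b) {a N : ℕ} (ha : p a)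
    (haN : a < N) : p (∑ q ∈ Finset.range N, ind (¬ p q)) ∧
      ∀ b, p b → ∑ q ∈ Finset.range N, ind (¬ p q) ≤ b := by
  classical
  have hex : ∃ q, p q := ⟨a, ha⟩
  have hle : Nat.find hex ≤ a := Nat.find_min' hex ha
  have key : ∑ q ∈ Finset.range N, ind (¬ p q) = Nat.find hex := by
    have h1 : ∀ q ∈ Finset.range N, ind (¬ p q) = if q < Nat.find hex then 1 else 0 := by
      intro q _
      split_ifs with h
      · exact ind_of (Nat.find_min hex h)
      · exact ind_of_not (not_not.2 (hp _ _ (not_lt.1 h) (Nat.find_spec hex)))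
    rw [Finset.sum_congr rfl h1]
    exact (mulN_eq (by omega : Nat.find hex ≤ N) 1).trans (mul_one _)
  rw [key]
  exact ⟨Nat.find_spec hex, fun b hb => Nat.find_min' hex hb⟩

namespace State

theorem Decides.mono {s : State} {a b : ℕ} (hab : a ≤ b) (h : s.Decides a) : s.Decides b := by
  obtain ⟨c, hc, h1, h2, h3, h4, h5⟩ := h
  exact ⟨c, hc, h1, h2, h3, h4, h5.trans hab⟩

/-- The state allows exact decisions about the graph with edge relation `E`. -/
structure Ready (n : ℕ) (E : ℕ → ℕ → Prop) (s : State) : Prop where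
  order : s.n = n
  edge : s.E = E
  symm : ∀ u v, E u v → E v u
  range : s.N = (s.n + 2) ^ (3 * s.K + 4)
  reach : s.ReachCorrect
  le : ∀ u < n, s.T u ≤ n
  deriv : Deriv n s.K E (fun _ => n) n 0

theorem Ready.decides_iff_feasible {n : ℕ} {E : ℕ → ℕ → Prop} {s : State} (h : s.Ready n E)
    (q : ℕ) : s.itemClosure.Decides q ↔ Feasible n E s.thrAt q := by
  obtain ⟨rfl, rfl, hs, hN, hr, hT, hd⟩ := h
  exact ⟨feasible_of_decides hN hr hs,
    decides_of_feasible hN hr hs (fun u hu => (Nat.sub_le _ _).trans (hT u hu)) hd⟩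

/-- The weight `q` is optimal for the current thresholds, and `w` is the total weight. -/
structure Optimal (n : ℕ) (E : ℕ → ℕ → Prop) (thr : ℕ → ℕ) (w : ℕ) (s : State) : Prop where
  ready : s.Ready n E
  done : s.done = 1
  split : ∀ u < n, s.out u + s.T u = thr u
  feasible : Feasible n E s.T s.q
  min : ∀ q, Feasible n E s.T q → s.q ≤ q
  weight : ∑ u ∈ Finset.range n, s.out u + s.q = w

theorem attempt_cases (s : State) :
    (s.z < s.n ∧ 0 < s.q ∧ 0 < s.T s.z ∧ s.itemClosure.Decides (s.q - 1) ∧ ∃ A, s.attempt =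
      { s with
        tab := A
        out := s.overwrite (fun u => s.out u + ind (u = s.z)) s.out
        T := s.overwrite s.thrAt s.T
        q := s.q - 1
        z := s.z + 1 }) ∨
    (¬ (s.z < s.n ∧ 0 < s.q ∧ 0 < s.T s.z ∧ s.itemClosure.Decides (s.q - 1)) ∧
      ∃ A, s.attempt = { s with tab := A, z := s.z + 1 }) := by
  by_cases h : s.z < s.n ∧ 0 < s.q ∧ 0 < s.T s.z ∧ s.itemClosure.Decides (s.q - 1)
  · refine .inl ⟨h.1, h.2.1, h.2.2.1, h.2.2.2, s.itemClosure.tab, ?_⟩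
    rw [attempt, if_pos h, itemClosure_eq]
    rfl
  · refine .inr ⟨h, s.itemClosure.tab, ?_⟩
    rw [attempt, if_neg h, itemClosure_eq]

section Optimal

variable {n w : ℕ} {E : ℕ → ℕ → Prop} {thr : ℕ → ℕ} {s : State}

/-- After a charge `q - 1` is again optimal, as undoing the charge costs at most one unit
(`Feasible.of_sub_ind`). The test for a positive threshold excludes truncation, so output and
threshold keep their sum. -/
theorem Optimal.attempt (h : s.Optimal n E thr w) : s.attempt.Optimal n E thr w ∧
    s.attempt.z = s.z + 1 ∧
    (s.attempt.q < s.q ∨ s.attempt.q = s.q ∧ s.attempt.T = s.T ∧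
      ¬ (s.z < n ∧ 0 < s.q ∧ 0 < s.T s.z ∧
        Feasible n E (fun u => s.T u - ind (u = s.z)) (s.q - 1))) := by
  have hdec := h.ready.decides_iff_feasible (s.q - 1)
  obtain ⟨⟨hn, hE, hs, hN, hr, hT, hd⟩, hdone, hsplit, hf, hmin, hw⟩ := h
  have hnN := n_lt_of_N_eq hN
  rcases s.attempt_cases with ⟨hz, hq, hTz, h, A, heq⟩ | ⟨hneg, A, heq⟩
  · rw [heq]
    rw [hn] at hz
    have hover : ∀ F B : ℕ → ℕ, ∀ u < n, s.overwrite F B u = F u := fun F B u hu =>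
      if_pos (by omega)
    have hfeas := hdec.1 h
    refine ⟨⟨⟨hn, hE, hs, hN, hr, fun u hu => ?_, hd⟩, hdone, fun u hu => ?_, ?_, ?_, ?_⟩, rfl,
      .inl (Nat.sub_lt hq one_pos)⟩
    · change s.overwrite _ _ u ≤ n
      rw [hover _ _ u hu]
      exact (Nat.sub_le _ _).trans (hT u hu)
    · change s.overwrite (fun u => s.out u + ind (u = s.z)) s.out u + s.overwrite s.thrAt s.T u = thr u
      rw [hover _ _ u hu, hover _ _ u hu, ← hsplit u hu]
      unfold thrAt
      by_cases huz : u = s.z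
      · rw [ind_of huz, huz]
        omega
      · rw [ind_of_not huz]
        omega
    · exact hfeas.congr fun u hu => (hover _ _ u hu).symm
    · intro q' hq'
      have h1 : Feasible n E s.thrAt q' := hq'.congr fun u hu => hover _ _ u hu
      have := hmin _ (h1.of_sub_ind hz)
      change s.q - 1 ≤ q'
      omega
    · change ∑ u ∈ Finset.range n,
        s.overwrite (fun u => s.out u + ind (u = s.z)) s.out u + (s.q - 1) = w
      rw [Finset.sum_congr rfl fun u hu => hover _ _ u (Finset.mem_range.1 hu),
        Finset.sum_add_distrib, sum_ind_eq hz]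
      omega
  · rw [heq]
    refine ⟨⟨⟨hn, hE, hs, hN, hr, hT, hd⟩, hdone, hsplit, hf, hmin, hw⟩, rfl,
      .inr ⟨rfl, rfl, fun h => hneg ?_⟩⟩
    rw [hdec, hn]
    exact h

/-- If `q` is positive, then some vertex `u` can be charged. Unless a charge occurs before `u` is
tried, the thresholds are still the initial ones at that moment and the attempt at `u` succeeds. -/
theorem Optimal.round (h : s.Optimal n E thr w) : s.round.Optimal n E thr w ∧
    s.round.q ≤ s.q - 1 := by
  set s₀ : State := { s with z := 0 } with hs₀
  have h₀ : s₀.Optimal n E thr w :=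
    ⟨⟨h.ready.order, h.ready.edge, h.ready.symm, h.ready.range, h.ready.reach, h.ready.le,
      h.ready.deriv⟩, h.done, h.split, h.feasible, h.min, h.weight⟩
  have hopt : ∀ i, (State.attempt^[i] s₀).Optimal n E thr w ∧ (State.attempt^[i] s₀).z = i := by
    intro i
    induction i with
    | zero => exact ⟨h₀, rfl⟩
    | succ i ih =>
      rw [Function.iterate_succ_apply']
      exact ⟨ih.1.attempt.1, ih.1.attempt.2.1.trans (by rw [ih.2])⟩
  have hle : ∀ i, (State.attempt^[i] s₀).q ≤ s.q := by
    intro i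
    induction i with
    | zero => exact le_rfl
    | succ i ih =>
      rw [Function.iterate_succ_apply']
      rcases (hopt i).1.attempt.2.2 with h | ⟨h, -⟩ <;> omega
  refine ⟨(hopt s.N).1, ?_⟩
  rcases Nat.eq_zero_or_pos s.q with hq | hq
  · exact (hle s.N).trans (by omega)
  obtain ⟨u, hu, hTu, hfu⟩ := h.feasible.exists_sub_ind hq h.min
  have hdec : ∀ i, (State.attempt^[i] s₀).q < s.q ∨
      (State.attempt^[i] s₀).q = s.q ∧ (State.attempt^[i] s₀).T = s.T ∧ i ≤ u := by
    intro i
    induction i with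
    | zero => exact .inr ⟨rfl, rfl, Nat.zero_le _⟩
    | succ i ih =>
      rw [Function.iterate_succ_apply']
      rcases (hopt i).1.attempt.2.2 with h | ⟨h1, h2, h3⟩
      · exact .inl (h.trans_le (hle i))
      · rcases ih with ih | ⟨ih1, ih2, ih3⟩
        · exact .inl (h1 ▸ ih)
        · refine .inr ⟨h1.trans ih1, h2.trans ih2, Nat.lt_of_le_of_ne ih3 ?_⟩
          rintro rfl
          rw [(hopt i).2, ih1, ih2] at h3
          exact h3 ⟨hu, hq, hTu, hfu⟩
  have hnN := n_lt_of_N_eq h.ready.range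
  rw [h.ready.order] at hnN
  rcases hdec s.N with h | ⟨-, -, h⟩
  · exact Nat.le_sub_one_of_lt h
  · omega

theorem Optimal.rounds (h : s.Optimal n E thr w) (k : ℕ) :
    (State.round^[k] s).Optimal n E thr w ∧ (State.round^[k] s).q ≤ s.q - k := by
  induction k with
  | zero => exact ⟨h, le_rfl⟩
  | succ k ih =>
    rw [Function.iterate_succ_apply']
    refine ⟨ih.1.round.1, ih.1.round.2.trans ?_⟩
    omega

end Optimal

/-- Once the tables decide some weight, the distribution yields an output of optimal weight. -/
theorem Ready.finish {n : ℕ} {E : ℕ → ℕ → Prop} {thr : ℕ → ℕ} {s : State} (h : s.Ready n E)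
    (hz : s.z = n) (hsplit : ∀ u < n, s.out u + s.T u = thr u) {a : ℕ} (ha : a < s.N)
    (hda : s.itemClosure.Decides a) : ∃ q, (∀ q', Feasible n E s.T q' → q ≤ q') ∧
      s.itemClosure.finish.Optimal n E thr (∑ u ∈ Finset.range n, s.out u + q) ∧
      s.itemClosure.finish.q = 0 := by
  have hdec : ∀ q, s.itemClosure.Decides q ↔ Feasible n E s.T q := by
    intro q
    have hT : ∀ u < n, s.thrAt u = s.T u := fun u hu => by
      rw [thrAt, ind_of_not (by omega), Nat.sub_zero]
    rw [h.decides_iff_feasible]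
    exact ⟨fun h => h.congr hT, fun h => h.congr fun u hu => (hT u hu).symm⟩
  set q := ∑ q ∈ Finset.range s.N, ind (¬ s.itemClosure.Decides q) with hq
  obtain ⟨h1, h2⟩ := sum_ind_not (p := s.itemClosure.Decides) (fun _ _ => Decides.mono) hda ha
  rw [← hq] at h1 h2
  obtain ⟨A, hA⟩ : ∃ A, s.itemClosure = { s with tab := A } := ⟨_, itemClosure_eq s⟩
  have hopt : ({ s.itemClosure with q := q, done := 1 } : State).Optimal n E thr
      (∑ u ∈ Finset.range n, s.out u + q) := by
    rw [hA]
    exact ⟨⟨h.order, h.edge, h.symm, h.range, h.reach, h.le, h.deriv⟩, rfl, hsplit,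
      (hdec q).1 h1, fun q' hq' => h2 q' ((hdec q').2 hq'), rfl⟩
  have hfin : s.itemClosure.finish = State.round^[s.N] { s.itemClosure with q := q, done := 1 } := by
    rw [State.finish, s.itemClosure_N, ← hq]
    simp only [s.itemClosure_N]
  refine ⟨q, fun q' hq' => h2 q' ((hdec q').2 hq'), ?_, ?_⟩
  · rw [hfin]
    exact (hopt.rounds _).1
  · rw [hfin]
    -- The optimum satisfies `q ≤ a < N`, so `N` rounds exhaust it.
    have := (hopt.rounds s.N).2
    change _ ≤ q - s.N at this
    have := h2 a hda
    omega

end State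

/-! ### Labellings and hulls -/

section Hull

variable {n : ℕ} {G : SimpleGraph (Fin n)}

theorem before_natAdj (P : ℕ → ℕ) (v : Fin n) (p : ℕ) :
    before n (natAdj G) P Set.univ v p = ({u : Fin n | P u < p} ∩ G.neighborSet v).ncard := by
  classical
  unfold before
  rw [wsum_of_forall fun u _ => Set.mem_univ u, ← Fin.sum_univ_eq_sum_range
    (fun u => ind (natAdj G v u ∧ P u < p)), Set.ncard_eq_toFinset_card', Finset.card_eq_sum_ones,
    ← Finset.sum_subset (Finset.subset_univ ({u : Fin n | P u < p} ∩ G.neighborSet v).toFinset)]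
  · refine Finset.sum_congr rfl fun u hu => ind_of ?_
    simp only [Set.mem_toFinset, Set.mem_inter_iff, Set.mem_ofPred_eq,
      SimpleGraph.mem_neighborSet] at hu
    exact ⟨⟨v.2, u.2, hu.2⟩, hu.1⟩
  · rintro u - hu
    refine ind_of_not fun ⟨⟨_, _, h⟩, hp⟩ => hu ?_
    simpa using ⟨hp, h⟩

/-- Partial incentives correspond to labellings of the vertices. -/
theorem isPartialIncentive_iff {τ : Fin n → ℤ} {σ : Fin n → ℕ} : IsPartialIncentive G τ σ ↔
    ∃ P : ℕ → ℕ, ∀ v : Fin n, τ v ≤ σ v + before n (natAdj G) P Set.univ v (P v) := by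
  constructor
  · intro h
    -- A maximal set that can be labelled consistently is closed: a vertex that could be added gets
    -- a label `M` larger than all others. A closed set contains the hull of the empty set, which is
    -- everything.
    let good : Set (Fin n) → Prop := fun H => ∃ P : ℕ → ℕ, ∀ v ∈ H,
      τ v - σ v ≤ (({u : Fin n | P u < P v} ∩ H ∩ G.neighborSet v).ncard : ℤ)
    obtain ⟨H, ⟨P, hP⟩, hmax⟩ := Set.Finite.exists_maximal (Set.toFinite {H | good H})
      ⟨∅, fun _ => 0, by simp⟩
    have hclosed : IsClosedIn G (fun u => τ u - (σ u : ℤ)) H := by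
      intro u hu
      by_contra hmem
      obtain ⟨M, hM⟩ : ∃ M, ∀ v : Fin n, P v < M :=
        ⟨∑ v : Fin n, P v + 1, fun v => Nat.lt_succ_of_le
          (Finset.single_le_sum (f := fun v : Fin n => P v) (fun _ _ => Nat.zero_le _)
            (Finset.mem_univ v))⟩
      refine hmem (hmax (y := insert u H) ⟨Function.update P u M, fun v hv => ?_⟩
        (Set.subset_insert u H) (Set.mem_insert u H))
      have hne : ∀ x ∈ H, Function.update P u M (x : ℕ) = P x := fun x hx =>
        Function.update_of_ne (fun h => hmem ((Fin.ext h : x = u) ▸ hx)) _ _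
      rcases hv with rfl | hv
      · refine hu.trans (Nat.cast_le.2 (Set.ncard_le_ncard ?_ (Set.toFinite _)))
        rintro x ⟨hx, hxv⟩
        refine ⟨⟨?_, .inr hx⟩, hxv⟩
        change Function.update P _ M (x : ℕ) < Function.update P _ M _
        rw [hne x hx, Function.update_self]
        exact hM x
      · refine (hP v hv).trans (Nat.cast_le.2 (Set.ncard_le_ncard ?_ (Set.toFinite _)))
        rintro x ⟨⟨hx, hxH⟩, hxv⟩
        refine ⟨⟨?_, .inr hxH⟩, hxv⟩
        change Function.update P _ M (x : ℕ) < Function.update P _ M (v : ℕ)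
        rw [hne x hxH, hne v hv]
        exact hx
    refine ⟨P, fun v => ?_⟩
    have hv : v ∈ H := by
      have : v ∈ hull G (fun u => τ u - (σ u : ℤ)) ∅ := by rw [h]; trivial
      exact this H ⟨Set.empty_subset _, hclosed⟩
    have h1 := hP v hv
    have h2 : (({u : Fin n | P u < P v} ∩ H ∩ G.neighborSet v).ncard : ℤ) ≤
        before n (natAdj G) P Set.univ v (P v) := by
      rw [before_natAdj]
      exact Nat.cast_le.2 (Set.ncard_le_ncard
        (Set.inter_subset_inter_left _ Set.inter_subset_left) (Set.toFinite _))
    omega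
  · rintro ⟨P, hP⟩
    refine Set.eq_univ_of_forall fun v H hH => ?_
    obtain ⟨-, hclosed⟩ := hH
    obtain ⟨p, hp⟩ : ∃ p, P v = p := ⟨_, rfl⟩
    -- In the order of the labels all vertices enter any closed set.
    induction p using Nat.strong_induction_on generalizing v with
    | _ p ih =>
      refine hclosed v ?_
      have h1 := hP v
      rw [before_natAdj] at h1
      have h2 : ({u : Fin n | P u < P v} ∩ G.neighborSet v).ncard ≤
          (H ∩ G.neighborSet v).ncard := Set.ncard_le_ncard
        (Set.inter_subset_inter_left _ fun u hu => ih (P u) (hp ▸ hu) u rfl) (Set.toFinite _)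
      change τ v - σ v ≤ _
      omega

end Hull

/-! ### The stages of the computation -/

/-- The presented state at the beginning. -/
noncomputable def inputState {n : ℕ} (G : SimpleGraph (Fin n)) (τ : Fin n → ℤ) : State where
  n := n
  N := 0
  K := 0
  z := 0
  q := 0
  done := 0
  thr i := ((inputMemory G τ).arr 0 i).toNat
  adj i := ((inputMemory G τ).arr 1 i).toNat
  out _ := 0
  T _ := 0
  reach _ := 0
  tab _ := 0

section Stages

variable {n : ℕ} {G : SimpleGraph (Fin n)} {τ : Fin n → ℤ}

theorem represents_inputState : Represents (inputState G τ) (inputMemory G τ) := by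
  refine ⟨rfl, rfl, rfl, rfl, rfl, rfl, fun _ => rfl, fun i => ?_, fun _ => rfl, fun _ => rfl,
    fun _ => rfl, fun _ => rfl⟩
  refine (Int.toNat_of_nonneg ?_).symm
  simp only [inputMemory, one_ne_zero, if_false, if_true]
  split_ifs <;> norm_num

theorem inputState_thr (u : Fin n) : (inputState G τ).thr u = (τ u).toNat := by
  simp [inputState, inputMemory]

theorem inputState_adj {y u : ℕ} (hu : u < n) :
    (inputState G τ).adj (y * n + u) = 1 ↔ natAdj G y u := by
  have h : (inputState G τ).adj (y * n + u) = 1 ↔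
      ∃ a b : Fin n, G.Adj a b ∧ ((y * n + u : ℕ) : ℤ) = ((a : ℕ) : ℤ) * (n : ℤ) + ((b : ℕ) : ℤ) := by
    simp only [inputState, inputMemory, one_ne_zero, if_false, if_true]
    split_ifs with h
    · exact iff_of_true rfl h
    · exact iff_of_false (by norm_num) h
  rw [h]
  constructor
  · rintro ⟨a, b, hab, heq⟩
    have heq : y * n + u = a * n + b := by exact_mod_cast heq
    have hub : u = b := by
      have := congrArg (· % n) heq
      simpa [Nat.mod_eq_of_lt hu, Nat.mod_eq_of_lt b.2] using this
    have hya : y = a := by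
      have : y * n = a * n := by omega
      exact Nat.eq_of_mul_eq_mul_right (by omega) this
    subst hub hya
    exact ⟨a.2, b.2, hab⟩
  · rintro ⟨hy, hu, hadj⟩
    exact ⟨_, _, hadj, by push_cast; rfl⟩

/-- The state before the work with `k + 1` slots. -/
structure Pending (G : SimpleGraph (Fin n)) (τ : Fin n → ℤ) (k : ℕ) (s : State) : Prop where
  order : s.n = n
  slots : s.K = k
  range : s.N = (n + 2) ^ (3 * k + 4)
  done : s.done = 0
  adj : s.adj = (inputState G τ).adj
  T : ∀ u : Fin n, s.T u = (τ u).toNat - ((τ u).toNat - n)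
  out : ∀ u : Fin n, s.out u = (τ u).toNat - n

/-- The state before the first stage. -/
noncomputable def initialState (G : SimpleGraph (Fin n)) (τ : Fin n → ℤ) : State :=
  { inputState G τ with N := n + 2 }.prepare

theorem pending_initialState : Pending G τ 0 (initialState G τ) := by
  have hover : ∀ (F A : ℕ → ℕ) (u : Fin n),
      ({ inputState G τ with N := n + 2 } : State).overwrite F A u = F u := fun F A u =>
    if_pos (show (u : ℕ) < n + 2 by omega)
  refine ⟨rfl, rfl, ?_, rfl, rfl, fun u => ?_, fun u => ?_⟩
  · change mulN (n + 2) (n + 2) (mulN (n + 2) (n + 2) (mulN (n + 2) (n + 2) (n + 2))) = _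
    simp only [mulN_eq le_rfl]
    ring
  · rw [← inputState_thr (G := G)]
    exact hover (fun u => (inputState G τ).thr u - ((inputState G τ).thr u - n)) _ u
  · rw [← inputState_thr (G := G)]
    exact hover (fun u => (inputState G τ).thr u - n) _ u

theorem Pending.start {k : ℕ} {s : State} (h : Pending G τ k s) : Pending G τ (k + 1) s.start := by
  have hle : s.n + 2 ≤ s.N := by
    rw [h.range, h.order]
    exact Nat.le_self_pow (by omega) _
  refine ⟨h.order, congrArg (· + 1) h.slots, ?_, h.done, h.adj, h.T, h.out⟩
  change mulN s.N (s.n + 2) (mulN s.N (s.n + 2) (mulN s.N (s.n + 2) s.N)) = _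
  simp only [mulN_eq hle]
  rw [h.range, h.order]
  ring

theorem Pending.edge {k : ℕ} {s : State} (h : Pending G τ k s) : s.E = natAdj G := by
  have hle : n ≤ s.N := by
    rw [h.range]
    exact (Nat.le_add_right n 2).trans (Nat.le_self_pow (by omega) _)
  funext y u
  refine propext ⟨fun ⟨hy, hu, hadj⟩ => ?_, fun hadj => ?_⟩
  · rw [h.order] at hy hu hadj
    rw [mulN_eq (by omega), h.adj] at hadj
    exact (inputState_adj hu).1 hadj
  · have hu : u < n := hadj.2.1
    refine ⟨h.order ▸ hadj.1, h.order ▸ hu, ?_⟩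
    rw [h.order, mulN_eq (by have := hadj.1; omega), h.adj]
    exact (inputState_adj hu).2 hadj

/-- A stage either finds an optimal partial incentive, or the slots do not suffice. -/
theorem Pending.stage {k : ℕ} {s : State} (h : Pending G τ k s) :
    (Pending G τ (k + 1) s.stage ∧ ¬ Deriv n (k + 1) (natAdj G) (fun _ => n) n 0) ∨
      (s.stage.done = 1 ∧ IsOptimalPartialIncentive G τ fun u => s.stage.out u) := by
  have h1 := h.start
  have hN : s.start.N = (s.start.n + 2) ^ (3 * s.start.K + 4) := by
    rw [h1.range, h1.order, h1.slots]
  have hreach := State.reachClosure_correct hN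
  obtain ⟨A, hA⟩ : ∃ A, s.start.reachClosure = { s.start with reach := A } :=
    ⟨_, State.reachClosure_eq _⟩
  set r := s.start.reachClosure with hr
  have h2 : Pending G τ (k + 1) r := by
    rw [hA]
    exact ⟨h1.order, h1.slots, h1.range, h1.done, h1.adj, h1.T, h1.out⟩
  have hrN : r.N = (r.n + 2) ^ (3 * r.K + 4) := by
    rw [h2.range, h2.order, h2.slots]
  have hrz : r.z = n := by
    rw [hA]
    exact h.order
  have htab : s.tables = r.itemClosure := rfl
  have hsymm : ∀ u v, natAdj G u v → natAdj G v u := fun u v ⟨a, b, c⟩ => ⟨b, a, c.symm⟩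
  have hready : Deriv n (k + 1) (natAdj G) (fun _ => n) n 0 → r.Ready n (natAdj G) := fun hd =>
    ⟨h2.order, h2.edge, hsymm, hrN, hreach, fun u hu => by
      rw [show r.T u = _ from h2.T ⟨u, hu⟩]
      omega, h2.slots ▸ hd⟩
  have hle := State.n_lt_of_N_eq hrN
  rw [h2.order] at hle
  by_cases hex : ∃ q < s.tables.N, s.tables.Decides q
  · right
    rw [State.stage, if_pos hex, htab]
    obtain ⟨a, ha, hda⟩ := hex
    rw [htab] at ha hda
    rw [State.itemClosure_N] at ha
    -- The item that was found certifies a derivation, so the answers are exact whatever the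
    -- treewidth is compared to the number of slots.
    have hd := State.deriv_of_decides hrN hreach hda
    rw [h2.order, h2.slots, h2.edge] at hd
    obtain ⟨q, hmin, hopt, hq⟩ := (hready hd).finish (thr := fun u => r.out u + r.T u) hrz
      (fun _ _ => rfl) ha hda
    refine ⟨hopt.done, isPartialIncentive_iff.2 ?_, fun σ' hσ' => ?_⟩
    · obtain ⟨P, hP⟩ := hopt.feasible
      rw [hq, Nat.le_zero, Finset.sum_eq_zero_iff] at hP
      refine ⟨P, fun v => ?_⟩
      have h3 := hP v (Finset.mem_range.2 v.2)
      have h4 := hopt.split v v.2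
      have h5 := h2.T v
      have h6 := h2.out v
      beta_reduce at h4 ⊢
      omega
    · obtain ⟨P, hP⟩ := isPartialIncentive_iff.1 hσ'
      have h3 := hmin _ ⟨P, le_rfl⟩
      have h4 := hopt.weight
      rw [hq, add_zero] at h4
      have h5 : weight (fun u : Fin n => r.itemClosure.finish.out u) =
          ∑ u ∈ Finset.range n, r.itemClosure.finish.out u :=
        Fin.sum_univ_eq_sum_range (fun u => r.itemClosure.finish.out u) n
      rw [h5, h4]
      -- The comparison is made at each vertex. At most `n` neighbours come earlier, so every
      -- incentive pays the part of a threshold above `n`, besides the deficit of the truncated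
      -- threshold.
      refine (Nat.add_le_add_left h3 _).trans ?_
      rw [← Finset.sum_add_distrib, ← Fin.sum_univ_eq_sum_range
        (fun u => r.out u + (r.T u - before n (natAdj G) P Set.univ u (P u)))]
      refine Finset.sum_le_sum fun v _ => ?_
      have h6 := h2.T v
      have h7 := h2.out v
      have h8 := hP v
      have h9 := before_le n (natAdj G) P Set.univ v (P v)
      omega
  · left
    rw [State.stage, if_neg hex]
    obtain ⟨B, hB⟩ : ∃ B, s.tables = { r with tab := B } := ⟨_, State.itemClosure_eq _⟩
    constructor
    · rw [hB]
      exact ⟨h2.order, h2.slots, h2.range, h2.done, h2.adj, h2.T, h2.out⟩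
    · intro hd
      -- Truncated thresholds add up to at most `n * n`, so this weight suffices for any labelling,
      -- and it lies in the range.
      refine hex ⟨n * n, ?_, ?_⟩
      · rw [htab, State.itemClosure_N, h2.range]
        calc n * n < (n + 2) ^ 2 := by nlinarith
          _ ≤ _ := Nat.pow_le_pow_right (by omega) (by omega)
      · rw [htab, (hready hd).decides_iff_feasible]
        refine ⟨fun _ => 0, ?_⟩
        calc _ ≤ ∑ v ∈ Finset.range n, n := Finset.sum_le_sum fun v hv =>
              (Nat.sub_le _ _).trans <| (Nat.sub_le _ _).trans <|
                (hready hd).le v (Finset.mem_range.1 hv)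
          _ = n * n := by simp

/-- `d` is the number of stages that may still fail: with `w + 1` slots a derivation exists, so that
stage cannot fail. -/
theorem Pending.stages {w : ℕ} (hG : TreewidthAtMost G w) (d : ℕ) :
    ∀ (k : ℕ) (s : State), k + d = w → Pending G τ k s → ∃ j ≤ d + 1,
      (∀ i < j, Pending G τ (k + i) (State.stage^[i] s)) ∧ (State.stage^[j] s).done = 1 ∧
      IsOptimalPartialIncentive G τ fun u => (State.stage^[j] s).out u := by
  induction d with
  | zero =>
    rintro k s rfl h
    refine ⟨1, le_rfl, fun i hi => ?_, ?_⟩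
    · obtain rfl : i = 0 := by omega
      exact h
    · rcases h.stage with ⟨-, h1⟩ | h1
      · exact absurd (deriv_of_treewidth hG) h1
      · exact h1
  | succ d ih =>
    intro k s hk h
    rcases h.stage with ⟨h1, -⟩ | h1
    · obtain ⟨j, hj, h2, h3⟩ := ih (k + 1) s.stage (by omega) h1
      refine ⟨j + 1, by omega, fun i hi => ?_, h3⟩
      cases i with
      | zero => exact h
      | succ i =>
        rw [show k + (i + 1) = k + 1 + i by omega]
        exact h2 i (by omega)
    · refine ⟨1, by omega, fun i hi => ?_, h1⟩
      obtain rfl : i = 0 := by omega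
      exact h

end Stages

/-- For `n ≤ 1` powers of `n` cannot absorb a factor that depends on `w`, so these graphs are
treated with width 0. -/
theorem treewidthAtMost_zero {n : ℕ} (hn : n ≤ 1) (G : SimpleGraph (Fin n)) :
    TreewidthAtMost G 0 := by
  refine ⟨{
    Node := Unit
    tree := ⊥
    isTree := .of_subsingleton
    bag := fun _ => Finset.univ
    cover := fun u => ⟨(), Finset.mem_univ u⟩
    edge := fun u v _ => ⟨(), Finset.mem_univ u, Finset.mem_univ v⟩
    subtree := fun u => ?_ }, ?_⟩
  · have : Nonempty {t : Unit | u ∈ (Finset.univ : Finset (Fin n))} := ⟨(), Finset.mem_univ u⟩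
    exact ⟨.of_subsingleton⟩
  · simp [TreeDecomposition.width]
    omega

/-- Some program computes optimal partial incentives, with a time bound in terms of the width. -/
theorem exists_program_time : ∃ (P : Program) (C : ℕ), ∀ (w n : ℕ) (G : SimpleGraph (Fin n))
    (τ : Fin n → ℤ), TreewidthAtMost G w → ∃ (m : Memory) (t : ℕ) (σ : Fin n → ℕ),
      Exec P (inputMemory G τ) m t ∧
      t ≤ C + C * (n + 3) ^ C + 2 + (w + 1) * (C * (n + 2) ^ ((3 * w + 5) * C) + 1) ∧
      m.Outputs σ ∧ IsOptimalPartialIncentive G τ σ := by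
  obtain ⟨P, C, h⟩ := exists_program
  refine ⟨P, C, fun w n G τ hG => ?_⟩
  obtain ⟨j, hj, hpend, hdone, hopt⟩ :=
    Pending.stages hG w 0 _ (by omega) (pending_initialState (τ := τ))
  obtain ⟨m, t, hexec, hrep, ht⟩ := h (inputState G τ) (inputMemory G τ) j represents_inputState
    (fun i hi => (hpend i hi).done) hdone
  refine ⟨m, t, _, hexec, ht.trans ?_, fun u => hrep.out u, hopt⟩
  change C * (0 + 1) ^ C + C * (n + 3) ^ C + 2 + ∑ i ∈ Finset.range j,
    (C * ((State.stage^[i] (initialState G τ)).N + 1) ^ C + 1) ≤ _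
  have hterm : ∀ i ∈ Finset.range j, C * ((State.stage^[i] (initialState G τ)).N + 1) ^ C + 1 ≤
      C * (n + 2) ^ ((3 * w + 5) * C) + 1 := by
    intro i hi
    rw [Finset.mem_range] at hi
    rw [(hpend i hi).range, pow_mul]
    refine Nat.add_le_add_right (Nat.mul_le_mul_left _ (Nat.pow_le_pow_left ?_ _)) _
    have h1 : (n + 2) ^ (3 * (0 + i) + 4) ≤ (n + 2) ^ (3 * w + 4) :=
      Nat.pow_le_pow_right (by omega) (by omega)
    have h2 : 1 ≤ (n + 2) ^ (3 * w + 4) := Nat.one_le_pow _ _ (by omega)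
    rw [show 3 * w + 5 = 3 * w + 4 + 1 by omega, pow_succ (n + 2) (3 * w + 4)]
    nlinarith
  have hsum := Finset.sum_le_sum hterm
  rw [Finset.sum_const, Finset.card_range, smul_eq_mul] at hsum
  rw [zero_add, one_pow, mul_one]
  exact Nat.add_le_add_left (hsum.trans (Nat.mul_le_mul_right _ hj)) _

/-- With `M = max w 1` and `n ≥ 2` one has `n + 3 ≤ n ^ 3`, `n + 2 ≤ n ^ 2` and `w + 1 ≤ n ^ M`. The
main exponent is `2 * (3 * w + 5) * C ≤ 16 * M * C`, and the factor `w + 1` adds another `M`. -/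
theorem time_le {C w n : ℕ} (hn : 2 ≤ n) :
    C + C * (n + 3) ^ C + 2 + (w + 1) * (C * (n + 2) ^ ((3 * w + 5) * C) + 1) ≤
      (17 * C + 17) * n ^ ((17 * C + 17) * max w 1) + (17 * C + 17) := by
  obtain ⟨M, hM⟩ : ∃ M, max w 1 = M := ⟨_, rfl⟩
  have hw : w ≤ M := hM ▸ le_max_left _ _
  have h1 : 1 ≤ M := hM ▸ le_max_right _ _
  rw [hM]
  set X := n ^ ((17 * C + 17) * M) with hX
  have hpow : ∀ {e : ℕ}, e ≤ (17 * C + 17) * M → n ^ e ≤ X := fun h =>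
    Nat.pow_le_pow_right (by omega) h
  have h2 : (n + 3) ^ C ≤ X := by
    calc (n + 3) ^ C ≤ (n ^ 3) ^ C := Nat.pow_le_pow_left (by nlinarith [Nat.pow_le_pow_left hn 2]) C
      _ = n ^ (3 * C) := (pow_mul _ _ _).symm
      _ ≤ X := hpow (by nlinarith)
  have h3 : w + 1 ≤ n ^ M := by
    calc w + 1 ≤ 2 ^ w := Nat.lt_two_pow_self
      _ ≤ 2 ^ M := Nat.pow_le_pow_right (by omega) hw
      _ ≤ n ^ M := Nat.pow_le_pow_left hn M
  have h4 : (n + 2) ^ ((3 * w + 5) * C) ≤ n ^ (16 * M * C) := by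
    calc (n + 2) ^ ((3 * w + 5) * C) ≤ (n ^ 2) ^ ((3 * w + 5) * C) :=
          Nat.pow_le_pow_left (by nlinarith) _
      _ = n ^ (2 * ((3 * w + 5) * C)) := (pow_mul _ _ _).symm
      _ ≤ n ^ (16 * M * C) := Nat.pow_le_pow_right (by omega) (by
          rw [← mul_assoc]
          exact Nat.mul_le_mul_right _ (by omega))
  have h5 : (w + 1) * (n + 2) ^ ((3 * w + 5) * C) ≤ X := by
    refine (Nat.mul_le_mul h3 h4).trans ?_
    rw [← pow_add]
    exact hpow (by nlinarith [Nat.zero_le (M * C)])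
  have h6 : w + 1 ≤ X := h3.trans (hpow (by nlinarith [Nat.zero_le (M * C)]))
  nlinarith [Nat.mul_le_mul_left C h5, Nat.mul_le_mul_left C h2]

theorem exists_program_polynomial :
    ∃ (P : Program) (c : ℕ),
      ∀ (w n : ℕ) (G : SimpleGraph (Fin n)) (τ : Fin n → ℤ), TreewidthAtMost G w →
        ∃ (m : Memory) (t : ℕ) (σ : Fin n → ℕ),
          Exec P (inputMemory G τ) m t ∧
          t ≤ c * n ^ (c * max w 1) + c ∧
          m.Outputs σ ∧
          IsOptimalPartialIncentive G τ σ := by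
  obtain ⟨P, C, h⟩ := exists_program_time
  -- The last two terms bound the time for `n ≤ 1`, where `n + 3 ≤ 4` and `n + 2 ≤ 3`.
  set c := 17 * C + 17 + (C * 4 ^ C + C * 3 ^ (5 * C)) with hc
  refine ⟨P, c, fun w n G τ hG => ?_⟩
  rcases Nat.lt_or_ge n 2 with hn | hn
  · obtain ⟨m, t, σ, h1, h2, h3⟩ := h 0 n G τ (treewidthAtMost_zero (by omega) G)
    refine ⟨m, t, σ, h1, h2.trans (le_trans ?_ (Nat.le_add_left _ _)), h3⟩
    have h4 : C * (n + 3) ^ C ≤ C * 4 ^ C :=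
      Nat.mul_le_mul_left _ (Nat.pow_le_pow_left (by omega) _)
    have h5 : C * (n + 2) ^ (5 * C) ≤ C * 3 ^ (5 * C) :=
      Nat.mul_le_mul_left _ (Nat.pow_le_pow_left (by omega) _)
    simp only [mul_zero, zero_add, one_mul]
    omega
  · obtain ⟨m, t, σ, h1, h2, h3⟩ := h w n G τ hG
    refine ⟨m, t, σ, h1, h2.trans ((time_le hn).trans ?_), h3⟩
    have hle : 17 * C + 17 ≤ c := Nat.le_add_right _ _
    exact Nat.add_le_add (Nat.mul_le_mul hle (Nat.pow_le_pow_right (by omega)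
      (Nat.mul_le_mul_right _ hle))) hle

end Incentive

theorem theorem5 :
    ∃ (P : Incentive.Program) (c : ℕ),
      ∀ (w n : ℕ) (G : SimpleGraph (Fin n)) (τ : Fin n → ℤ), Incentive.TreewidthAtMost G w →
        ∃ (m : Incentive.Memory) (t : ℕ) (σ : Fin n → ℕ),
          Incentive.Exec P (Incentive.inputMemory G τ) m t ∧
          t ≤ c * n ^ (c * max w 1) + c ∧
          m.Outputs σ ∧
          Incentive.IsOptimalPartialIncentive G τ σ :=
  Incentive.exists_program_polynomial
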